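/- Let $(M,\omega)$ be a compact symplectic manifold of dimension $2n$ (smooth, Hausdorff, without boundary). A compatible almost complex structure on $(M,\omega)$ is a smooth almost complex structure $J$ with $\omega(J\cdot,J\cdot)=\omega$ and $\omega(v,Jv)>0$ for $v\neq 0$; write $g_J(u,v)=\omega(u,Jv)$ for the associated Riemannian metric and $TM_\varepsilon=\{(m,v)\in TM : g_J(v,v)<\varepsilon^2\}$. Let $B_\varepsilon\subset\mathbb R^{2n}$ be the open ball of radius $\varepsilon$ with the standard symplectic form. A (continuous) twisted family of symplectic embeddings of $B_\varepsilon$ into $M$ parametrized by a space $X$ is a fibre bundle $B_\varepsilon\to P\to X$ with a continuous map $\Phi:P\to M$ such that $X$ is covered by domains of local trivializations $e$ for which every map $b\mapsto\Phi(e^{-1}(x,b))$ is a symplectic embedding $B_\varepsilon\to M$. It is smooth if $X$ and $P$ are smooth manifolds, $\Phi$ is smooth and these trivializations can be taken to be diffeomorphisms. Then compatible almost complex structures on $(M,\omega)$ exist, and for each such $J$ there is $\varepsilon_0>0$ such that for every $0<\varepsilon\le\varepsilon_0$ there is a smooth map $\phi:TM_\varepsilon\to M$ with the following properties. 1. $\phi(0_m)=m$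 for every $m\in M$, and the restriction of $\phi$ to each fibre $(T_mM)_\varepsilon$, identified with $B_\varepsilon$ by any unitary frame of $(T_mM,\omega_m,J_m)$, is a symplectic embedding $B_\varepsilon\to M$. 2. (Thickening property.) For every topological space $X$ and every continuous map $f:X\to M$, the pull-back $f^*TM_\varepsilon\to X$ together with $\phi\circ\hat f: f^*TM_\varepsilon\to M$, where $\hat f:f^*TM_\varepsilon\to TM_\varepsilon$ is the canonical map, is a continuous twisted family of symplectic embeddings of $B_\varepsilon$ into $M$ parametrized by $X$. If $X$ is a smooth manifold and $f$ is smooth, it is a smooth twisted family. -/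

import Mathlib

open Bundle Manifold ContDiff Topology TopologicalSpace

noncomputable section

/-- The real vector space `ℝ²ⁿ` with coordinates `(x₁, …, xₙ, y₁, …, yₙ)`, where `xᵢ` is the
coordinate `Sum.inl i` and `yᵢ` is the coordinate `Sum.inr i`. -/
abbrev StdSpace (n : ℕ) : Type := EuclideanSpace ℝ (Fin n ⊕ Fin n)

/-- The standard symplectic form `∑ᵢ dxᵢ ∧ dyᵢ` on `ℝ²ⁿ`. -/
def stdForm (n : ℕ) (u v : StdSpace n) : ℝ :=
  ∑ i : Fin n, (u (Sum.inl i) * v (Sum.inr i) - u (Sum.inr i) * v (Sum.inl i))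

/-- The standard complex structure on `ℝ²ⁿ`: `∂/∂xᵢ ↦ ∂/∂yᵢ`, `∂/∂yᵢ ↦ -∂/∂xᵢ`. -/
def stdJ (n : ℕ) (v : StdSpace n) : StdSpace n :=
  WithLp.toLp 2 (Sum.elim (fun i => -v (Sum.inr i)) (fun i => v (Sum.inl i)))

theorem stdForm_stdJ (n : ℕ) (v : StdSpace n) : stdForm n v (stdJ n v) = ‖v‖ ^ 2 := by
  simp only [stdForm, stdJ, EuclideanSpace.real_norm_sq_eq, Fintype.sum_sum_type,
    Sum.elim_inl, Sum.elim_inr, ← Finset.sum_add_distrib]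
  exact Finset.sum_congr rfl fun i _ => by ring

/-- The standard open ball `B_ε ⊆ ℝ²ⁿ` of radius `ε`, as an open submanifold. -/
def stdBall (n : ℕ) (ε : ℝ) : Opens (StdSpace n) := ⟨Metric.ball 0 ε, Metric.isOpen_ball⟩

/-- A field of bilinear forms on the tangent spaces, written in the preferred chart at `x`:
its pull-back along the inverse of that chart, a function on `ℝ^d` with values in bilinear
forms. -/
def formInChart {d : ℕ} {M : Type*} [TopologicalSpace M]
    [ChartedSpace (EuclideanSpace ℝ (Fin d)) M]
    (σ : ∀ m : M, TangentSpace (𝓡 d) m →L[ℝ] TangentSpace (𝓡 d) m →L[ℝ] ℝ) (x : M)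
    (y : EuclideanSpace ℝ (Fin d)) :
    EuclideanSpace ℝ (Fin d) →L[ℝ] EuclideanSpace ℝ (Fin d) →L[ℝ] ℝ :=
  let D : EuclideanSpace ℝ (Fin d) →L[ℝ] EuclideanSpace ℝ (Fin d) :=
    mfderiv 𝓘(ℝ, EuclideanSpace ℝ (Fin d)) (𝓡 d) (extChartAt (𝓡 d) x).symm y
  let B : EuclideanSpace ℝ (Fin d) →L[ℝ] EuclideanSpace ℝ (Fin d) →L[ℝ] ℝ :=
    σ ((extChartAt (𝓡 d) x).symm y)
  B.bilinearComp D D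

/-- A symplectic form on a smooth manifold of dimension `2n`: a smooth closed nondegenerate
2-form. -/
structure SymplecticForm (n : ℕ) (M : Type*) [TopologicalSpace M]
    [ChartedSpace (EuclideanSpace ℝ (Fin (2 * n))) M] [IsManifold (𝓡 (2 * n)) ∞ M] where
  /-- The bilinear form on each tangent space. -/
  form : ∀ m : M, TangentSpace (𝓡 (2 * n)) m →L[ℝ] TangentSpace (𝓡 (2 * n)) m →L[ℝ] ℝ
  alternating : ∀ (m : M) (v : TangentSpace (𝓡 (2 * n)) m), form m v v = 0
  smooth : ContMDiff (𝓡 (2 * n))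
    ((𝓡 (2 * n)).prod 𝓘(ℝ, EuclideanSpace ℝ (Fin (2 * n)) →L[ℝ]
      EuclideanSpace ℝ (Fin (2 * n)) →L[ℝ] ℝ)) ∞
    (fun m => TotalSpace.mk' (EuclideanSpace ℝ (Fin (2 * n)) →L[ℝ]
      EuclideanSpace ℝ (Fin (2 * n)) →L[ℝ] ℝ)
      (E := fun m : M => TangentSpace (𝓡 (2 * n)) m →L[ℝ] TangentSpace (𝓡 (2 * n)) m →L[ℝ] ℝ)
      m (form m))
  /-- The exterior derivative vanishes, in local coordinates: for the local representative `α`,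
  `(D_u α)(v, w) + (D_v α)(w, u) + (D_w α)(u, v) = 0`. -/
  closed : ∀ x : M, ∀ y ∈ (extChartAt (𝓡 (2 * n)) x).target,
    ∀ u v w : EuclideanSpace ℝ (Fin (2 * n)),
      fderiv ℝ (formInChart form x) y u v w + fderiv ℝ (formInChart form x) y v w u
        + fderiv ℝ (formInChart form x) y w u v = 0
  nondegenerate : ∀ (m : M) (v : TangentSpace (𝓡 (2 * n)) m), (∀ w, form m v w = 0) → v = 0

/-- A smooth almost complex structure `J` compatible with the symplectic form `σ`:
`J² = -1`, `σ(J·, J·) = σ`, and `σ(v, Jv) > 0` for `v ≠ 0`. The associated Riemannian metric is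
`g_J(u, v) = σ(u, Jv)`. -/
structure CompatibleACS {n : ℕ} {M : Type*} [TopologicalSpace M]
    [ChartedSpace (EuclideanSpace ℝ (Fin (2 * n))) M] [IsManifold (𝓡 (2 * n)) ∞ M]
    (σ : SymplecticForm n M) where
  /-- The endomorphism of each tangent space. -/
  J : ∀ m : M, TangentSpace (𝓡 (2 * n)) m →L[ℝ] TangentSpace (𝓡 (2 * n)) m
  smooth : ContMDiff (𝓡 (2 * n))
    ((𝓡 (2 * n)).prod 𝓘(ℝ, EuclideanSpace ℝ (Fin (2 * n)) →L[ℝ] EuclideanSpace ℝ (Fin (2 * n)))) ∞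
    (fun m => TotalSpace.mk' (EuclideanSpace ℝ (Fin (2 * n)) →L[ℝ] EuclideanSpace ℝ (Fin (2 * n)))
      (E := fun m : M => TangentSpace (𝓡 (2 * n)) m →L[ℝ] TangentSpace (𝓡 (2 * n)) m) m (J m))
  sq : ∀ (m : M) (v : TangentSpace (𝓡 (2 * n)) m), J m (J m v) = -v
  compatible : ∀ (m : M) (u v : TangentSpace (𝓡 (2 * n)) m),
    σ.form m (J m u) (J m v) = σ.form m u v
  pos : ∀ (m : M) (v : TangentSpace (𝓡 (2 * n)) m), v ≠ 0 → 0 < σ.form m v (J m v)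

section

variable {n : ℕ} {M : Type*} [TopologicalSpace M]
  [ChartedSpace (EuclideanSpace ℝ (Fin (2 * n))) M] [IsManifold (𝓡 (2 * n)) ∞ M]

/-- The squared length of tangent vectors for the metric `g_J` is a continuous function. -/
theorem CompatibleACS.continuous_sqNorm {σ : SymplecticForm n M} (J : CompatibleACS σ) :
    Continuous (fun p : TangentBundle (𝓡 (2 * n)) M => σ.form p.proj p.2 (J.J p.proj p.2)) := by
  have hp : ContMDiff (𝓡 (2 * n)).tangent (𝓡 (2 * n)) ∞
      (fun p : TangentBundle (𝓡 (2 * n)) M => p.proj) := contMDiff_proj _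
  have hv : ContMDiff (𝓡 (2 * n)).tangent (𝓡 (2 * n)).tangent ∞
      (fun p : TangentBundle (𝓡 (2 * n)) M =>
        TotalSpace.mk' (EuclideanSpace ℝ (Fin (2 * n)))
          (E := fun m : M => TangentSpace (𝓡 (2 * n)) m) p.proj p.2) := contMDiff_id
  have hJ := (J.smooth.comp hp).clm_bundle_apply (v := fun p => p.2) hv
  have h := (σ.smooth.comp hp).clm_bundle_apply₂ (F₃ := ℝ) (E₃ := Bundle.Trivial M ℝ)
    (v := fun p : TangentBundle (𝓡 (2 * n)) M => p.2)
    (w := fun p : TangentBundle (𝓡 (2 * n)) M => J.J p.proj p.2) hv hJ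
  exact continuous_iff_continuousAt.2 fun p =>
    ((Bundle.contMDiffAt_totalSpace.1 (h p)).2).continuousAt

/-- The `ε`-ball bundle `TM_ε = {(m, v) : g_J(v, v) < ε²}`, an open submanifold of `TM`. -/
def discBundle {σ : SymplecticForm n M} (J : CompatibleACS σ) (ε : ℝ) :
    Opens (TangentBundle (𝓡 (2 * n)) M) :=
  ⟨{p | σ.form p.proj p.2 (J.J p.proj p.2) < ε ^ 2},
    isOpen_lt J.continuous_sqNorm continuous_const⟩

/-- A unitary frame at `m`: a linear isomorphism `ℝ²ⁿ ≅ T_m M` carrying the standard symplectic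
form and complex structure to `σ_m` and `J_m`. -/
structure IsUnitaryFrame {σ : SymplecticForm n M} (J : CompatibleACS σ) (m : M)
    (L : StdSpace n ≃L[ℝ] TangentSpace (𝓡 (2 * n)) m) : Prop where
  form : ∀ u v, σ.form m (L u) (L v) = stdForm n u v
  complex : ∀ v, L (stdJ n v) = J.J m (L v)

/-- The inclusion `B_ε → TM_ε` of the fibre over `m`, for the identification of the fibre with
the standard ball that is given by a unitary frame at `m`. -/
def fibreInclusion {σ : SymplecticForm n M} {J : CompatibleACS σ} {m : M}
    {L : StdSpace n ≃L[ℝ] TangentSpace (𝓡 (2 * n)) m} (hL : IsUnitaryFrame J m L) (ε : ℝ)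
    (b : stdBall n ε) : discBundle J ε :=
  ⟨⟨m, L b⟩, by
    have hb : ‖(b : StdSpace n)‖ < ε := mem_ball_zero_iff.1 b.2
    change σ.form m (L b) (J.J m (L b)) < ε ^ 2
    rw [← hL.complex, hL.form, stdForm_stdJ]
    exact pow_lt_pow_left₀ hb (norm_nonneg _) two_ne_zero⟩

/-- The zero vector at `m`, as a point of `TM_ε`. -/
def discZero {σ : SymplecticForm n M} (J : CompatibleACS σ) {ε : ℝ} (hε : 0 < ε) (m : M) :
    discBundle J ε :=
  ⟨⟨m, 0⟩, by
    change σ.form m 0 (J.J m 0) < ε ^ 2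
    simpa using pow_pos hε 2⟩

/-- A symplectic embedding of the standard ball `B_ε` into `(M, σ)`: a smooth map which is a
homeomorphism onto its image and pulls `σ` back to the standard symplectic form. (Its
differential is then injective, since the standard form is nondegenerate.) -/
structure IsSymplecticEmbedding (σ : SymplecticForm n M) {ε : ℝ} (g : stdBall n ε → M) : Prop where
  smooth : ContMDiff 𝓘(ℝ, StdSpace n) (𝓡 (2 * n)) ∞ g
  embedding : IsEmbedding g
  symplectic : ∀ (b : stdBall n ε) (u v : StdSpace n),
    σ.form (g b) (mfderiv 𝓘(ℝ, StdSpace n) (𝓡 (2 * n)) g b u)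
      (mfderiv 𝓘(ℝ, StdSpace n) (𝓡 (2 * n)) g b v) = stdForm n u v

/-- A continuous twisted family of symplectic embeddings of `B_ε` into `(M, σ)` parametrized by
`X`: a fibre bundle `p : P → X` with fibre `B_ε` and a continuous map `Φ : P → M` whose
restriction to each fibre is a symplectic embedding. -/
structure IsTwistedFamily (σ : SymplecticForm n M) (ε : ℝ) {X P : Type*} [TopologicalSpace X]
    [TopologicalSpace P] (p : P → X) (Φ : P → M) : Prop where
  continuous : Continuous Φ
  locallyTrivial : ∀ x : X, ∃ e : Trivialization (stdBall n ε) p, x ∈ e.baseSet ∧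
    ∀ y ∈ e.baseSet,
      IsSymplecticEmbedding σ (fun b => Φ (e.toOpenPartialHomeomorph.symm (y, b)))

/-- A smooth twisted family of symplectic embeddings of `B_ε` into `(M, σ)` parametrized by the
manifold `X`: as above, where `P` is a smooth manifold, `p : P → X` is a smooth fibre bundle
(its local trivializations are diffeomorphisms) and `Φ` is smooth. -/
structure IsSmoothTwistedFamily (σ : SymplecticForm n M) (ε : ℝ)
    {EX HX X EP HP P : Type*}
    [NormedAddCommGroup EX] [NormedSpace ℝ EX] [TopologicalSpace HX] (IX : ModelWithCorners ℝ EX HX)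
    [TopologicalSpace X] [ChartedSpace HX X]
    [NormedAddCommGroup EP] [NormedSpace ℝ EP] [TopologicalSpace HP] (IP : ModelWithCorners ℝ EP HP)
    [TopologicalSpace P] [ChartedSpace HP P] (p : P → X) (Φ : P → M) : Prop where
  smooth : ContMDiff IP (𝓡 (2 * n)) ∞ Φ
  locallyTrivial : ∀ x : X, ∃ e : Trivialization (stdBall n ε) p, x ∈ e.baseSet ∧
    ContMDiffOn IP (IX.prod 𝓘(ℝ, StdSpace n)) ∞ e e.source ∧
    ContMDiffOn (IX.prod 𝓘(ℝ, StdSpace n)) IP ∞ e.toOpenPartialHomeomorph.symm e.target ∧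
    ∀ y ∈ e.baseSet,
      IsSymplecticEmbedding σ (fun b => Φ (e.toOpenPartialHomeomorph.symm (y, b)))

/-- The pull-back `f^* TM_ε` of the `ε`-ball bundle along a continuous map `f : X → M`, an open
subset of the pull-back bundle `f^* TM`. -/
def pullbackDisc {σ : SymplecticForm n M} (J : CompatibleACS σ) (ε : ℝ) {X K : Type*}
    [TopologicalSpace X] [FunLike K X M] [ContinuousMapClass K X M] (f : K) :
    Opens (TotalSpace (EuclideanSpace ℝ (Fin (2 * n)))
      ((f : X → M) *ᵖ (TangentSpace (𝓡 (2 * n)) : M → Type))) :=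
  ⟨Pullback.lift f ⁻¹' (discBundle J ε),
    (discBundle J ε).isOpen.preimage (Pullback.continuous_lift _ _ _)⟩

/-- The bundle projection `f^* TM_ε → X`. -/
def pullbackDiscProj {σ : SymplecticForm n M} (J : CompatibleACS σ) (ε : ℝ) {X K : Type*}
    [TopologicalSpace X] [FunLike K X M] [ContinuousMapClass K X M] (f : K)
    (p : pullbackDisc J ε f) : X := p.1.proj

/-- The canonical bundle map `f^* TM_ε → TM_ε` covering `f`. -/
def pullbackDiscLift {σ : SymplecticForm n M} (J : CompatibleACS σ) (ε : ℝ) {X K : Type*}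
    [TopologicalSpace X] [FunLike K X M] [ContinuousMapClass K X M] (f : K)
    (p : pullbackDisc J ε f) : discBundle J ε := ⟨Pullback.lift f p.1, p.2⟩

/-- `φ : TM_ε → M` is a smooth map that sends the zero vector at each `m` to `m` and whose
restriction to each fibre, identified with `B_ε` by a unitary frame, is a symplectic embedding. -/
structure IsThickening {σ : SymplecticForm n M} (J : CompatibleACS σ) {ε : ℝ} (hε : 0 < ε)
    (φ : discBundle J ε → M) : Prop where
  smooth : ContMDiff (𝓡 (2 * n)).tangent (𝓡 (2 * n)) ∞ φ
  zero : ∀ m, φ (discZero J hε m) = m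
  fibre : ∀ (m : M) (L : StdSpace n ≃L[ℝ] TangentSpace (𝓡 (2 * n)) m)
    (hL : IsUnitaryFrame J m L), IsSymplecticEmbedding σ (φ ∘ fibreInclusion hL ε)

end

end

/-! The map `φ` is a symplectic substitute for the exponential map. In a chart, the translations `v
↦ y + v` are tangent to the identity at `v = 0`, and pulling `ω` back along them gives closed forms
`β (y, v)` with `β (y, 0) = ω_y`. Moser's argument, run with `y` as a parameter, produces germs `θ
(y, ·)` at `0` with `θ (y, 0) = 0` and derivative the identity there, which pull `β (y, ·)` back to
the constant form `ω_y`. Translation by `θ (y, v)` is then symplectic on each fibre, near the zero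
section (`IsSymplecticGerm.timeOne_moserField`).

Charts are glued by one further property of this construction: if `β (y, ·)` is already constant,
the Moser field vanishes and `θ (y, ·)` is the identity. Given a solution over part of `M` and a
bump function in a new chart, interpolate fibrewise with translations in that chart and correct by
Moser. Where the bump vanishes nothing changes, so the result extends the old solution
(`IsThickeningGerm.exists_extension`, `exists_isThickeningNear_of_bump`). A finite cover gives `φ`
near the whole zero section. For this the corrected map has to be a single function, not one germ
per base point; `timeOne` therefore selects flow lines by minimal norm.

The flow comes from the inverse function theorem in the Banach space of curves on `[0, 1]`.
Superposition `γ ↦ f ∘ γ` is smooth there (`contDiffOn_superpose`), and the Moser field vanishes to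
first order on the zero section, so the linearised flow equation is the identity (`exists_flow`).
The same superposition theorem differentiates integrals depending on a parameter.

Compatible almost complex structures exist locally, by transporting the standard structure along
symplectic frames, and are glued along the Cayley path, an explicit path in the space of compatible
structures that is natural under conjugation (`IsCompatible.cayleyPath`, `cayleyPath_conj`).

Compactness of `M` gives one radius `r` on which `φ` is smooth, fibrewise symplectic and fibrewise
injective. For `ε < r` each fibre map extends injectively to a compact closed ball, so it is an
embedding. The thickening property follows from smooth local unitary frames
(`exists_isUnitaryFrameOn`): they trivialize the pulled-back disc bundle so that the family
restricted to a fibre is exactly `φ` in a unitary frame. -/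

noncomputable section

set_option linter.unusedSectionVars false

universe u

/-! ### Calculus of germs of smooth maps and the inverse function theorem -/

section SmoothNear

variable {E F G H : Type*} [NormedAddCommGroup E] [NormedSpace ℝ E] [NormedAddCommGroup F]
  [NormedSpace ℝ F] [NormedAddCommGroup G] [NormedSpace ℝ G] [NormedAddCommGroup H]
  [NormedSpace ℝ H]

/-- `f` is smooth at every point of some neighbourhood of `z`. -/
def SmoothNear (f : E → F) (z : E) : Prop := ∀ᶠ w in 𝓝 z, ContDiffAt ℝ ∞ f w

namespace SmoothNear

theorem contDiffAt {f : E → F} {z : E} (h : SmoothNear f z) : ContDiffAt ℝ ∞ f z :=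
  h.self_of_nhds

theorem continuousAt {f : E → F} {z : E} (h : SmoothNear f z) : ContinuousAt f z :=
  h.contDiffAt.continuousAt

theorem differentiableAt {f : E → F} {z : E} (h : SmoothNear f z) : DifferentiableAt ℝ f z :=
  h.contDiffAt.differentiableAt (by simp)

theorem eventually {f : E → F} {z : E} (h : SmoothNear f z) : ∀ᶠ w in 𝓝 z, SmoothNear f w :=
  eventually_eventually_nhds.2 h

theorem congr {f g : E → F} {z : E} (h : SmoothNear f z) (hfg : g =ᶠ[𝓝 z] f) :
    SmoothNear g z := by
  filter_upwards [h, hfg.eventually_nhds] with w hw hw' using hw.congr_of_eventuallyEq hw'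

theorem _root_.ContDiff.smoothNear {f : E → F} (h : ContDiff ℝ ∞ f) (z : E) : SmoothNear f z :=
  Filter.Eventually.of_forall fun _ => h.contDiffAt

theorem _root_.ContinuousLinearMap.smoothNear (f : E →L[ℝ] F) (z : E) : SmoothNear f z :=
  f.contDiff.smoothNear z

theorem comp {g : F → G} {f : E → F} (z : E) (hg : SmoothNear g (f z)) (hf : SmoothNear f z) :
    SmoothNear (fun w => g (f w)) z := by
  filter_upwards [hf, hf.continuousAt.eventually hg] with w h1 h2 using h2.comp w h1

theorem fderiv {f : E → F} {z : E} (h : SmoothNear f z) : SmoothNear (fderiv ℝ f) z :=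
  h.mono fun _ hw => hw.fderiv_right (by simp)

theorem prodMk {f : E → F} {g : E → G} {z : E} (hf : SmoothNear f z) (hg : SmoothNear g z) :
    SmoothNear (fun w => (f w, g w)) z := by
  filter_upwards [hf, hg] with w h1 h2 using h1.prodMk h2

theorem add {f g : E → F} {z : E} (hf : SmoothNear f z) (hg : SmoothNear g z) :
    SmoothNear (fun w => f w + g w) z := by
  filter_upwards [hf, hg] with w h1 h2 using h1.add h2

theorem sub {f g : E → F} {z : E} (hf : SmoothNear f z) (hg : SmoothNear g z) :
    SmoothNear (fun w => f w - g w) z := by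
  filter_upwards [hf, hg] with w h1 h2 using h1.sub h2

theorem neg {f : E → F} {z : E} (hf : SmoothNear f z) : SmoothNear (fun w => -f w) z :=
  hf.mono fun _ h => h.neg

theorem smul {f : E → ℝ} {g : E → F} {z : E} (hf : SmoothNear f z) (hg : SmoothNear g z) :
    SmoothNear (fun w => f w • g w) z := by
  filter_upwards [hf, hg] with w h1 h2 using h1.smul h2

theorem clm_apply {f : E → F →L[ℝ] G} {g : E → F} {z : E} (hf : SmoothNear f z)
    (hg : SmoothNear g z) : SmoothNear (fun w => f w (g w)) z := by
  filter_upwards [hf, hg] with w h1 h2 using h1.clm_apply h2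

theorem clm_comp {f : E → G →L[ℝ] H} {g : E → F →L[ℝ] G} {z : E} (hf : SmoothNear f z)
    (hg : SmoothNear g z) : SmoothNear (fun w => (f w).comp (g w)) z := by
  filter_upwards [hf, hg] with w h1 h2 using h1.clm_comp h2

theorem const (c : F) (z : E) : SmoothNear (fun _ : E => c) z := contDiff_const.smoothNear z

theorem fst (z : E × F) : SmoothNear (Prod.fst : E × F → E) z := contDiff_fst.smoothNear z

theorem snd (z : E × F) : SmoothNear (Prod.snd : E × F → F) z := contDiff_snd.smoothNear z

theorem id (z : E) : SmoothNear (fun w : E => w) z := contDiff_id.smoothNear z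

theorem of_contDiffOn {f : E → F} {U : Set E} (hU : IsOpen U) (h : ContDiffOn ℝ ∞ f U) {z : E}
    (hz : z ∈ U) : SmoothNear f z :=
  (hU.eventually_mem hz).mono fun _ hw => h.contDiffAt (hU.mem_nhds hw)

theorem contDiffOn_interior (f : E → F) :
    ContDiffOn ℝ ∞ f (interior {w | ContDiffAt ℝ ∞ f w}) :=
  fun w hw => by
    have : ContDiffAt ℝ ∞ f w := interior_subset (s := {w | ContDiffAt ℝ ∞ f w}) hw
    exact this.contDiffWithinAt

theorem mem_interior {f : E → F} {z : E} (h : SmoothNear f z) :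
    z ∈ interior {w | ContDiffAt ℝ ∞ f w} := mem_interior_iff_mem_nhds.2 h

/-- Smooth inverse function theorem, for germs. -/
theorem exists_inverse [CompleteSpace E] {f : E → F} {z : E} (h : SmoothNear f z)
    (f' : E ≃L[ℝ] F) (hf' : HasFDerivAt f (f' : E →L[ℝ] F) z) :
    ∃ g : F → E, g (f z) = z ∧ SmoothNear g (f z) ∧ (∀ᶠ w in 𝓝 (f z), f (g w) = w) ∧
      ∀ᶠ w in 𝓝 z, g (f w) = w := by
  have hn : (∞ : WithTop ℕ∞) ≠ 0 := by simp
  let e := h.contDiffAt.toOpenPartialHomeomorph f hf' hn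
  have hz : z ∈ e.source := h.contDiffAt.mem_toOpenPartialHomeomorph_source hf' hn
  have hfz : f z ∈ e.target := h.contDiffAt.image_mem_toOpenPartialHomeomorph_target hf' hn
  have hcoe : ∀ w, e w = f w := fun w => rfl
  have hsymm : e.symm (f z) = z := e.left_inv hz
  refine ⟨e.symm, hsymm, ?_, ?_, ?_⟩
  · have hc : Filter.Tendsto e.symm (𝓝 (f z)) (𝓝 z) := by
      have := e.continuousAt_symm hfz
      rwa [ContinuousAt, hsymm] at this
    have hinv : ∀ᶠ w in 𝓝 z, ∃ A : E ≃L[ℝ] F, (A : E →L[ℝ] F) = _root_.fderiv ℝ f w := by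
      have : ContinuousAt (_root_.fderiv ℝ f) z := h.fderiv.continuousAt
      have h2 : Set.range ((↑) : (E ≃L[ℝ] F) → E →L[ℝ] F) ∈ 𝓝 (_root_.fderiv ℝ f z) := by
        rw [hf'.fderiv]
        exact ContinuousLinearEquiv.nhds f'
      exact this.eventually h2
    filter_upwards [e.open_target.eventually_mem hfz, hc.eventually h, hc.eventually hinv]
      with w h1 h2 ⟨A, hA⟩
    refine e.contDiffAt_symm (f₀' := A) h1 ?_ h2
    rw [hA]
    exact (h2.differentiableAt hn).hasFDerivAt
  · filter_upwards [e.open_target.eventually_mem hfz] with w hw using e.right_inv hw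
  · filter_upwards [e.open_source.eventually_mem hz] with w hw using e.left_inv hw

end SmoothNear

end SmoothNear

/-! ### Smoothness of superposition operators on spaces of continuous maps -/

section Superposition

instance ContinuousMap.normedAddCommGroupCLM (K : Type*) [TopologicalSpace K] [CompactSpace K]
    (E F : Type*) [NormedAddCommGroup E] [NormedSpace ℝ E] [NormedAddCommGroup F]
    [NormedSpace ℝ F] : NormedAddCommGroup C(K, E →L[ℝ] F) := ContinuousMap.instNormedAddCommGroup

instance ContinuousMap.normedSpaceCLM (K : Type*) [TopologicalSpace K] [CompactSpace K]
    (E F : Type*) [NormedAddCommGroup E] [NormedSpace ℝ E] [NormedAddCommGroup F]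
    [NormedSpace ℝ F] : NormedSpace ℝ C(K, E →L[ℝ] F) := ContinuousMap.normedSpace

/-- Pointwise evaluation of families of continuous linear maps over a compact space. -/
def evalFamily (K : Type*) [TopologicalSpace K] [CompactSpace K] (E F : Type*)
    [NormedAddCommGroup E] [NormedSpace ℝ E] [NormedAddCommGroup F] [NormedSpace ℝ F] :
    C(K, E →L[ℝ] F) →L[ℝ] C(K, E) →L[ℝ] C(K, F) :=
  LinearMap.mkContinuous₂
    (LinearMap.mk₂ ℝ (fun (A : C(K, E →L[ℝ] F)) (h : C(K, E)) => (⟨fun s => A s (h s), by fun_prop⟩ : C(K, F)))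
      (fun _ _ _ => by ext; simp) (fun _ _ _ => by ext; simp)
      (fun _ _ _ => by ext; simp) (fun _ _ _ => by ext; simp)) 1 (fun A h => by
        rw [one_mul]
        refine (ContinuousMap.norm_le _ (by positivity)).2 fun s => ?_
        exact ((A s).le_opNorm _).trans (mul_le_mul (A.norm_coe_le_norm s) (h.norm_coe_le_norm s)
          (norm_nonneg _) (norm_nonneg _)))

variable {K : Type*} [TopologicalSpace K] [CompactSpace K]

@[simp] theorem evalFamily_apply {E F : Type*}
    [NormedAddCommGroup E] [NormedSpace ℝ E] [NormedAddCommGroup F] [NormedSpace ℝ F]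
    (A : C(K, E →L[ℝ] F)) (h : C(K, E)) (s : K) : evalFamily K E F A h s = A s (h s) := rfl

open Classical in
/-- The superposition operator `γ ↦ f ∘ γ`, with value `0` if `f ∘ γ` is not continuous. -/
def superpose {E F : Type*} [TopologicalSpace E] [TopologicalSpace F] [Zero F] (f : E → F)
    (γ : C(K, E)) : C(K, F) :=
  if h : Continuous (fun s => f (γ s)) then ⟨fun s => f (γ s), h⟩ else 0

theorem superpose_apply {E F : Type*} [TopologicalSpace E] [TopologicalSpace F] [Zero F]
    {f : E → F} {γ : C(K, E)} (h : ∀ s, ContinuousAt f (γ s)) (s : K) :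
    superpose f γ s = f (γ s) := by
  have : Continuous (fun s => f (γ s)) :=
    continuous_iff_continuousAt.2 fun s => (h s).comp γ.continuous.continuousAt
  rw [superpose, dif_pos this]; rfl

/-- The derivative of `f` is uniformly continuous near the compact range of `γ`. One radius
therefore serves all parameters `s`, and the mean value inequality on the balls around `γ s` gives
an error estimate uniform in `s`. -/
theorem hasFDerivAt_superpose {E F : Type*} [NormedAddCommGroup E] [NormedSpace ℝ E]
    [NormedAddCommGroup F] [NormedSpace ℝ F] {f : E → F} {U : Set E} (hU : IsOpen U)
    (hd : DifferentiableOn ℝ f U) (hc : ContinuousOn (fderiv ℝ f) U) {γ : C(K, E)}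
    (hγ : ∀ s, γ s ∈ U) :
    HasFDerivAt (superpose f) (evalFamily K E F (superpose (fderiv ℝ f) γ)) γ := by
  have hfc : ∀ x ∈ U, ContinuousAt f x := fun x hx =>
    (hd.differentiableAt (hU.mem_nhds hx)).continuousAt
  have hcc : ∀ x ∈ U, ContinuousAt (fderiv ℝ f) x := fun x hx => hc.continuousAt (hU.mem_nhds hx)
  have hK : IsCompact (Set.range γ) := isCompact_range γ.continuous
  have hKU : Set.range γ ⊆ U := by rintro _ ⟨s, rfl⟩; exact hγ s
  obtain ⟨δ₁, hδ₁, hsub⟩ := hK.exists_thickening_subset_open hU hKU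
  refine HasFDerivAt.of_isLittleO (Asymptotics.isLittleO_iff.2 fun ε hε => ?_)
  have := hK.uniformContinuousAt_of_continuousAt (fderiv ℝ f) (fun a ha => hcc a (hKU ha))
    (Metric.dist_mem_uniformity hε)
  obtain ⟨δ₂, hδ₂, hun⟩ := Metric.mem_uniformity_dist.1 this
  filter_upwards [Metric.ball_mem_nhds γ (lt_min hδ₁ hδ₂)] with η hη
  have hηs : ∀ s, dist (η s) (γ s) < min δ₁ δ₂ := fun s =>
    (ContinuousMap.dist_apply_le_dist s).trans_lt hη
  have hball : ∀ s, Metric.ball (γ s) (min δ₁ δ₂) ⊆ U := fun s x hx =>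
    hsub (Metric.mem_thickening_iff.2 ⟨γ s, ⟨s, rfl⟩, lt_of_lt_of_le hx (min_le_left _ _)⟩)
  refine (ContinuousMap.norm_le _ (by positivity)).2 fun s => ?_
  have e1 : superpose f η s = f (η s) := superpose_apply (fun s => hfc _ (hball s (hηs s))) s
  have e2 : superpose f γ s = f (γ s) := superpose_apply (fun s => hfc _ (hγ s)) s
  have e3 : superpose (fderiv ℝ f) γ s = fderiv ℝ f (γ s) :=
    superpose_apply (fun s => hcc _ (hγ s)) s
  simp only [ContinuousMap.sub_apply, evalFamily_apply, e1, e2, e3]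
  have key := (convex_ball (γ s) (min δ₁ δ₂)).norm_image_sub_le_of_norm_hasFDerivWithin_le'
    (f := f) (f' := fderiv ℝ f) (φ := fderiv ℝ f (γ s)) (C := ε) (x := γ s) (y := η s)
    (fun x hx => ((hd.differentiableAt (hU.mem_nhds (hball s hx))).hasFDerivAt).hasFDerivWithinAt)
    (fun x hx => ?_) (Metric.mem_ball_self (lt_min hδ₁ hδ₂)) (hηs s)
  · refine key.trans (mul_le_mul_of_nonneg_left ?_ hε.le)
    exact (η - γ).norm_coe_le_norm s
  · have h2 : dist (γ s) x < δ₂ := by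
      rw [dist_comm]; exact lt_of_lt_of_le hx (min_le_right _ _)
    have := hun h2 ⟨s, rfl⟩
    rw [← dist_eq_norm, dist_comm]
    exact le_of_lt this

/-- The derivative of a superposition operator is the superposition operator of `fderiv ℝ f`,
followed by the continuous linear map `evalFamily`. Induction on the order of differentiability thus
works once the target space varies; `E` and `F` share a universe so that `E →L[ℝ] F` is again an
admissible target. -/
theorem contDiffOn_superpose {E F : Type u} [NormedAddCommGroup E] [NormedSpace ℝ E]
    [NormedAddCommGroup F] [NormedSpace ℝ F] {f : E → F} {U : Set E} (hU : IsOpen U)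
    (hf : ContDiffOn ℝ ∞ f U) :
    ContDiffOn ℝ ∞ (superpose f : C(K, E) → C(K, F)) {γ | ∀ s, γ s ∈ U} := by
  have hopen : IsOpen {γ : C(K, E) | ∀ s, γ s ∈ U} := by
    have := ContinuousMap.isOpen_setOfPred_mapsTo (isCompact_univ (X := K)) hU
    simpa [Set.MapsTo] using this
  have main : ∀ k : ℕ, ∀ {F : Type u} [NormedAddCommGroup F] [NormedSpace ℝ F]
      {f : E → F}, ContDiffOn ℝ ∞ f U →
      ContDiffOn ℝ k (superpose f : C(K, E) → C(K, F)) {γ | ∀ s, γ s ∈ U} := by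
    intro k
    induction k with
    | zero =>
      intro F _ _ f hf
      obtain ⟨h1, h2⟩ := (contDiffOn_infty_iff_fderiv_of_isOpen hU).1 hf
      exact contDiffOn_zero.2 fun γ hγ =>
        (hasFDerivAt_superpose hU h1 h2.continuousOn hγ).continuousAt.continuousWithinAt
    | succ k ih =>
      intro F _ _ f hf
      obtain ⟨h1, h2⟩ := (contDiffOn_infty_iff_fderiv_of_isOpen hU).1 hf
      have hd := fun γ hγ => hasFDerivAt_superpose (K := K) (γ := γ) hU h1 h2.continuousOn hγ
      rw [Nat.cast_succ, contDiffOn_succ_iff_fderiv_of_isOpen hopen]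
      refine ⟨fun γ hγ => (hd γ hγ).differentiableAt.differentiableWithinAt, by simp, ?_⟩
      exact ((evalFamily K E F).contDiff.comp_contDiffOn (ih h2)).congr
        fun γ hγ => (hd γ hγ).fderiv
  exact contDiffOn_infty.2 fun k => main k hf

end Superposition

section Superposition

theorem SmoothNear.superpose {K : Type*} [TopologicalSpace K] [CompactSpace K]
    {E F : Type u} [NormedAddCommGroup E] [NormedSpace ℝ E]
    [NormedAddCommGroup F] [NormedSpace ℝ F] {f : E → F} {γ : C(K, E)}
    (h : ∀ s, SmoothNear f (γ s)) : SmoothNear (superpose f : C(K, E) → C(K, F)) γ := by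
  have hopen : IsOpen {γ : C(K, E) | ∀ s, γ s ∈ interior {w | ContDiffAt ℝ ∞ f w}} := by
    have := ContinuousMap.isOpen_setOfPred_mapsTo (isCompact_univ (X := K))
      (isOpen_interior (s := {w | ContDiffAt ℝ ∞ f w}))
    simpa [Set.MapsTo] using this
  exact SmoothNear.of_contDiffOn hopen (contDiffOn_superpose isOpen_interior
    (SmoothNear.contDiffOn_interior f)) fun s => (h s).mem_interior

/-- By compactness of `K`, the maps sending all of `K` into a given open set form an open set. -/
theorem eventually_forall_curve {K : Type*} [TopologicalSpace K] [CompactSpace K]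
    {E : Type*} [TopologicalSpace E] {Q : E → Prop} {γ : C(K, E)}
    (h : ∀ s, ∀ᶠ z in 𝓝 (γ s), Q z) : ∀ᶠ γ' : C(K, E) in 𝓝 γ, ∀ s, Q (γ' s) := by
  have hopen : IsOpen {γ : C(K, E) | ∀ s, γ s ∈ interior {w | Q w}} := by
    have := ContinuousMap.isOpen_setOfPred_mapsTo (isCompact_univ (X := K))
      (isOpen_interior (s := {w | Q w}))
    simpa [Set.MapsTo] using this
  filter_upwards [hopen.eventually_mem (x := γ) fun s => mem_interior_iff_mem_nhds.2 (h s)]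
    with γ' h' s
  exact interior_subset (s := {w | Q w}) (h' s)

theorem eventually_forall_smoothNear {K : Type*} [TopologicalSpace K] [CompactSpace K]
    {E F : Type*} [NormedAddCommGroup E] [NormedSpace ℝ E]
    [NormedAddCommGroup F] [NormedSpace ℝ F] {f : E → F} {γ : C(K, E)}
    (h : ∀ s, SmoothNear f (γ s)) : ∀ᶠ γ' : C(K, E) in 𝓝 γ, ∀ s, SmoothNear f (γ' s) :=
  eventually_forall_curve fun s => (h s).eventually

theorem SmoothNear.superpose_apply {K : Type*} [TopologicalSpace K] [CompactSpace K]
    {E F : Type*} [NormedAddCommGroup E] [NormedSpace ℝ E]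
    [NormedAddCommGroup F] [NormedSpace ℝ F] {f : E → F} {γ : C(K, E)}
    (h : ∀ s, SmoothNear f (γ s)) (s : K) : _root_.superpose f γ s = f (γ s) :=
  _root_.superpose_apply (fun s => (h s).continuousAt) s

theorem SmoothNear.fderiv_superpose {K : Type*} [TopologicalSpace K] [CompactSpace K]
    {E F : Type*} [NormedAddCommGroup E] [NormedSpace ℝ E]
    [NormedAddCommGroup F] [NormedSpace ℝ F] {f : E → F} {γ : C(K, E)}
    (h : ∀ s, SmoothNear f (γ s)) (η : C(K, E)) (s : K) :
    _root_.fderiv ℝ (_root_.superpose f) γ η s = _root_.fderiv ℝ f (γ s) (η s) := by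
  obtain ⟨h1, h2⟩ := (contDiffOn_infty_iff_fderiv_of_isOpen isOpen_interior).1
    (SmoothNear.contDiffOn_interior f)
  rw [(hasFDerivAt_superpose isOpen_interior h1 h2.continuousOn
    fun s => (h s).mem_interior).fderiv, evalFamily_apply,
    SmoothNear.superpose_apply fun s => (h s).fderiv]

end Superposition

/-! ### Integration of curves as a bounded operator -/

section Primitive

open unitInterval

/-- The operator taking a curve `g : [0, 1] → E` to its primitive `t ↦ ∫ s in 0..t, g s`. -/
def primitive (E : Type*) [NormedAddCommGroup E] [NormedSpace ℝ E] [CompleteSpace E] :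
    C(I, E) →L[ℝ] C(I, E) :=
  LinearMap.mkContinuous
    { toFun := fun g => ⟨fun t => ∫ s in (0 : ℝ)..t, Set.IccExtend zero_le_one g s,
        (intervalIntegral.continuous_primitive
          (fun a b => (g.continuous.Icc_extend').intervalIntegrable a b) 0).comp
          continuous_subtype_val⟩
      map_add' := fun g h => by
        ext t
        exact intervalIntegral.integral_add (g.continuous.Icc_extend'.intervalIntegrable _ _)
          (h.continuous.Icc_extend'.intervalIntegrable _ _)
      map_smul' := fun c g => by
        ext t
        exact intervalIntegral.integral_smul c _ } 1 (fun g => by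
    rw [one_mul]
    refine (ContinuousMap.norm_le _ (norm_nonneg _)).2 fun t => ?_
    refine (intervalIntegral.norm_integral_le_of_norm_le_const (C := ‖g‖)
      fun x _ => g.norm_coe_le_norm _).trans ?_
    rw [sub_zero, abs_of_nonneg t.2.1]
    exact mul_le_of_le_one_right (norm_nonneg _) t.2.2)

variable {E : Type*} [NormedAddCommGroup E] [NormedSpace ℝ E] [CompleteSpace E]

theorem primitive_apply (g : C(I, E)) (t : I) :
    primitive E g t = ∫ s in (0 : ℝ)..t, Set.IccExtend zero_le_one g s := rfl

theorem hasDerivWithinAt_primitive (g : C(I, E)) {t : ℝ} (ht : t ∈ Set.Icc (0 : ℝ) 1) :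
    HasDerivWithinAt (Set.IccExtend zero_le_one (primitive E g)) (g ⟨t, ht⟩)
      (Set.Icc 0 1) t := by
  have h1 : HasDerivAt (fun t : ℝ => ∫ s in (0 : ℝ)..t, Set.IccExtend zero_le_one g s)
      (Set.IccExtend zero_le_one g t) t :=
    intervalIntegral.integral_hasDerivAt_right
      (g.continuous.Icc_extend'.intervalIntegrable _ _)
      (g.continuous.Icc_extend'.stronglyMeasurableAtFilter _ _)
      g.continuous.Icc_extend'.continuousAt
  rw [Set.IccExtend_of_mem _ _ ht] at h1
  refine h1.hasDerivWithinAt.congr (fun x hx => ?_) ?_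
  · rw [Set.IccExtend_of_mem _ _ hx]; rfl
  · rw [Set.IccExtend_of_mem _ _ ht]; rfl

end Primitive

/-! ### Integrals depending on a parameter -/

section ParametricIntegral

open unitInterval

variable {V F : Type u} [NormedAddCommGroup V] [NormedSpace ℝ V]
  [NormedAddCommGroup F] [NormedSpace ℝ F] [CompleteSpace F]

/-- The continuous linear map sending a vector to the constant curve. -/
def constCurve (V : Type*) [NormedAddCommGroup V] [NormedSpace ℝ V] : V →L[ℝ] C(I, V) :=
  LinearMap.mkContinuous
    { toFun := fun v => ContinuousMap.const I v
      map_add' := fun _ _ => rfl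
      map_smul' := fun _ _ => rfl } 1 (fun v => by
    rw [one_mul]
    exact (ContinuousMap.norm_le _ (norm_nonneg _)).2 fun _ => le_rfl)

@[simp] theorem constCurve_apply (V : Type*) [NormedAddCommGroup V] [NormedSpace ℝ V] (v : V)
    (s : I) : constCurve V v s = v := rfl

/-- The integral is a continuous linear functional of the curve `s ↦ k (s, p)`, and this curve is
the superposition of `k` with a curve affine in `p`. Smoothness and differentiation under the
integral sign are then the chain rule. -/
theorem SmoothNear.parametric_integral {k : ℝ × V → F} {p₀ : V}
    (hk : ∀ s ∈ Set.Icc (0 : ℝ) 1, SmoothNear k (s, p₀)) :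
    SmoothNear (fun p => ∫ s in (0 : ℝ)..1, k (s, p)) p₀ ∧
    ∀ᶠ p in 𝓝 p₀, ∀ a, _root_.fderiv ℝ (fun p => ∫ s in (0 : ℝ)..1, k (s, p)) p a =
      ∫ s in (0 : ℝ)..1, _root_.fderiv ℝ k (s, p) (0, a) := by
  let c₀ : C(I, ℝ × V) := ⟨fun s => ((s : ℝ), 0), by fun_prop⟩
  let ℓ : V →L[ℝ] C(I, ℝ × V) := (constCurve (ℝ × V)).comp (ContinuousLinearMap.inr ℝ ℝ V)
  let c : V → C(I, ℝ × V) := fun p => c₀ + ℓ p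
  have hc : ContDiff ℝ ∞ c := contDiff_const.add ℓ.contDiff
  have hca : ∀ p s, c p s = ((s : ℝ), p) := fun p s => by simp [c, c₀, ℓ]
  have hcd : ∀ p, HasFDerivAt c ℓ p := fun p => ℓ.hasFDerivAt.const_add c₀
  have h0 : ∀ s, SmoothNear k (c p₀ s) := fun s => by rw [hca]; exact hk s s.2
  let T : C(I, F) →L[ℝ] F := (ContinuousMap.evalCLM ℝ (1 : I)).comp (primitive F)
  have hT : ∀ g : C(I, F), T g = ∫ s in (0 : ℝ)..1, Set.IccExtend zero_le_one g s := fun g => rfl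
  have hev : ∀ᶠ p in 𝓝 p₀, ∀ s, SmoothNear k (c p s) :=
    hc.continuous.continuousAt.eventually (eventually_forall_smoothNear h0)
  have heq : (fun p => ∫ s in (0 : ℝ)..1, k (s, p)) =ᶠ[𝓝 p₀]
      fun p => T (_root_.superpose k (c p)) := by
    filter_upwards [hev] with p hp
    rw [hT]
    refine intervalIntegral.integral_congr fun s hs => ?_
    rw [Set.uIcc_of_le zero_le_one] at hs
    rw [Set.IccExtend_of_mem _ _ hs, SmoothNear.superpose_apply hp, hca]
  refine ⟨SmoothNear.congr ((T.smoothNear _).comp p₀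
    ((SmoothNear.superpose h0).comp p₀ (hc.smoothNear p₀))) heq, ?_⟩
  filter_upwards [heq.eventually_nhds, hev] with p hp hs a
  have hd : HasFDerivAt (fun p => T (_root_.superpose k (c p)))
      (T.comp ((_root_.fderiv ℝ (_root_.superpose k) (c p)).comp ℓ)) p :=
    T.hasFDerivAt.comp p ((SmoothNear.superpose hs).differentiableAt.hasFDerivAt.comp p (hcd p))
  rw [Filter.EventuallyEq.fderiv_eq hp, hd.fderiv]
  change T _ = _
  rw [hT]
  refine intervalIntegral.integral_congr fun s hs' => ?_
  rw [Set.uIcc_of_le zero_le_one] at hs'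
  rw [Set.IccExtend_of_mem _ _ hs']
  change _root_.fderiv ℝ (_root_.superpose k) (c p) (ℓ a) _ = _
  rw [SmoothNear.fderiv_superpose hs, hca]
  rfl

end ParametricIntegral

/-! ### Flow lines as solutions of an integral equation in a Banach space -/

section Flow

open unitInterval

variable {P E : Type u} [NormedAddCommGroup P] [NormedSpace ℝ P] [CompleteSpace P]
  [NormedAddCommGroup E] [NormedSpace ℝ E] [CompleteSpace E]

/-- The curve `s ↦ (s, y, γ s)`. -/
def graphCurve (y : P) (γ : C(I, E)) : C(I, ℝ × P × E) :=
  ⟨fun s => ((s : ℝ), y, γ s), by fun_prop⟩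

/-- `γ : [0, 1] → E` solves `γ' = X(s, y, γ)`, `γ 0 = v`, written as an integral equation. -/
def IsFlowLine (X : ℝ × P × E → E) (p : P × E) (γ : C(I, E)) : Prop :=
  γ = constCurve E p.2 + primitive E (superpose X (graphCurve p.1 γ))

/-- A solution whose norm is strictly smaller than that of any other solution. -/
def IsMinimalFlowLine (X : ℝ × P × E → E) (p : P × E) (γ : C(I, E)) : Prop :=
  IsFlowLine X p γ ∧ ∀ γ', IsFlowLine X p γ' → ‖γ'‖ ≤ ‖γ‖ → γ' = γ

open Classical in
/-- The time-one map of the vector field `X(·, y, ·)`, for initial values whose flow line is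
distinguished by its norm. -/
def timeOne (X : ℝ × P × E → E) (p : P × E) : E :=
  if h : ∃ γ, IsMinimalFlowLine X p γ then h.choose 1 else 0

/-- Two minimal flow lines are comparable in norm, hence equal, so the choice in `timeOne` is
harmless. Since minimality mentions no base point, a single function `timeOne X` describes the flow
near all stationary points at once. -/
theorem IsMinimalFlowLine.timeOne_eq {X : ℝ × P × E → E} {p : P × E} {γ : C(I, E)}
    (h : IsMinimalFlowLine X p γ) : timeOne X p = γ 1 := by
  have hex : ∃ γ, IsMinimalFlowLine X p γ := ⟨γ, h⟩
  have hs := hex.choose_spec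
  rw [timeOne, dif_pos hex]
  rcases le_total ‖γ‖ ‖hex.choose‖ with hle | hle
  · rw [hs.2 γ h.1 hle]
  · rw [h.2 _ hs.1 hle]

/-- The linear part of `graphCurve`. -/
def graphCurveLin (P E : Type u) [NormedAddCommGroup P] [NormedSpace ℝ P]
    [NormedAddCommGroup E] [NormedSpace ℝ E] : P × C(I, E) →L[ℝ] C(I, ℝ × P × E) :=
  LinearMap.mkContinuous
    { toFun := fun q => ⟨fun s => ((0 : ℝ), q.1, q.2 s), by fun_prop⟩
      map_add' := fun _ _ => by ext <;> simp
      map_smul' := fun _ _ => by ext <;> simp } 1 (fun q => by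
    rw [one_mul]
    refine (ContinuousMap.norm_le _ (norm_nonneg _)).2 fun s => ?_
    simp only [LinearMap.coe_mk, AddHom.coe_mk, ContinuousMap.coe_mk, Prod.norm_mk, norm_zero]
    refine max_le (norm_nonneg _) (max_le (norm_fst_le q) ?_)
    exact (q.2.norm_coe_le_norm s).trans (norm_snd_le q))

@[simp] theorem graphCurveLin_apply (q : P × C(I, E)) (s : I) :
    graphCurveLin P E q s = ((0 : ℝ), q.1, q.2 s) := rfl

theorem graphCurve_eq (q : P × C(I, E)) :
    graphCurve q.1 q.2 = graphCurve (0 : P) (0 : C(I, E)) + graphCurveLin P E q := by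
  ext s <;> simp [graphCurve]

theorem hasFDerivAt_graphCurve (q : P × C(I, E)) :
    HasFDerivAt (fun q : P × C(I, E) => graphCurve q.1 q.2) (graphCurveLin P E) q := by
  rw [show (fun q : P × C(I, E) => graphCurve q.1 q.2) = _ from funext graphCurve_eq]
  exact (graphCurveLin P E).hasFDerivAt.const_add _

theorem contDiff_graphCurve :
    ContDiff ℝ ∞ (fun q : P × C(I, E) => graphCurve q.1 q.2) := by
  rw [show (fun q : P × C(I, E) => graphCurve q.1 q.2) = _ from funext graphCurve_eq]
  exact contDiff_const.add (graphCurveLin P E).contDiff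

/-- Near a stationary point at which the derivative of the vector field vanishes, the flow lines
over `[0, 1]` exist, are unique among short ones, and depend smoothly on all data. -/
theorem exists_flow {X : ℝ × P × E → E} {y₀ : P}
    (hX : ∀ s ∈ Set.Icc (0 : ℝ) 1, SmoothNear X (s, y₀, 0))
    (hX0 : ∀ s ∈ Set.Icc (0 : ℝ) 1, X (s, y₀, 0) = 0)
    (hdX : ∀ s ∈ Set.Icc (0 : ℝ) 1, fderiv ℝ X (s, y₀, 0) = 0) :
    ∃ Γ : P × E → C(I, E), SmoothNear Γ (y₀, 0) ∧ Γ (y₀, 0) = 0 ∧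
      (∀ᶠ p in 𝓝 (y₀, (0 : E)), IsFlowLine X p (Γ p)) ∧
      (∀ᶠ q in 𝓝 ((y₀, (0 : E)), (0 : C(I, E))), IsFlowLine X q.1 q.2 → q.2 = Γ q.1) := by
  let A : (P × E) × C(I, E) →L[ℝ] P × C(I, E) :=
    ((ContinuousLinearMap.fst ℝ P E).comp (ContinuousLinearMap.fst ℝ _ _)).prod
      (((constCurve E).comp ((ContinuousLinearMap.snd ℝ P E).comp
        (ContinuousLinearMap.fst ℝ _ _))) + ContinuousLinearMap.snd ℝ _ _)
  have hA : ∀ z, A z = (z.1.1, constCurve E z.1.2 + z.2) := fun z => rfl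
  let c : (P × E) × C(I, E) → C(I, ℝ × P × E) := fun z => graphCurve (A z).1 (A z).2
  let z₀ : (P × E) × C(I, E) := ((y₀, 0), 0)
  have hc : ContDiff ℝ ∞ c := contDiff_graphCurve.comp A.contDiff
  have hcd : HasFDerivAt c ((graphCurveLin P E).comp A) z₀ :=
    (hasFDerivAt_graphCurve (A z₀)).comp z₀ A.hasFDerivAt
  have hc0 : ∀ s, c z₀ s = ((s : ℝ), y₀, 0) := fun s => by simp [c, hA, z₀, graphCurve]
  have hsm : ∀ s, SmoothNear X (c z₀ s) := fun s => by rw [hc0]; exact hX s s.2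
  -- The second variable is the deviation of the curve from the constant curve at its initial value.
  -- Carrying the parameters along in the first component makes the implicit function theorem an
  -- instance of the inverse function theorem.
  let H : (P × E) × C(I, E) → (P × E) × C(I, E) := fun z =>
    (z.1, z.2 - primitive E (superpose X (c z)))
  have hH : SmoothNear H z₀ := (SmoothNear.fst z₀).prodMk ((SmoothNear.snd z₀).sub
    (((primitive E).smoothNear _).comp z₀ ((SmoothNear.superpose hsm).comp z₀ (hc.smoothNear z₀))))
  -- The vector field has zero derivative along the stationary curve, so `H` has the identity as
  -- derivative; the whole interval `[0, 1]` is covered without shrinking time.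
  have hder : fderiv ℝ (superpose X) (c z₀) = 0 := by
    ext η s
    rw [SmoothNear.fderiv_superpose hsm, hc0, hdX s s.2]; rfl
  have hH' : HasFDerivAt H
      ((ContinuousLinearEquiv.refl ℝ ((P × E) × C(I, E)) : _ ≃L[ℝ] _) : _ →L[ℝ] _) z₀ := by
    have h1 : HasFDerivAt (fun z => primitive E (superpose X (c z)))
        ((primitive E).comp ((fderiv ℝ (superpose X) (c z₀)).comp
          ((graphCurveLin P E).comp A))) z₀ :=
      (primitive E).hasFDerivAt.comp z₀
        ((SmoothNear.superpose hsm).differentiableAt.hasFDerivAt.comp z₀ hcd)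
    rw [hder] at h1
    have h2 : HasFDerivAt H _ z₀ := (hasFDerivAt_fst (p := z₀)).prodMk
      ((hasFDerivAt_snd (p := z₀)).sub h1)
    refine h2.congr_fderiv ?_
    ext <;> simp
  obtain ⟨g, hg1, hg2, hg3, hg4⟩ := hH.exists_inverse _ hH'
  have hsup0 : superpose X (c z₀) = 0 := by
    ext s
    rw [SmoothNear.superpose_apply hsm, hc0, hX0 s s.2]; rfl
  have hHz : H z₀ = ((y₀, 0), 0) := by simp [H, hsup0, z₀]
  rw [hHz] at hg1 hg2 hg3
  have hin : ∀ p : P × E, SmoothNear (fun p : P × E => (p, (0 : C(I, E)))) p := fun p =>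
    (SmoothNear.id p).prodMk (SmoothNear.const _ p)
  have hflow : ∀ p η, IsFlowLine X p (constCurve E p.2 + η) ↔ H (p, η) = (p, 0) := by
    intro p η
    simp only [IsFlowLine, H, c, hA, Prod.mk.injEq, true_and, sub_eq_zero, add_right_inj]
  refine ⟨fun p => constCurve E p.2 + (g (p, 0)).2, ?_, ?_, ?_, ?_⟩
  · exact (((constCurve E).smoothNear _).comp _ (SmoothNear.snd _)).add
      ((SmoothNear.snd _).comp _ (SmoothNear.comp (y₀, (0 : E)) (g := g) hg2 (hin _)))
  · simp [hg1, z₀]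
  · have : ∀ᶠ p : P × E in 𝓝 (y₀, 0), H (g (p, 0)) = (p, 0) :=
      (hin _).continuousAt.eventually hg3
    filter_upwards [this] with p hp
    have h1 : (g (p, 0)).1 = p := congrArg Prod.fst hp
    refine (hflow _ _).2 ?_
    have h2 : (p, (g (p, 0)).2) = g (p, 0) := Prod.ext h1.symm rfl
    rw [h2, hp]
  -- Uniqueness: `g` is also a left inverse of `H` near `z₀`, which determines every flow line close
  -- to the zero curve.
  · have hcont : ContinuousAt (fun q : (P × E) × C(I, E) => (q.1, q.2 - constCurve E q.1.2))
        ((y₀, (0 : E)), (0 : C(I, E))) := by fun_prop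
    have hz : (fun q : (P × E) × C(I, E) => (q.1, q.2 - constCurve E q.1.2))
        ((y₀, (0 : E)), (0 : C(I, E))) = z₀ := by simp [z₀]
    have hcont' := hcont.tendsto
    beta_reduce at hcont' hz
    rw [hz] at hcont'
    filter_upwards [hcont'.eventually hg4] with q hq hfl
    have : H (q.1, q.2 - constCurve E q.1.2) = (q.1, 0) :=
      (hflow _ _).1 (by rwa [add_sub_cancel])
    rw [this] at hq
    rw [hq]; simp

end Flow

/-! ### The time-one map and its variational equation -/

section TimeOne

open unitInterval

variable {P E : Type u} [NormedAddCommGroup P] [NormedSpace ℝ P] [CompleteSpace P]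
  [NormedAddCommGroup E] [NormedSpace ℝ E] [CompleteSpace E]

theorem IsFlowLine.apply_zero {X : ℝ × P × E → E} {p : P × E} {γ : C(I, E)}
    (h : IsFlowLine X p γ) : γ 0 = p.2 := by
  rw [h, ContinuousMap.add_apply, primitive_apply]; simp

theorem IsFlowLine.hasDerivWithinAt {X : ℝ × P × E → E} {p : P × E} {γ : C(I, E)}
    (h : IsFlowLine X p γ) (hX : ∀ s : I, ContinuousAt X ((s : ℝ), p.1, γ s)) {t : ℝ}
    (ht : t ∈ Set.Icc (0 : ℝ) 1) :
    HasDerivWithinAt (Set.IccExtend zero_le_one γ) (X (t, p.1, γ ⟨t, ht⟩)) (Set.Icc 0 1) t := by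
  have h1 := (hasDerivWithinAt_primitive (superpose X (graphCurve p.1 γ)) ht).const_add p.2
  rw [superpose_apply (fun s => hX s)] at h1
  refine h1.congr (fun x hx => ?_) ?_
  · rw [Set.IccExtend_of_mem _ _ hx, Set.IccExtend_of_mem _ _ hx]
    conv_lhs => rw [h]
    simp
  · rw [Set.IccExtend_of_mem _ _ ht, Set.IccExtend_of_mem _ _ ht]
    conv_lhs => rw [h]
    simp

/-- The properties of the time-one map near a stationary point at which the derivative of the
vector field vanishes. -/
theorem timeOne_spec {X : ℝ × P × E → E} {y₀ : P}
    (hX : ∀ s ∈ Set.Icc (0 : ℝ) 1, SmoothNear X (s, y₀, 0))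
    (hX0 : ∀ s ∈ Set.Icc (0 : ℝ) 1, X (s, y₀, 0) = 0)
    (hdX : ∀ s ∈ Set.Icc (0 : ℝ) 1, fderiv ℝ X (s, y₀, 0) = 0)
    {Q : ℝ × P × E → Prop} (hQ : ∀ s ∈ Set.Icc (0 : ℝ) 1, ∀ᶠ z in 𝓝 (s, y₀, (0 : E)), Q z) :
    SmoothNear (timeOne X) (y₀, 0) ∧
    (∀ᶠ p in 𝓝 (y₀, (0 : E)), (∀ s ∈ Set.Icc (0 : ℝ) 1, X (s, p) = 0) → timeOne X p = p.2) ∧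
    ∀ᶠ p in 𝓝 (y₀, (0 : E)), ∃ (γ : C(I, E)) (η : E → C(I, E)),
      (p = (y₀, 0) → γ = 0) ∧ γ 0 = p.2 ∧ γ 1 = timeOne X p ∧ (∀ s : I, Q (s, p.1, γ s)) ∧
      (∀ t (ht : t ∈ Set.Icc (0 : ℝ) 1), HasDerivWithinAt (Set.IccExtend zero_le_one γ)
        (X (t, p.1, γ ⟨t, ht⟩)) (Set.Icc 0 1) t) ∧
      ∀ a, η a 0 = a ∧ η a 1 = fderiv ℝ (timeOne X) p (0, a) ∧
        ∀ t (ht : t ∈ Set.Icc (0 : ℝ) 1), HasDerivWithinAt (Set.IccExtend zero_le_one (η a))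
          (fderiv ℝ X (t, p.1, γ ⟨t, ht⟩) (0, 0, η a ⟨t, ht⟩)) (Set.Icc 0 1) t := by
  obtain ⟨Γ, hΓ, hΓ0, hfl, huniq⟩ := exists_flow hX hX0 hdX
  have hΓt : Filter.Tendsto Γ (𝓝 (y₀, 0)) (𝓝 0) := by
    have := hΓ.continuousAt.tendsto; rwa [hΓ0] at this
  -- Uniqueness holds for curves in a fixed ball around `0`. Near `(y₀, 0)` the curve `Γ p` lies in
  -- that ball, and so does every competitor of no larger norm; hence `Γ p` is minimal.
  have hmin : ∀ᶠ p in 𝓝 (y₀, (0 : E)), IsMinimalFlowLine X p (Γ p) := by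
    rw [nhds_prod_eq] at huniq
    obtain ⟨N, hN, W, hW, hNW⟩ := Filter.eventually_prod_iff.1 huniq
    obtain ⟨r, hr, hball⟩ := Metric.eventually_nhds_iff_ball.1 hW
    filter_upwards [hN, hfl, hΓt.eventually (Metric.ball_mem_nhds _ hr)] with p h1 h2 h3
    refine ⟨h2, fun γ' h4 h5 => hNW h1 (hball _ ?_) h4⟩
    rw [dist_zero_right] at h3
    exact mem_ball_zero_iff.2 (h5.trans_lt h3)
  have heq : timeOne X =ᶠ[𝓝 (y₀, 0)] fun p => ContinuousMap.evalCLM ℝ (1 : I) (Γ p) :=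
    hmin.mono fun p hp => hp.timeOne_eq
  have hgc : Continuous (fun q : P × C(I, E) => graphCurve q.1 q.2) :=
    contDiff_graphCurve.continuous
  have hgt : Filter.Tendsto (fun p => graphCurve p.1 (Γ p)) (𝓝 (y₀, 0))
      (𝓝 (graphCurve y₀ (0 : C(I, E)))) := by
    have : ContinuousAt (fun p : P × E => graphCurve p.1 (Γ p)) (y₀, 0) :=
      hgc.continuousAt.comp (continuousAt_fst.prodMk hΓ.continuousAt)
    simpa only [ContinuousAt, hΓ0] using this
  have hQ' : ∀ᶠ p in 𝓝 (y₀, (0 : E)), ∀ s : I, Q (s, p.1, Γ p s) :=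
    hgt.eventually (eventually_forall_curve fun s => hQ s s.2)
  have hsm : ∀ᶠ p in 𝓝 (y₀, (0 : E)), ∀ s : I, SmoothNear X (s, p.1, Γ p s) :=
    hgt.eventually (eventually_forall_smoothNear fun s => hX s s.2)
  refine ⟨((ContinuousMap.evalCLM ℝ (1 : I)).smoothNear _).comp _ hΓ |>.congr heq, ?_, ?_⟩
  -- The constant curve at `p.2` solves the equation and is close to `0`, so by uniqueness it is `Γ
  -- p`.
  · have hct : Filter.Tendsto (fun p : P × E => (p, constCurve E p.2)) (𝓝 (y₀, 0))
        (𝓝 ((y₀, 0), 0)) := by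
      have : ContinuousAt (fun p : P × E => (p, constCurve E p.2)) (y₀, 0) := by fun_prop
      simpa only [ContinuousAt, map_zero] using this
    have hct' : Filter.Tendsto (fun p : P × E => graphCurve p.1 (constCurve E p.2)) (𝓝 (y₀, 0))
        (𝓝 (graphCurve y₀ (0 : C(I, E)))) := by
      have : ContinuousAt (fun p : P × E => graphCurve p.1 (constCurve E p.2)) (y₀, 0) :=
        hgc.continuousAt.comp (f := fun p : P × E => (p.1, constCurve E p.2)) (by fun_prop)
      simpa only [ContinuousAt, map_zero] using this
    filter_upwards [hmin, hct.eventually huniq,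
      hct'.eventually (eventually_forall_smoothNear fun s => hX s s.2)] with p h1 h2 h3 h4
    rw [h1.timeOne_eq, ← h2]
    · rfl
    · change constCurve E p.2 = _
      rw [left_eq_add]
      have : superpose X (graphCurve p.1 (constCurve E p.2)) = 0 := by
        ext s
        rw [SmoothNear.superpose_apply h3]
        exact h4 s s.2
      rw [this, map_zero]
  · filter_upwards [hmin, heq.eventually_nhds, hfl.eventually_nhds, hΓ.eventually, hQ', hsm]
      with p h1 h2 h3 h4 h5 h6
    refine ⟨Γ p, fun a => fderiv ℝ Γ p (0, a), fun hp => hp ▸ hΓ0, h1.1.apply_zero, h1.timeOne_eq.symm, h5,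
      fun t ht => h1.1.hasDerivWithinAt (fun s => (h6 s).continuousAt) ht, fun a => ?_⟩
    have hΓd := h4.differentiableAt.hasFDerivAt
    have hT : fderiv ℝ (timeOne X) p (0, a) = fderiv ℝ Γ p (0, a) 1 := by
      have h7 : HasFDerivAt (fun p => ContinuousMap.evalCLM ℝ (1 : I) (Γ p)) _ p :=
        HasFDerivAt.comp (g := ContinuousMap.evalCLM ℝ (1 : I)) p
          (ContinuousLinearMap.hasFDerivAt _) hΓd
      rw [Filter.EventuallyEq.fderiv_eq h2, h7.fderiv]
      rfl
    have hg : HasFDerivAt (fun p : P × E => graphCurve p.1 (Γ p))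
        ((graphCurveLin P E).comp ((ContinuousLinearMap.fst ℝ P E).prod (fderiv ℝ Γ p))) p :=
      HasFDerivAt.comp (g := fun q : P × C(I, E) => graphCurve q.1 q.2)
        (f := fun p : P × E => (p.1, Γ p)) p
        (hasFDerivAt_graphCurve (p.1, Γ p)) (hasFDerivAt_fst.prodMk hΓd)
    have hs : HasFDerivAt (fun p : P × E => superpose X (graphCurve p.1 (Γ p))) _ p :=
      HasFDerivAt.comp (g := superpose X) (f := fun p : P × E => graphCurve p.1 (Γ p)) p
        (SmoothNear.superpose (γ := graphCurve p.1 (Γ p)) h6).differentiableAt.hasFDerivAt hg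
    have hr : HasFDerivAt
        (fun p : P × E => constCurve E p.2 + primitive E (superpose X (graphCurve p.1 (Γ p)))) _ p :=
      HasFDerivAt.add
        (f := fun p : P × E => constCurve E p.2)
        (g := fun p : P × E => primitive E (superpose X (graphCurve p.1 (Γ p))))
        (HasFDerivAt.comp (g := constCurve E) (f := Prod.snd) p
          (constCurve E).hasFDerivAt hasFDerivAt_snd)
        (HasFDerivAt.comp (g := primitive E) p (primitive E).hasFDerivAt hs)
    have heq3 : Γ =ᶠ[𝓝 p]
        fun p : P × E => constCurve E p.2 + primitive E (superpose X (graphCurve p.1 (Γ p))) := h3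
    -- Differentiating the integral equation satisfied by `Γ` in the direction of the initial value
    -- gives the variational equation in integral form.
    have hη : fderiv ℝ Γ p (0, a) = constCurve E a + primitive E
        (fderiv ℝ (superpose X) (graphCurve p.1 (Γ p))
          (graphCurveLin P E (0, fderiv ℝ Γ p (0, a)))) := by
      conv_lhs => rw [heq3.fderiv_eq, hr.fderiv]
      rfl
    set η := fderiv ℝ Γ p (0, a) with hηdef
    change η 0 = a ∧ η 1 = _ ∧ ∀ t (ht : t ∈ Set.Icc (0 : ℝ) 1),
      HasDerivWithinAt (Set.IccExtend zero_le_one η)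
        (fderiv ℝ X (t, p.1, Γ p ⟨t, ht⟩) (0, 0, η ⟨t, ht⟩)) (Set.Icc 0 1) t
    refine ⟨?_, hT.symm, fun t ht => ?_⟩
    · rw [hη, ContinuousMap.add_apply, primitive_apply]; simp
    · have h7 := (hasDerivWithinAt_primitive (fderiv ℝ (superpose X) (graphCurve p.1 (Γ p))
          (graphCurveLin P E (0, η))) ht).const_add a
      rw [SmoothNear.fderiv_superpose (γ := graphCurve p.1 (Γ p)) h6] at h7
      refine h7.congr (fun x hx => ?_) ?_
      · rw [Set.IccExtend_of_mem _ _ hx, Set.IccExtend_of_mem _ _ hx]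
        conv_lhs => rw [hη]
        simp
      · rw [Set.IccExtend_of_mem _ _ ht, Set.IccExtend_of_mem _ _ ht]
        conv_lhs => rw [hη]
        simp

end TimeOne

/-! ### Moser's argument with parameters: the primitive of the difference of forms -/

section Moser

instance bilinNormedAddCommGroup (E : Type*) [NormedAddCommGroup E] [NormedSpace ℝ E] :
    NormedAddCommGroup (E →L[ℝ] E →L[ℝ] ℝ) := ContinuousLinearMap.toNormedAddCommGroup

instance bilinNormedSpace (E : Type*) [NormedAddCommGroup E] [NormedSpace ℝ E] :
    NormedSpace ℝ (E →L[ℝ] E →L[ℝ] ℝ) := ContinuousLinearMap.toNormedSpace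

instance bilinAddGroup (E : Type*) [NormedAddCommGroup E] [NormedSpace ℝ E] :
    AddGroup (E →L[ℝ] E →L[ℝ] ℝ) := (bilinNormedAddCommGroup E).toAddGroup

instance bilinAddZeroClass (E : Type*) [NormedAddCommGroup E] [NormedSpace ℝ E] :
    AddZeroClass (E →L[ℝ] E →L[ℝ] ℝ) := (bilinAddGroup E).toAddZeroClass

instance bilinAddCommMagma (E : Type*) [NormedAddCommGroup E] [NormedSpace ℝ E] :
    AddCommMagma (E →L[ℝ] E →L[ℝ] ℝ) :=
  (bilinNormedAddCommGroup E).toAddCommGroup.toAddCommMonoid.toAddCommSemigroup.toAddCommMagma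

open unitInterval

variable {P E : Type u} [NormedAddCommGroup P] [NormedSpace ℝ P] [CompleteSpace P]
  [NormedAddCommGroup E] [NormedSpace ℝ E] [CompleteSpace E]

/-- Product balls around `(y₀, 0)` are star-shaped in the second variable. This supplies the
hypotheses along the segments `s • v` over which the homotopy operator integrates. -/
theorem eventually_forall_scaled {Q : P × E → Prop} {y₀ : P} (h : ∀ᶠ p in 𝓝 (y₀, (0 : E)), Q p) :
    ∀ᶠ p in 𝓝 (y₀, (0 : E)), ∀ s ∈ Set.Icc (0 : ℝ) 1, Q (p.1, s • p.2) := by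
  obtain ⟨r, hr, hball⟩ := Metric.eventually_nhds_iff_ball.1 h
  filter_upwards [Metric.ball_mem_nhds _ hr] with p hp s hs
  refine hball _ ?_
  rw [Metric.mem_ball, Prod.dist_eq, max_lt_iff] at hp ⊢
  refine ⟨hp.1, ?_⟩
  simp only [dist_zero_right, norm_smul, Real.norm_eq_abs, abs_of_nonneg hs.1] at hp ⊢
  exact (mul_le_of_le_one_left (norm_nonneg _) hs.2).trans_lt hp.2

theorem eventually_zero_section {Q : P × E → Prop} {y₀ : P}
    (h : ∀ᶠ p in 𝓝 (y₀, (0 : E)), Q p) : ∀ᶠ p in 𝓝 (y₀, (0 : E)), Q (p.1, 0) :=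
  (eventually_forall_scaled h).mono fun p hp => by
    simpa using hp 0 ⟨le_rfl, zero_le_one⟩

/-- The conditions under which Moser's argument applies near `(y₀, 0)` to a family
`v ↦ β (y, v)` of two-forms on `E`. -/
structure IsSymplecticGerm (β : P × E → E →L[ℝ] E →L[ℝ] ℝ) (y₀ : P) : Prop where
  smooth : SmoothNear β (y₀, 0)
  alternating : ∀ᶠ p in 𝓝 (y₀, (0 : E)), ∀ a, β p a a = 0
  closed : ∀ᶠ p in 𝓝 (y₀, (0 : E)), ∀ a b c, fderiv ℝ β p (0, a) b c + fderiv ℝ β p (0, b) c a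
    + fderiv ℝ β p (0, c) a b = 0
  invertible : (β (y₀, 0)).IsInvertible

/-- The integrand of the Poincaré homotopy operator. -/
def moserIntegrand (β : P × E → E →L[ℝ] E →L[ℝ] ℝ) (z : ℝ × P × E) : E →L[ℝ] ℝ :=
  z.1 • ((β (z.2.1, z.1 • z.2.2) - β (z.2.1, 0)) z.2.2)

/-- The primitive of `β (y, ·) - β (y, 0)` given by the Poincaré homotopy operator. -/
def moserPrimitive (β : P × E → E →L[ℝ] E →L[ℝ] ℝ) (p : P × E) : E →L[ℝ] ℝ :=
  ∫ s in (0 : ℝ)..1, moserIntegrand β (s, p)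

/-- The linear path of two-forms from `β (y, 0)` to `β (y, ·)`. -/
def moserPath (β : P × E → E →L[ℝ] E →L[ℝ] ℝ) (z : ℝ × P × E) : E →L[ℝ] E →L[ℝ] ℝ :=
  β (z.2.1, 0) + z.1 • (β z.2 - β (z.2.1, 0))

/-- The time-dependent vector field of Moser's argument. -/
def moserField (β : P × E → E →L[ℝ] E →L[ℝ] ℝ) (z : ℝ × P × E) : E :=
  -(moserPath β z).inverse (moserPrimitive β z.2)

variable {β : P × E → E →L[ℝ] E →L[ℝ] ℝ} {y₀ : P}

theorem smoothNear_zero_section {F : Type*} [NormedAddCommGroup F] [NormedSpace ℝ F]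
    {f : P × E → F} {p : P × E} (h : SmoothNear f (p.1, 0)) :
    SmoothNear (fun q : P × E => f (q.1, 0)) p :=
  SmoothNear.comp (g := f) p h ((SmoothNear.fst p).prodMk (SmoothNear.const 0 p))

theorem hasFDerivAt_zero_section {F : Type*} [NormedAddCommGroup F] [NormedSpace ℝ F]
    {f : P × E → F} {p : P × E} (h : SmoothNear f (p.1, 0)) :
    HasFDerivAt (fun q : P × E => f (q.1, 0))
      ((fderiv ℝ f (p.1, 0)).comp ((ContinuousLinearMap.fst ℝ P E).prod 0)) p :=
  HasFDerivAt.comp (g := f) (f := fun q : P × E => (q.1, (0 : E))) p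
    h.differentiableAt.hasFDerivAt (hasFDerivAt_fst.prodMk (hasFDerivAt_const 0 p))

theorem smoothNear_moserIntegrand {z : ℝ × P × E} (h : SmoothNear β (z.2.1, z.1 • z.2.2))
    (h0 : SmoothNear β (z.2.1, 0)) : SmoothNear (moserIntegrand β) z := by
  have hA : ContDiff ℝ ∞ (fun z : ℝ × P × E => (z.2.1, z.1 • z.2.2)) := by fun_prop
  have hB : ContDiff ℝ ∞ (fun z : ℝ × P × E => (z.2.1, (0 : E))) := by fun_prop
  exact (SmoothNear.fst z).smul ((((SmoothNear.comp (g := β) z h (hA.smoothNear z)).sub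
    (SmoothNear.comp (g := β) z h0 (hB.smoothNear z)))).clm_apply
      (contDiff_snd.snd.smoothNear z))

theorem fderiv_moserIntegrand {s : ℝ} {p : P × E} (h : SmoothNear β (p.1, s • p.2))
    (h0 : SmoothNear β (p.1, 0)) (u : P) (a : E) :
    fderiv ℝ (moserIntegrand β) (s, p) (0, (u, a)) =
      s • ((fderiv ℝ β (p.1, s • p.2) (u, s • a) - fderiv ℝ β (p.1, 0) (u, 0)) p.2 +
        (β (p.1, s • p.2) - β (p.1, 0)) a) := by
  have e : HasFDerivAt (fun q : P × E => (s, q)) (ContinuousLinearMap.inr ℝ ℝ (P × E)) p :=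
    hasFDerivAt_prodMk_right s p
  have h1 : HasFDerivAt (fun q : P × E => moserIntegrand β (s, q))
      ((fderiv ℝ (moserIntegrand β) (s, p)).comp (ContinuousLinearMap.inr ℝ ℝ (P × E))) p :=
    HasFDerivAt.comp (g := moserIntegrand β) (f := fun q : P × E => (s, q)) p
      (smoothNear_moserIntegrand (z := (s, p)) h h0).differentiableAt.hasFDerivAt e
  have hA : HasFDerivAt (fun q : P × E => (q.1, s • q.2))
      ((ContinuousLinearMap.fst ℝ P E).prod (s • ContinuousLinearMap.snd ℝ P E)) p :=
    hasFDerivAt_fst.prodMk (hasFDerivAt_snd.const_smul s)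
  have h2 : HasFDerivAt (fun q : P × E => β (q.1, s • q.2)) _ p :=
    HasFDerivAt.comp (g := β) (f := fun q : P × E => (q.1, s • q.2)) p
      h.differentiableAt.hasFDerivAt hA
  have h3 := (((h2.sub (hasFDerivAt_zero_section h0)).clm_apply
    (hasFDerivAt_snd (p := p))).const_smul s)
  have h4 := h1.unique h3
  have h5 := congrArg (fun L => L (u, a)) h4
  simpa [add_comm] using h5

theorem IsSymplecticGerm.smooth_scaled (h : IsSymplecticGerm β y₀) :
    ∀ᶠ p in 𝓝 (y₀, (0 : E)), ∀ s ∈ Set.Icc (0 : ℝ) 1, SmoothNear β (p.1, s • p.2) :=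
  eventually_forall_scaled h.smooth.eventually

theorem IsSymplecticGerm.smoothNear_moserPrimitive (h : IsSymplecticGerm β y₀) :
    SmoothNear (moserPrimitive β) (y₀, 0) ∧ ∀ᶠ p in 𝓝 (y₀, (0 : E)), ∀ a,
      fderiv ℝ (moserPrimitive β) p a =
        ∫ s in (0 : ℝ)..1, fderiv ℝ (moserIntegrand β) (s, p) (0, a) :=
  SmoothNear.parametric_integral fun s _ =>
    smoothNear_moserIntegrand (z := (s, y₀, 0)) (by simpa using h.smooth) h.smooth

theorem moserPrimitive_zero (y : P) : moserPrimitive β (y, 0) = 0 := by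
  simp [moserPrimitive, moserIntegrand]

/-- The integrand is bilinear in `β (y, s • v) - β (y, 0)` and `v`, both of which vanish at `v = 0`,
so it vanishes to second order. This makes the Moser field vanish to first order. -/
theorem IsSymplecticGerm.fderiv_moserPrimitive_zero (h : IsSymplecticGerm β y₀) :
    fderiv ℝ (moserPrimitive β) (y₀, 0) = 0 := by
  refine ContinuousLinearMap.ext fun a => ?_
  rw [h.smoothNear_moserPrimitive.2.self_of_nhds a]
  have : ∀ s : ℝ, fderiv ℝ (moserIntegrand β) (s, (y₀, 0)) (0, a) = 0 := fun s => by
    rw [show a = (a.1, a.2) from rfl,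
      fderiv_moserIntegrand (by simpa using h.smooth) (by simpa using h.smooth)]
    simp
  simp [this]

/-- Polarization of the alternating condition, differentiated: the identity holds on a
neighbourhood, so its derivative vanishes too. -/
theorem IsSymplecticGerm.fderiv_antisymm (h : IsSymplecticGerm β y₀) :
    ∀ᶠ p in 𝓝 (y₀, (0 : E)), ∀ a b c, fderiv ℝ β p c a b = -fderiv ℝ β p c b a := by
  filter_upwards [h.alternating.eventually_nhds, h.smooth] with p hp hs a b c
  have hd := (hs.differentiableAt (by simp)).hasFDerivAt
  have h1 : HasFDerivAt (fun q => β q (a + b) (a + b)) _ p :=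
    (hd.clm_apply (hasFDerivAt_const (a + b) p)).clm_apply (hasFDerivAt_const (a + b) p)
  have h2 : HasFDerivAt (fun q => β q a a) _ p :=
    (hd.clm_apply (hasFDerivAt_const a p)).clm_apply (hasFDerivAt_const a p)
  have h3 : HasFDerivAt (fun q => β q b b) _ p :=
    (hd.clm_apply (hasFDerivAt_const b p)).clm_apply (hasFDerivAt_const b p)
  have e1 := (h1.congr_of_eventuallyEq (hp.mono fun q hq => (hq (a + b)).symm)).unique
    (hasFDerivAt_const (0 : ℝ) p)
  have e2 := (h2.congr_of_eventuallyEq (hp.mono fun q hq => (hq a).symm)).unique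
    (hasFDerivAt_const (0 : ℝ) p)
  have e3 := (h3.congr_of_eventuallyEq (hp.mono fun q hq => (hq b).symm)).unique
    (hasFDerivAt_const (0 : ℝ) p)
  have e1 := congrArg (fun L => L c) e1
  have e2 := congrArg (fun L => L c) e2
  have e3 := congrArg (fun L => L c) e3
  simp at e1 e2 e3
  linarith

theorem IsSymplecticGerm.antisymm (h : IsSymplecticGerm β y₀) :
    ∀ᶠ p in 𝓝 (y₀, (0 : E)), ∀ a b, β p a b = -β p b a := by
  filter_upwards [h.alternating] with p hp a b
  have := hp (a + b)
  simp only [map_add, _root_.add_apply, hp a, hp b] at this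
  linarith

/-- Poincaré's lemma: the exterior derivative of `moserPrimitive β` is `β (y, ·) - β (y, 0)`. -/
theorem IsSymplecticGerm.exteriorDerivative_moserPrimitive (h : IsSymplecticGerm β y₀) :
    ∀ᶠ p in 𝓝 (y₀, (0 : E)), ∀ a b : E, fderiv ℝ (moserPrimitive β) p (0, a) b
      - fderiv ℝ (moserPrimitive β) p (0, b) a = β p a b - β (p.1, 0) a b := by
  filter_upwards [h.smoothNear_moserPrimitive.2, h.smooth_scaled,
    eventually_forall_scaled h.closed, eventually_forall_scaled h.fderiv_antisymm,
    eventually_forall_scaled h.antisymm, eventually_zero_section h.antisymm] with p h1 h2 h3 h4 h5 h6 a b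
  have hz : SmoothNear β (p.1, 0) := by simpa using h2 0 ⟨le_rfl, zero_le_one⟩
  have hint : ∀ a : E, IntervalIntegrable
      (fun s => fderiv ℝ (moserIntegrand β) (s, p) (0, (0, a))) MeasureTheory.volume 0 1 := by
    intro a
    refine ContinuousOn.intervalIntegrable fun s hs => ?_
    rw [Set.uIcc_of_le zero_le_one] at hs
    have : ContinuousAt (fderiv ℝ (moserIntegrand β)) (s, p) :=
      (smoothNear_moserIntegrand (z := (s, p)) (h2 s hs) hz).fderiv.continuousAt
    have h7 : ContinuousAt (fun s => fderiv ℝ (moserIntegrand β) (s, p)) s :=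
      ContinuousAt.comp (g := fderiv ℝ (moserIntegrand β)) (f := fun s : ℝ => (s, p)) this
        (by fun_prop)
    exact (h7.clm_apply continuousAt_const).continuousWithinAt
  have happ : ∀ a b : E, fderiv ℝ (moserPrimitive β) p (0, a) b =
      ∫ s in (0 : ℝ)..1, fderiv ℝ (moserIntegrand β) (s, p) (0, (0, a)) b := by
    intro a b
    rw [h1]
    exact ((ContinuousLinearMap.apply ℝ ℝ b).intervalIntegral_comp_comm (hint a)).symm
  have hint' : ∀ a b : E, IntervalIntegrable
      (fun s => fderiv ℝ (moserIntegrand β) (s, p) (0, (0, a)) b) MeasureTheory.volume 0 1 :=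
    fun a b => ⟨(ContinuousLinearMap.apply ℝ ℝ b).integrable_comp (hint a).1,
      (ContinuousLinearMap.apply ℝ ℝ b).integrable_comp (hint a).2⟩
  rw [happ, happ, ← intervalIntegral.integral_sub (hint' a b) (hint' b a)]
  -- Closedness of `β` on the triple `(v, a, b)` turns the integrand of the exterior derivative into
  -- the derivative of `s² (β (y, s • v) - β (y, 0)) (a, b)`. The fundamental theorem of calculus
  -- then gives the claim, as this function vanishes at `s = 0`.
  have hder : ∀ s ∈ Set.uIcc (0 : ℝ) 1, HasDerivAt
      (fun s : ℝ => s ^ 2 * ((β (p.1, s • p.2) - β (p.1, 0)) a b))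
      (fderiv ℝ (moserIntegrand β) (s, p) (0, (0, a)) b
        - fderiv ℝ (moserIntegrand β) (s, p) (0, (0, b)) a) s := by
    intro s hs
    rw [Set.uIcc_of_le zero_le_one] at hs
    have hc : HasDerivAt (fun s : ℝ => (p.1, s • p.2)) ((0 : P), (1 : ℝ) • p.2) s :=
      (hasDerivAt_const s p.1).prodMk ((hasDerivAt_id s).smul_const p.2)
    have hb : HasDerivAt (fun s : ℝ => β (p.1, s • p.2))
        (fderiv ℝ β (p.1, s • p.2) ((0 : P), (1 : ℝ) • p.2)) s :=
      HasFDerivAt.comp_hasDerivAt (l := β) s (h2 s hs).differentiableAt.hasFDerivAt hc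
    have hb2 := (((hb.sub_const (β (p.1, 0))).clm_apply (hasDerivAt_const s a)).clm_apply
      (hasDerivAt_const s b))
    have hb3 := (hasDerivAt_pow 2 s).mul hb2
    refine hb3.congr_deriv ?_
    rw [fderiv_moserIntegrand (h2 s hs) hz, fderiv_moserIntegrand (h2 s hs) hz]
    have k1 := h3 s hs p.2 a b
    have k2 := h4 s hs b p.2 (0, a)
    have sm : ∀ x : E, ((0 : P), s • x) = s • ((0 : P), x) := fun x => by simp
    simp only [sm, map_smul, one_smul, Prod.mk_zero_zero, map_zero, sub_zero,
      _root_.smul_apply, _root_.add_apply,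
      _root_.sub_apply, smul_eq_mul, add_zero]
    rw [h5 s hs b a, h6 b a]
    push_cast
    rw [k2] at k1
    linear_combination s ^ 2 * k1
  rw [intervalIntegral.integral_eq_sub_of_hasDerivAt hder ((hint' a b).sub (hint' b a))]
  simp

end Moser

/-! ### Moser's argument with parameters: the vector field and its flow -/

section Moser

open unitInterval

theorem ContinuousLinearMap.IsInvertible.eventually {E F : Type*} [NormedAddCommGroup E]
    [NormedSpace ℝ E] [NormedAddCommGroup F] [NormedSpace ℝ F] [CompleteSpace E]
    {f : E →L[ℝ] F} (h : f.IsInvertible) : ∀ᶠ g in 𝓝 f, g.IsInvertible := by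
  obtain ⟨e, rfl⟩ := h
  exact ContinuousLinearEquiv.nhds e

theorem SmoothNear.inverse {V E F : Type*} [NormedAddCommGroup V] [NormedSpace ℝ V]
    [NormedAddCommGroup E]
    [NormedSpace ℝ E] [NormedAddCommGroup F] [NormedSpace ℝ F] [CompleteSpace E]
    {f : V → E →L[ℝ] F} {z : V} (hf : SmoothNear f z) (h : (f z).IsInvertible) :
    SmoothNear (fun w => (f w).inverse) z := by
  filter_upwards [hf, hf.continuousAt.eventually h.eventually] with w h1 h2
  obtain ⟨e, he⟩ := h2
  have := contDiffAt_map_inverse (𝕜 := ℝ) (n := ∞) e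
  rw [he] at this
  exact this.comp w h1

variable {P E : Type u} [NormedAddCommGroup P] [NormedSpace ℝ P] [CompleteSpace P]
  [NormedAddCommGroup E] [NormedSpace ℝ E] [CompleteSpace E]
  {β : P × E → E →L[ℝ] E →L[ℝ] ℝ} {y₀ : P}

theorem hasFDerivAt_moserPath {z : ℝ × P × E} (h : SmoothNear β z.2)
    (h0 : SmoothNear β (z.2.1, 0)) (r : ℝ) (u : P) (a : E) :
    SmoothNear (moserPath β) z ∧ fderiv ℝ (moserPath β) z (r, u, a) =
      fderiv ℝ β (z.2.1, 0) (u, 0) + (r • (β z.2 - β (z.2.1, 0)) +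
        z.1 • (fderiv ℝ β z.2 (u, a) - fderiv ℝ β (z.2.1, 0) (u, 0))) := by
  have s1 : SmoothNear (fun z : ℝ × P × E => β z.2) z := SmoothNear.comp (g := β) z h (.snd z)
  have s2 : SmoothNear (fun z : ℝ × P × E => β (z.2.1, 0)) z :=
    SmoothNear.comp (g := fun q : P × E => β (q.1, 0)) (f := Prod.snd) z
      (smoothNear_zero_section h0) (.snd z)
  have d1 : HasFDerivAt (fun z : ℝ × P × E => β z.2)
      ((fderiv ℝ β z.2).comp (ContinuousLinearMap.snd ℝ ℝ (P × E))) z :=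
    HasFDerivAt.comp (g := β) z h.differentiableAt.hasFDerivAt hasFDerivAt_snd
  have d2 : HasFDerivAt (fun z : ℝ × P × E => β (z.2.1, 0)) _ z :=
    HasFDerivAt.comp (g := fun q : P × E => β (q.1, 0)) (f := Prod.snd) z
      (hasFDerivAt_zero_section h0) hasFDerivAt_snd
  refine ⟨s2.add ((SmoothNear.fst z).smul (s1.sub s2)), ?_⟩
  have d3 : HasFDerivAt (moserPath β) _ z := d2.add ((hasFDerivAt_fst (p := z)).smul (d1.sub d2))
  rw [d3.fderiv]
  simp [add_comm]

theorem IsSymplecticGerm.moserPath_zero (s : ℝ) (y : P) :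
    moserPath β (s, y, 0) = β (y, 0) := by simp [moserPath]

theorem IsSymplecticGerm.smoothNear_moserPath (h : IsSymplecticGerm β y₀) (s : ℝ) :
    SmoothNear (moserPath β) (s, y₀, 0) :=
  (hasFDerivAt_moserPath (z := (s, y₀, 0)) h.smooth h.smooth 0 0 0).1

theorem IsSymplecticGerm.smoothNear_moserField (h : IsSymplecticGerm β y₀) (s : ℝ) :
    SmoothNear (moserField β) (s, y₀, 0) :=
  ((((h.smoothNear_moserPath s).inverse (by
    rw [moserPath_zero]; exact h.invertible))).clm_apply
    (SmoothNear.comp (g := moserPrimitive β) _ h.smoothNear_moserPrimitive.1 (.snd _))).neg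

theorem moserField_zero (s : ℝ) (y : P) : moserField β (s, y, 0) = 0 := by
  simp [moserField, moserPrimitive_zero]

/-- In the product rule both terms contain the primitive or its derivative at `(y₀, 0)`, and both of
these are zero. This is the hypothesis needed for the flow up to time one. -/
theorem IsSymplecticGerm.fderiv_moserField_zero (h : IsSymplecticGerm β y₀) (s : ℝ) :
    fderiv ℝ (moserField β) (s, y₀, 0) = 0 := by
  have h1 : HasFDerivAt (fun z : ℝ × P × E => (moserPath β z).inverse) _ (s, y₀, 0) :=
    ((h.smoothNear_moserPath s).inverse (by
      rw [moserPath_zero]; exact h.invertible)).differentiableAt.hasFDerivAt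
  have h2 : HasFDerivAt (fun z : ℝ × P × E => moserPrimitive β z.2) _ (s, y₀, (0 : E)) :=
    HasFDerivAt.comp (g := moserPrimitive β) (f := Prod.snd) (s, y₀, (0 : E))
      h.smoothNear_moserPrimitive.1.differentiableAt.hasFDerivAt hasFDerivAt_snd
  have h3 : HasFDerivAt (moserField β) _ (s, y₀, 0) := (h1.clm_apply h2).neg
  rw [h3.fderiv, h.fderiv_moserPrimitive_zero, moserPrimitive_zero]
  ext <;> simp

/-- The defining equation of the Moser field, contraction of the path of forms with the field being
minus the primitive. It holds where the path of forms is invertible, an open condition satisfied on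
the zero section. -/
theorem IsSymplecticGerm.eventually_moserPath_moserField (h : IsSymplecticGerm β y₀) (s : ℝ) :
    ∀ᶠ z in 𝓝 (s, y₀, (0 : E)), moserPath β z (moserField β z) = -moserPrimitive β z.2 := by
  have h1 : (moserPath β (s, y₀, 0)).IsInvertible := by
    rw [moserPath_zero]; exact h.invertible
  filter_upwards [(h.smoothNear_moserPath s).continuousAt.eventually h1.eventually] with z hz
  rw [moserField, map_neg, hz.self_apply_inverse]

/-- The infinitesimal form of Moser's argument: the derivative along the flow of the pulled back
path of forms vanishes. -/
theorem IsSymplecticGerm.eventually_lie_derivative (h : IsSymplecticGerm β y₀) (s : ℝ) :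
    ∀ᶠ z in 𝓝 (s, y₀, (0 : E)), SmoothNear (moserPath β) z ∧ ∀ a b : E,
      fderiv ℝ (moserPath β) z (1, 0, moserField β z) a b
        + moserPath β z (fderiv ℝ (moserField β) z (0, 0, a)) b
        + moserPath β z a (fderiv ℝ (moserField β) z (0, 0, b)) = 0 := by
  have pull : ∀ {Q : P × E → Prop}, (∀ᶠ p in 𝓝 (y₀, (0 : E)), Q p) →
      ∀ᶠ z in 𝓝 (s, y₀, (0 : E)), Q z.2 := fun hQ => continuousAt_snd.eventually hQ
  filter_upwards [(h.smoothNear_moserPath s).eventually,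
    (h.smoothNear_moserField s).eventually,
    (h.eventually_moserPath_moserField s).eventually_nhds, pull h.smooth.eventually,
    pull (eventually_zero_section h.smooth.eventually), pull h.antisymm,
    pull (eventually_zero_section h.antisymm), pull h.closed, pull h.fderiv_antisymm,
    pull h.exteriorDerivative_moserPrimitive, pull h.smoothNear_moserPrimitive.1.eventually]
    with z sp sf hid sβ sβ0 anti anti0 cl danti ext sprim
  refine ⟨sp, ?_⟩
  set X := moserField β z with hX
  set s := z.1
  have hd : ∀ r u a, fderiv ℝ (moserPath β) z (r, u, a) = _ := fun r u a =>
    (hasFDerivAt_moserPath sβ sβ0 r u a).2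
  -- Differentiate the defining equation of the Moser field in the direction `a`.
  have key : ∀ a b, fderiv ℝ (moserPath β) z (0, 0, a) X b
      + moserPath β z (fderiv ℝ (moserField β) z (0, 0, a)) b
      = - fderiv ℝ (moserPrimitive β) z.2 (0, a) b := by
    intro a b
    have d1 : HasFDerivAt (fun w => moserPath β w (moserField β w)) _ z :=
      sp.differentiableAt.hasFDerivAt.clm_apply sf.differentiableAt.hasFDerivAt
    have d2 : HasFDerivAt (fun w : ℝ × P × E => -moserPrimitive β w.2) _ z :=
      (HasFDerivAt.comp (g := moserPrimitive β) (f := Prod.snd) z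
        sprim.differentiableAt.hasFDerivAt hasFDerivAt_snd).neg
    have d3 := congrArg (fun L => L (0, 0, a) b)
      (d1.unique (d2.congr_of_eventuallyEq hid))
    simp only [_root_.add_apply, ContinuousLinearMap.flip_apply,
      ContinuousLinearMap.comp_apply, _root_.neg_apply, ContinuousLinearMap.coe_snd'] at d3
    rw [add_comm]
    exact d3
  have pathanti : ∀ a b, moserPath β z a b = - moserPath β z b a := by
    intro a b
    simp only [moserPath, _root_.add_apply, _root_.smul_apply, _root_.sub_apply, smul_eq_mul]
    rw [anti a b, anti0 a b]; ring
  intro a b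
  rw [pathanti a]
  have k1 := key a b
  have k2 := key b a
  rw [hd] at k1 k2 ⊢
  have k3 := ext a b
  have k4 := cl X a b
  have k5 := danti b X (0, a)
  simp only [Prod.mk_zero_zero, map_zero, zero_smul, sub_zero, zero_add, one_smul,
    _root_.add_apply, _root_.smul_apply, _root_.sub_apply, smul_eq_mul] at k1 k2 ⊢
  -- Cartan's formula in coordinates: antisymmetrizing `key` gives the exterior derivative of the
  -- contraction, `k3` identifies that of the primitive with the time derivative of the path, and
  -- `k4` is closedness of `β` on `(X, a, b)`. The form `β (y, 0)` is constant in `v` and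
  -- contributes nothing to closedness.
  linear_combination k1 - k2 - k3 + z.1 * k4 - z.1 * k5

/-- The integrand is identically zero for parameters with constant forms. Here `Z` is an arbitrary
set, so it may consist of the zeros of a cut-off function. -/
theorem IsSymplecticGerm.moserPrimitive_eq_zero {Z : Set P}
    (hZ : ∀ᶠ p in 𝓝 (y₀, (0 : E)), p.1 ∈ Z → β p = β (p.1, 0)) :
    ∀ᶠ p in 𝓝 (y₀, (0 : E)), p.1 ∈ Z → moserPrimitive β p = 0 := by
  filter_upwards [eventually_forall_scaled hZ] with p hp hpZ
  rw [moserPrimitive, intervalIntegral.integral_congr (g := fun _ => 0)]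
  · simp
  · intro s hs
    rw [Set.uIcc_of_le zero_le_one] at hs
    simp [moserIntegrand, hp s hs hpZ]

/-- Moser's argument with parameters: `θ (y, ·)` is a germ of diffeomorphism at `0` pulling
`β (y, ·)` back to the constant form `β (y, 0)`, and it is the identity for all parameters for
which `β (y, ·)` is already constant. -/
theorem IsSymplecticGerm.timeOne_moserField (h : IsSymplecticGerm β y₀) :
    SmoothNear (timeOne (moserField β)) (y₀, 0) ∧
    (∀ᶠ y in 𝓝 y₀, timeOne (moserField β) (y, 0) = 0) ∧
    (∀ a, fderiv ℝ (timeOne (moserField β)) (y₀, 0) (0, a) = a) ∧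
    (∀ᶠ p in 𝓝 (y₀, (0 : E)), ∀ a b,
      β (p.1, timeOne (moserField β) p) (fderiv ℝ (timeOne (moserField β)) p (0, a))
        (fderiv ℝ (timeOne (moserField β)) p (0, b)) = β (p.1, 0) a b) ∧
    ∀ Z : Set P, (∀ᶠ p in 𝓝 (y₀, (0 : E)), p.1 ∈ Z → β p = β (p.1, 0)) →
      ∀ᶠ p in 𝓝 (y₀, (0 : E)), p.1 ∈ Z → timeOne (moserField β) p = p.2 := by
  obtain ⟨h1, h2, h3⟩ := timeOne_spec (X := moserField β) (y₀ := y₀)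
    (fun s _ => h.smoothNear_moserField s) (fun s _ => moserField_zero s y₀)
    (fun s _ => h.fderiv_moserField_zero s) (fun s _ => h.eventually_lie_derivative s)
  refine ⟨h1, ?_, ?_, ?_, ?_⟩
  · have : ContinuousAt (fun y : P => (y, (0 : E))) y₀ := by fun_prop
    filter_upwards [this.eventually h2] with y hy
    exact hy fun s _ => moserField_zero s y
  · intro a
    obtain ⟨γ, η, hγ, -, -, -, -, hη⟩ := h3.self_of_nhds
    obtain ⟨hη0, hη1, hη2⟩ := hη a
    -- Along the stationary curve the variational equation has zero right-hand side, so its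
    -- solutions are constant.
    have hconst := constant_of_derivWithin_zero
      (f := Set.IccExtend (zero_le_one (α := ℝ)) (η a)) (a := 0) (b := 1)
      (fun t ht => (hη2 t ht).differentiableWithinAt) (fun t ht => by
        have ht' : t ∈ Set.Icc (0 : ℝ) 1 := ⟨ht.1, ht.2.le⟩
        rw [(hη2 t ht').derivWithin (uniqueDiffOn_Icc zero_lt_one t ht'), hγ rfl]
        change fderiv ℝ (moserField β) (t, y₀, 0) _ = 0
        rw [h.fderiv_moserField_zero]; rfl) 1 ⟨zero_le_one, le_rfl⟩
    rw [← hη1]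
    simpa [Set.IccExtend_of_mem, hη0] using hconst
  · filter_upwards [h3] with p hp a b
    obtain ⟨γ, η, -, hγ0, hγ1, hQ, hγ, hη⟩ := hp
    have ext : ∀ (g : C(I, E)) (t : ℝ) (ht : t ∈ Set.Icc (0 : ℝ) 1),
      Set.IccExtend (zero_le_one (α := ℝ)) g t = g ⟨t, ht⟩ := fun g t ht =>
        Set.IccExtend_of_mem _ _ ht
    -- The path of forms evaluated on two variations along a flow line is constant in time by the
    -- infinitesimal identity. Its value at `0` is `β (y, 0)` on the initial vectors, its value at
    -- `1` the pull-back of `β (y, ·)`.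
    have hder : ∀ t (ht : t ∈ Set.Icc (0 : ℝ) 1), HasDerivWithinAt
        (fun t => moserPath β (t, p.1, Set.IccExtend (zero_le_one (α := ℝ)) γ t)
          (Set.IccExtend (zero_le_one (α := ℝ)) (η a) t)
          (Set.IccExtend (zero_le_one (α := ℝ)) (η b) t)) 0 (Set.Icc 0 1) t := by
      intro t ht
      obtain ⟨q1, q2⟩ := hQ ⟨t, ht⟩
      have c1 : HasDerivWithinAt
          (fun t : ℝ => (t, p.1, Set.IccExtend (zero_le_one (α := ℝ)) γ t))
          ((1 : ℝ), (0 : P), moserField β (t, p.1, γ ⟨t, ht⟩)) (Set.Icc 0 1) t :=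
        (hasDerivWithinAt_id t _).prodMk ((hasDerivWithinAt_const t _ p.1).prodMk (hγ t ht))
      have c2 : HasFDerivAt (moserPath β) (fderiv ℝ (moserPath β) (t, p.1, γ ⟨t, ht⟩))
          (t, p.1, Set.IccExtend (zero_le_one (α := ℝ)) γ t) := by
        rw [ext γ t ht]; exact q1.differentiableAt.hasFDerivAt
      have c3 : HasDerivWithinAt
          (fun t : ℝ => moserPath β (t, p.1, Set.IccExtend (zero_le_one (α := ℝ)) γ t)) _
          (Set.Icc 0 1) t := HasFDerivAt.comp_hasDerivWithinAt (l := moserPath β)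
            (f := fun t : ℝ => (t, p.1, Set.IccExtend (zero_le_one (α := ℝ)) γ t)) t c2 c1
      have c4 := (c3.clm_apply ((hη a).2.2 t ht)).clm_apply ((hη b).2.2 t ht)
      refine c4.congr_deriv ?_
      have q3 := q2 (η a ⟨t, ht⟩) (η b ⟨t, ht⟩)
      simp only [_root_.add_apply, ext _ t ht]
      linarith
    have hconst := constant_of_derivWithin_zero (fun t ht => (hder t ht).differentiableWithinAt)
      (fun t ht => (hder t ⟨ht.1, ht.2.le⟩).derivWithin
        (uniqueDiffOn_Icc zero_lt_one t ⟨ht.1, ht.2.le⟩)) 1 ⟨zero_le_one, le_rfl⟩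
    rw [ext _ 1 ⟨zero_le_one, le_rfl⟩, ext _ 1 ⟨zero_le_one, le_rfl⟩,
      ext _ 1 ⟨zero_le_one, le_rfl⟩, ext _ 0 ⟨le_rfl, zero_le_one⟩,
      ext _ 0 ⟨le_rfl, zero_le_one⟩, ext _ 0 ⟨le_rfl, zero_le_one⟩] at hconst
    change moserPath β (1, p.1, γ 1) (η a 1) (η b 1)
      = moserPath β (0, p.1, γ 0) (η a 0) (η b 0) at hconst
    rw [hγ1, (hη a).1, (hη b).1, (hη a).2.1, (hη b).2.1] at hconst
    simpa [moserPath] using hconst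
  · intro Z hZ
    filter_upwards [h2, IsSymplecticGerm.moserPrimitive_eq_zero hZ] with p hp hp' hpZ
    refine hp fun s _ => ?_
    simp [moserField, hp' hpZ]

end Moser

/-! ### Fibrewise symplectic germs in a chart and their extension -/

section SymplecticGerm

theorem ContinuousLinearMap.isInvertible_of_nondegenerate {E : Type*} [NormedAddCommGroup E]
    [NormedSpace ℝ E] [FiniteDimensional ℝ E] (B : E →L[ℝ] E →L[ℝ] ℝ)
    (h : ∀ v, (∀ w, B v w = 0) → v = 0) : B.IsInvertible := by
  have hinj : Function.Injective (B : E →ₗ[ℝ] E →L[ℝ] ℝ) := by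
    rw [← LinearMap.ker_eq_bot, LinearMap.ker_eq_bot']
    intro v hv
    exact h v fun w => by
      have : B v = 0 := hv
      rw [this]; rfl
  have hdim : Module.finrank ℝ E = Module.finrank ℝ (E →L[ℝ] ℝ) := by
    rw [← (LinearMap.toContinuousLinearMap (𝕜 := ℝ) (E := E) (F' := ℝ)).finrank_eq]
    exact (Subspace.dual_finrank_eq (K := ℝ) (V := E)).symm
  exact ⟨(LinearEquiv.ofInjectiveOfFinrankEq _ hinj hdim).toContinuousLinearEquiv, by ext; rfl⟩

theorem SmoothNear.bilinearComp {V E F : Type*} [NormedAddCommGroup V] [NormedSpace ℝ V]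
    [NormedAddCommGroup E] [NormedSpace ℝ E] [NormedAddCommGroup F] [NormedSpace ℝ F]
    {f : V → E →L[ℝ] E →L[ℝ] ℝ} {g h : V → F →L[ℝ] E} {z : V} (hf : SmoothNear f z)
    (hg : SmoothNear g z) (hh : SmoothNear h z) :
    SmoothNear (fun w => (f w).bilinearComp (g w) (h w)) z := by
  have h1 : SmoothNear (fun w => (ContinuousLinearMap.compL ℝ F E ℝ).flip (h w)) z :=
    SmoothNear.comp (g := (ContinuousLinearMap.compL ℝ F E ℝ).flip) z
      (ContinuousLinearMap.smoothNear _ _) hh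
  exact h1.clm_comp (hf.clm_comp hg)

variable {E : Type u} [NormedAddCommGroup E] [NormedSpace ℝ E] [CompleteSpace E]

/-- `Ω` is a symplectic form near `y`. -/
structure IsSymplecticNear (Ω : E → E →L[ℝ] E →L[ℝ] ℝ) (y : E) : Prop where
  smooth : SmoothNear Ω y
  alternating : ∀ᶠ x in 𝓝 y, ∀ a, Ω x a a = 0
  closed : ∀ᶠ x in 𝓝 y, ∀ a b c,
    fderiv ℝ Ω x a b c + fderiv ℝ Ω x b c a + fderiv ℝ Ω x c a b = 0
  invertible : (Ω y).IsInvertible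

/-- `ψ` is a smooth family of maps `ψ (y, ·)` tangent to the translation `v ↦ y + v` at `0`. -/
structure IsExponentialGerm (ψ : E × E → E) (y : E) : Prop where
  zero : ∀ᶠ x in 𝓝 y, ψ (x, 0) = x
  smooth : SmoothNear ψ (y, 0)
  deriv : ∀ᶠ x in 𝓝 y, ∀ a, fderiv ℝ ψ (x, 0) (0, a) = a

/-- A germ `ψ` as above, for which every `ψ (y, ·)` pulls `Ω` back to the constant form `Ω y`. -/
structure IsThickeningGerm (Ω : E → E →L[ℝ] E →L[ℝ] ℝ) (ψ : E × E → E) (y : E) : Prop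
    extends IsExponentialGerm ψ y where
  symplectic : ∀ᶠ p in 𝓝 (y, (0 : E)), ∀ a b,
    Ω (ψ p) (fderiv ℝ ψ p (0, a)) (fderiv ℝ ψ p (0, b)) = Ω p.1 a b

/-- The pull-backs of `Ω` by the maps `ψ (y, ·)`. -/
def fibrePullback (Ω : E → E →L[ℝ] E →L[ℝ] ℝ) (ψ : E × E → E) (p : E × E) :
    E →L[ℝ] E →L[ℝ] ℝ :=
  (Ω (ψ p)).bilinearComp ((fderiv ℝ ψ p).comp (ContinuousLinearMap.inr ℝ E E))
    ((fderiv ℝ ψ p).comp (ContinuousLinearMap.inr ℝ E E))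

@[simp] theorem fibrePullback_apply (Ω : E → E →L[ℝ] E →L[ℝ] ℝ) (ψ : E × E → E) (p : E × E)
    (a b : E) :
    fibrePullback Ω ψ p a b = Ω (ψ p) (fderiv ℝ ψ p (0, a)) (fderiv ℝ ψ p (0, b)) := rfl

theorem IsSymplecticGerm.eventually {β : E × E → E →L[ℝ] E →L[ℝ] ℝ} {y : E}
    (h : IsSymplecticGerm β y) : ∀ᶠ x in 𝓝 y, IsSymplecticGerm β x := by
  have hc : ContinuousAt (fun x : E => (x, (0 : E))) y := by fun_prop
  filter_upwards [hc.eventually h.smooth.eventually,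
    hc.eventually h.alternating.eventually_nhds, hc.eventually h.closed.eventually_nhds,
    hc.eventually (h.smooth.continuousAt.eventually h.invertible.eventually)] with x h1 h2 h3 h4
  exact ⟨h1, h2, h3, h4⟩

theorem IsExponentialGerm.tendsto {ψ : E × E → E} {y : E} (h : IsExponentialGerm ψ y) :
    Filter.Tendsto ψ (𝓝 (y, 0)) (𝓝 y) := by
  have := h.smooth.continuousAt.tendsto
  rwa [h.zero.self_of_nhds] at this

/-- Pull-back preserves closedness because the second derivatives of `ψ` are symmetric and cancel in
the cyclic sum. At `v = 0` the fibre derivative is the identity, so the pulled-back form is `Ω y`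
itself and nondegeneracy is inherited. -/
theorem IsSymplecticNear.fibrePullback {Ω : E → E →L[ℝ] E →L[ℝ] ℝ} {ψ : E × E → E} {y : E}
    (hΩ : IsSymplecticNear Ω y) (hψ : IsExponentialGerm ψ y) :
    IsSymplecticGerm (fibrePullback Ω ψ) y := by
  have hψy : ψ (y, 0) = y := hψ.zero.self_of_nhds
  have hD : SmoothNear (fun p => (fderiv ℝ ψ p).comp (ContinuousLinearMap.inr ℝ E E)) (y, 0) :=
    hψ.smooth.fderiv.clm_comp (.const _ _)
  refine ⟨(SmoothNear.comp (g := Ω) _ (by rw [hψy]; exact hΩ.smooth) hψ.smooth).bilinearComp hD hD,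
    ?_, ?_, ?_⟩
  · filter_upwards [hψ.tendsto.eventually hΩ.alternating] with p hp a
    rw [fibrePullback_apply]; exact hp _
  · filter_upwards [hψ.tendsto.eventually hΩ.alternating, hψ.tendsto.eventually hΩ.closed,
      hψ.smooth.eventually, hψ.tendsto.eventually hΩ.smooth.eventually] with p alt cl sψ sΩ
    have anti : ∀ a b, Ω (ψ p) a b = -Ω (ψ p) b a := fun a b => by
      have := alt (a + b)
      simp only [map_add, _root_.add_apply, alt a, alt b] at this
      linarith
    have symm : ∀ u w, fderiv ℝ (fderiv ℝ ψ) p u w = fderiv ℝ (fderiv ℝ ψ) p w u :=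
      (sψ.contDiffAt.isSymmSndFDerivAt (by
        rw [minSmoothness_of_isRCLikeNormedField]
        exact WithTop.coe_le_coe.2 (le_top : (2 : ℕ∞) ≤ ⊤))).eq
    have hder : ∀ a b c, fderiv ℝ (_root_.fibrePullback Ω ψ) p (0, a) b c =
        fderiv ℝ Ω (ψ p) (fderiv ℝ ψ p (0, a)) (fderiv ℝ ψ p (0, b)) (fderiv ℝ ψ p (0, c))
        + Ω (ψ p) (fderiv ℝ (fderiv ℝ ψ) p (0, a) (0, b)) (fderiv ℝ ψ p (0, c))
        + Ω (ψ p) (fderiv ℝ ψ p (0, b)) (fderiv ℝ (fderiv ℝ ψ) p (0, a) (0, c)) := by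
      intro a b c
      have sD : SmoothNear (fun p => (fderiv ℝ ψ p).comp (ContinuousLinearMap.inr ℝ E E)) p :=
        sψ.fderiv.clm_comp (.const _ _)
      have d0 : DifferentiableAt ℝ (_root_.fibrePullback Ω ψ) p :=
        ((SmoothNear.comp (g := Ω) _ sΩ sψ).bilinearComp sD sD).differentiableAt
      have d1 : HasFDerivAt (fun q => _root_.fibrePullback Ω ψ q b c) _ p :=
        (d0.hasFDerivAt.clm_apply (hasFDerivAt_const b p)).clm_apply (hasFDerivAt_const c p)
      have e : ∀ x, HasFDerivAt (fun q => fderiv ℝ ψ q (0, x)) _ p := fun x =>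
        sψ.fderiv.differentiableAt.hasFDerivAt.clm_apply (hasFDerivAt_const ((0 : E), x) p)
      have d2 : HasFDerivAt (fun q => Ω (ψ q)) _ p := HasFDerivAt.comp (g := Ω) (f := ψ) p
        sΩ.differentiableAt.hasFDerivAt sψ.differentiableAt.hasFDerivAt
      have d3 : HasFDerivAt (fun q => Ω (ψ q) (fderiv ℝ ψ q (0, b)) (fderiv ℝ ψ q (0, c))) _ p :=
        (d2.clm_apply (e b)).clm_apply (e c)
      have d4 := congrArg (fun L => L (0, a)) (d1.unique d3)
      simp at d4
      rw [d4]; ring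
    intro a b c
    rw [hder, hder, hder, symm (0, b) (0, a), symm (0, c) (0, a), symm (0, c) (0, b)]
    rw [anti (fderiv ℝ ψ p (0, c)), anti (fderiv ℝ ψ p (0, b)), anti (fderiv ℝ ψ p (0, a))]
    linear_combination cl (fderiv ℝ ψ p (0, a)) (fderiv ℝ ψ p (0, b)) (fderiv ℝ ψ p (0, c))
  · convert hΩ.invertible using 1
    ext a b
    rw [fibrePullback_apply, hψy, hψ.deriv.self_of_nhds, hψ.deriv.self_of_nhds]

/-- The family `(x, v) ↦ (1 - χ x) F (x, v) + χ x (x + v)`. -/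
def interpolate (χ : E → ℝ) (F : E × E → E) (p : E × E) : E :=
  F p + χ p.1 • (p.1 + p.2 - F p)

theorem smoothNear_interpolate {χ : E → ℝ} {F : E × E → E} {p : E × E} (hχ : SmoothNear χ p.1)
    (hF : SmoothNear F p) : SmoothNear (interpolate χ F) p :=
  hF.add ((SmoothNear.comp (g := χ) _ hχ (.fst p)).smul (((SmoothNear.fst p).add (.snd p)).sub hF))

theorem fderiv_interpolate {χ : E → ℝ} {F : E × E → E} {p : E × E} (hχ : SmoothNear χ p.1)
    (hF : SmoothNear F p) (a : E) :
    fderiv ℝ (interpolate χ F) p (0, a) =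
      fderiv ℝ F p (0, a) + χ p.1 • (a - fderiv ℝ F p (0, a)) := by
  have d1 : HasFDerivAt (fun q : E × E => χ q.1) _ p :=
    HasFDerivAt.comp (g := χ) (f := Prod.fst) p hχ.differentiableAt.hasFDerivAt hasFDerivAt_fst
  have dF := hF.differentiableAt.hasFDerivAt
  have d2 : HasFDerivAt (interpolate χ F) _ p :=
    dF.add (d1.smul (((hasFDerivAt_fst (p := p)).add (hasFDerivAt_snd (p := p))).sub dF))
  rw [d2.fderiv]
  simp

theorem isExponentialGerm_add (y : E) : IsExponentialGerm (fun p : E × E => p.1 + p.2) y := by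
  refine ⟨.of_forall fun x => by simp, (SmoothNear.fst _).add (.snd _), .of_forall fun x a => ?_⟩
  have : HasFDerivAt (fun p : E × E => p.1 + p.2) _ (x, 0) :=
    (hasFDerivAt_fst (𝕜 := ℝ)).add hasFDerivAt_snd
  rw [this.fderiv]
  simp

theorem IsExponentialGerm.congr {ψ ψ' : E × E → E} {y : E} (h : IsExponentialGerm ψ y)
    (hψ : ψ' =ᶠ[𝓝 (y, 0)] ψ) : IsExponentialGerm ψ' y := by
  have hc : ContinuousAt (fun x : E => (x, (0 : E))) y := by fun_prop
  refine ⟨?_, h.smooth.congr hψ, ?_⟩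
  · filter_upwards [h.zero, hc.eventually hψ] with x h1 h2 using h2.trans h1
  · filter_upwards [h.deriv, hc.eventually hψ.eventually_nhds] with x h1 h2 a
    rw [Filter.EventuallyEq.fderiv_eq h2]; exact h1 a

/-- The conditions on value and fibre derivative at `v = 0` are affine and hold for translations,
hence survive interpolation. Near points where `χ` is identically `1` only the translation remains,
and `F` may be arbitrary. -/
theorem IsExponentialGerm.interpolate {χ : E → ℝ} {F : E × E → E} {y : E} (hχ : SmoothNear χ y)
    (h : IsExponentialGerm F y ∨ ∀ᶠ x in 𝓝 y, χ x = 1) :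
    IsExponentialGerm (interpolate χ F) y := by
  have hc : ContinuousAt (fun x : E => (x, (0 : E))) y := by fun_prop
  rcases h with h | h
  · refine ⟨?_, smoothNear_interpolate hχ h.smooth, ?_⟩
    · filter_upwards [h.zero] with x hx
      simp [_root_.interpolate, hx]
    · filter_upwards [h.deriv, hχ.eventually, hc.eventually h.smooth.eventually] with x h1 h2 h3 a
      rw [fderiv_interpolate h2 h3, h1]; simp
  · refine (isExponentialGerm_add y).congr ?_
    have : ContinuousAt (Prod.fst : E × E → E) (y, 0) := continuousAt_fst
    filter_upwards [this.eventually h] with p hp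
    simp [_root_.interpolate, hp]

/-- The inductive step: interpolate between `F` and translations, then apply Moser's argument. -/
theorem IsThickeningGerm.exists_extension (Ω : E → E →L[ℝ] E →L[ℝ] ℝ) (χ : E → ℝ)
    (F : E × E → E) : ∃ F' : E × E → E, ∀ y, IsSymplecticNear Ω y → SmoothNear χ y →
      ((IsThickeningGerm Ω F y ∨ ∀ᶠ x in 𝓝 y, χ x = 1) → IsThickeningGerm Ω F' y) ∧
      (IsThickeningGerm Ω F y → ∀ᶠ p in 𝓝 (y, (0 : E)), χ p.1 = 0 → F' p = F p) := by
  set ψ := interpolate χ F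
  set β := fibrePullback Ω ψ
  set θ := timeOne (moserField β)
  have hc : ∀ y : E, ContinuousAt (fun x : E => (x, (0 : E))) y := fun y => by fun_prop
  -- The same `F'` is used for all `y`: interpolation, pull-back and `timeOne` are globally defined
  -- functions, and only their properties are local.
  refine ⟨fun p => ψ (p.1, θ p), fun y hΩ hχ => ⟨fun h => ?_, fun h => ?_⟩⟩
  · have hψ : IsExponentialGerm ψ y :=
      IsExponentialGerm.interpolate hχ (h.imp_left fun h => h.toIsExponentialGerm)
    have hβ : IsSymplecticGerm β y := hΩ.fibrePullback hψ
    obtain ⟨θ1, θ2, -, θ4, -⟩ := hβ.timeOne_moserField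
    replace θ2 : ∀ᶠ x in 𝓝 y, θ (x, 0) = 0 := θ2
    -- Moser's argument gives the derivative only at its base point. The hypotheses are open in the
    -- base point, so it is applied at every `x` near `y`.
    have θ3 : ∀ᶠ x in 𝓝 y, ∀ a, fderiv ℝ θ (x, 0) (0, a) = a :=
      hβ.eventually.mono fun x hx => hx.timeOne_moserField.2.2.1
    have hθ0 : θ (y, 0) = 0 := θ2.self_of_nhds
    have hA : SmoothNear (fun p : E × E => (p.1, θ p)) (y, 0) := (SmoothNear.fst _).prodMk θ1
    have hAt : Filter.Tendsto (fun p : E × E => (p.1, θ p)) (𝓝 (y, 0)) (𝓝 (y, 0)) := by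
      have := hA.continuousAt.tendsto
      simpa only [hθ0] using this
    have hder : ∀ᶠ p in 𝓝 (y, (0 : E)), ∀ a, fderiv ℝ (fun p : E × E => ψ (p.1, θ p)) p (0, a) =
        fderiv ℝ ψ (p.1, θ p) (0, fderiv ℝ θ p (0, a)) := by
      filter_upwards [hAt.eventually hψ.smooth.eventually, θ1.eventually] with p h1 h2 a
      have d1 : HasFDerivAt (fun p : E × E => (p.1, θ p)) _ p :=
        hasFDerivAt_fst.prodMk h2.differentiableAt.hasFDerivAt
      have d2 : HasFDerivAt (fun p : E × E => ψ (p.1, θ p)) _ p :=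
        HasFDerivAt.comp (g := ψ) (f := fun p : E × E => (p.1, θ p)) p
          h1.differentiableAt.hasFDerivAt d1
      rw [d2.fderiv]; rfl
    refine ⟨⟨?_, SmoothNear.comp (g := ψ) _ (by rw [hθ0]; exact hψ.smooth) hA, ?_⟩, ?_⟩
    · filter_upwards [hψ.zero, θ2] with x h1 h2
      rw [h2, h1]
    · filter_upwards [(hc y).eventually hder, hψ.deriv, θ2, θ3] with x h1 h2 h3 h4 a
      rw [h1, h3, h4, h2]
    · have hf : ContinuousAt (Prod.fst : E × E → E) (y, 0) := continuousAt_fst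
      filter_upwards [hder, θ4, hf.eventually hψ.zero, hf.eventually hψ.deriv] with p h1 h2 h3 h4 a b
      rw [h1, h1]
      have := h2 a b
      rw [fibrePullback_apply, fibrePullback_apply] at this
      rw [this, h3, h4, h4]
  · have hψ : IsExponentialGerm ψ y :=
      IsExponentialGerm.interpolate hχ (.inl h.toIsExponentialGerm)
    have hβ : IsSymplecticGerm β y := hΩ.fibrePullback hψ
    have hf : ContinuousAt (Prod.fst : E × E → E) (y, 0) := continuousAt_fst
    -- Fibre derivatives do not differentiate `χ`. At a base point with `χ = 0` the pull-backs by
    -- `ψ` are therefore those by `F`, which are already constant, and Moser's correction is the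
    -- identity.
    have hZ : ∀ᶠ p in 𝓝 (y, (0 : E)), p.1 ∈ {x | χ x = 0} → β p = β (p.1, 0) := by
      filter_upwards [h.symplectic, eventually_zero_section h.symplectic, h.smooth.eventually,
        eventually_zero_section h.smooth.eventually, hf.eventually hχ.eventually]
        with p h1 h2 h3 h4 h5 (hp : χ p.1 = 0)
      ext a b
      rw [fibrePullback_apply, fibrePullback_apply, fderiv_interpolate h5 h3,
        fderiv_interpolate h5 h3, fderiv_interpolate (p := (p.1, 0)) h5 h4,
        fderiv_interpolate (p := (p.1, 0)) h5 h4]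
      simp only [ψ, _root_.interpolate, hp, zero_smul, add_zero]
      rw [h1, h2]
    filter_upwards [hβ.timeOne_moserField.2.2.2.2 _ hZ] with p h1 (hp : χ p.1 = 0)
    rw [show θ p = p.2 from h1 hp]
    simp [ψ, _root_.interpolate, hp]

end SymplecticGerm

/-! ### Smooth square roots near the identity -/

section SquareRoot

/-- The smooth square root near `1` in a Banach algebra. -/
theorem exists_smooth_sqrt (A : Type*) [NormedRing A] [NormedAlgebra ℝ A] [CompleteSpace A] :
    ∃ s : A → A, s 1 = 1 ∧ SmoothNear s 1 ∧ (∀ᶠ c in 𝓝 (1 : A), s c * s c = c) ∧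
      ∀ᶠ q in 𝓝 (1 : A), s (q * q) = q := by
  -- The factor `1 / 2` makes the derivative at `1` the identity.
  let f : A → A := fun q => (1 / 2 : ℝ) • (q * q)
  have hf : ContDiff ℝ ∞ f := by
    have : ContDiff ℝ ∞ (fun q : A => q * q) := contDiff_id.mul contDiff_id
    exact this.const_smul _
  have hd : HasFDerivAt f ((ContinuousLinearEquiv.refl ℝ A : A ≃L[ℝ] A) : A →L[ℝ] A) 1 := by
    have h1 := ((hasFDerivAt_id (𝕜 := ℝ) (1 : A)).mul' (hasFDerivAt_id (1 : A))).const_smul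
      (1 / 2 : ℝ)
    refine h1.congr_fderiv ?_
    ext x
    simp only [one_div, id_eq, one_smul, MulOpposite.op_one, _root_.smul_apply,
      ContinuousLinearMap.id_apply, smul_add, ← add_smul, ContinuousLinearEquiv.coe_refl]
    norm_num
  obtain ⟨g, g1, g2, g3, g4⟩ := (hf.smoothNear 1).exists_inverse _ hd
  have hf1 : f 1 = (1 / 2 : ℝ) • (1 : A) := by simp [f]
  have hh : ContDiff ℝ ∞ (fun c : A => (1 / 2 : ℝ) • c) := contDiff_id.const_smul _
  rw [hf1] at g1 g2 g3
  refine ⟨fun c => g ((1 / 2 : ℝ) • c), g1, SmoothNear.comp (g := g) 1 g2 (hh.smoothNear 1), ?_, g4⟩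
  have hc : ContinuousAt (fun c : A => (1 / 2 : ℝ) • c) 1 := hh.continuous.continuousAt
  filter_upwards [hc.eventually g3] with c h
  have := congrArg (fun x => (2 : ℝ) • x) h
  simpa [f, smul_smul] using this

/-- The square root is compatible with maps preserving squares. -/
theorem sqrt_fixed {A : Type*} [NormedRing A] {s : A → A} (h1 : s 1 = 1) (hs : ContinuousAt s 1)
    (hsq : ∀ᶠ c in 𝓝 (1 : A), s c * s c = c) (hinv : ∀ᶠ q in 𝓝 (1 : A), s (q * q) = q)
    {T : A → A} (hT : ContinuousAt T 1) (hT1 : T 1 = 1) (hTm : ∀ q, T (q * q) = T q * T q) :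
    ∀ᶠ c in 𝓝 (1 : A), T c = c → T (s c) = s c := by
  have hst : Filter.Tendsto s (𝓝 1) (𝓝 1) := by
    have := hs.tendsto; rwa [h1] at this
  have hTt : Filter.Tendsto T (𝓝 1) (𝓝 1) := by
    have := hT.tendsto; rwa [hT1] at this
  -- If `T c = c`, then `T (s c)` is another square root of `c` near `1`, and such roots are unique.
  filter_upwards [hsq, (hTt.comp hst).eventually hinv] with c h2 h3 h4
  have h3 : s (T (s c) * T (s c)) = T (s c) := h3
  rw [← hTm, h2, h4] at h3
  exact h3.symm

end SquareRoot

/-! ### The standard symplectic vector space -/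

section StandardSpace

/-- The standard symplectic form as a continuous bilinear form. -/
def stdFormL (n : ℕ) : StdSpace n →L[ℝ] StdSpace n →L[ℝ] ℝ :=
  LinearMap.toContinuousLinearMap
    { toFun := fun u => LinearMap.toContinuousLinearMap
        { toFun := fun v => stdForm n u v
          map_add' := fun v w => by
            simp only [stdForm, PiLp.add_apply, ← Finset.sum_add_distrib]
            exact Finset.sum_congr rfl fun i _ => by ring
          map_smul' := fun c v => by
            simp only [stdForm, PiLp.smul_apply, smul_eq_mul, RingHom.id_apply, Finset.mul_sum]
            exact Finset.sum_congr rfl fun i _ => by ring }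
      map_add' := fun v w => by
        ext x
        change stdForm n (v + w) x = stdForm n v x + stdForm n w x
        simp only [stdForm, PiLp.add_apply, ← Finset.sum_add_distrib]
        exact Finset.sum_congr rfl fun i _ => by ring
      map_smul' := fun c v => by
        ext x
        change stdForm n (c • v) x = c * stdForm n v x
        simp only [stdForm, PiLp.smul_apply, smul_eq_mul, Finset.mul_sum]
        exact Finset.sum_congr rfl fun i _ => by ring }

/-- The standard complex structure as a continuous linear map. -/
def stdJL (n : ℕ) : StdSpace n →L[ℝ] StdSpace n :=
  LinearMap.toContinuousLinearMap
    { toFun := stdJ n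
      map_add' := fun v w => by
        ext (i | i)
        · simp [stdJ, add_comm]
        · simp [stdJ]
      map_smul' := fun c v => by ext (i | i) <;> simp [stdJ] }

theorem stdJ_stdJ (n : ℕ) (v : StdSpace n) : stdJ n (stdJ n v) = -v := by
  ext (i | i) <;> simp [stdJ]

theorem stdForm_stdJ_stdJ (n : ℕ) (u v : StdSpace n) :
    stdForm n (stdJ n u) (stdJ n v) = stdForm n u v := by
  simp only [stdForm, stdJ, Sum.elim_inl, Sum.elim_inr]
  exact Finset.sum_congr rfl fun i _ => by ring

theorem stdForm_antisymm (n : ℕ) (u v : StdSpace n) : stdForm n u v = -stdForm n v u := by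
  simp only [stdForm, ← Finset.sum_neg_distrib]
  exact Finset.sum_congr rfl fun i _ => by ring

theorem stdForm_nondegenerate (n : ℕ) (v : StdSpace n) (h : ∀ w, stdForm n v w = 0) : v = 0 := by
  have := h (stdJ n v)
  rw [stdForm_stdJ] at this
  simpa using this

theorem stdFormL_isInvertible (n : ℕ) : (stdFormL n).IsInvertible :=
  ContinuousLinearMap.isInvertible_of_nondegenerate _ fun v h => stdForm_nondegenerate n v h

end StandardSpace

/-! ### Correcting frames to symplectic frames -/

section LocalFrame

variable {Y E : Type*} [NormedAddCommGroup Y] [NormedSpace ℝ Y]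
  [NormedAddCommGroup E] [NormedSpace ℝ E]

/-- A smooth family of linear maps `L y : ℝ²ⁿ → E` which is symplectic at `y₀` can be corrected
to a family of symplectic maps, keeping complex linearity. -/
theorem exists_symplectic_correction {n : ℕ} {Ω : Y → E →L[ℝ] E →L[ℝ] ℝ}
    {L : Y → StdSpace n →L[ℝ] E} {y₀ : Y} (hΩ : SmoothNear Ω y₀)
    (halt : ∀ᶠ y in 𝓝 y₀, ∀ a b, Ω y a b = -Ω y b a) (hL : SmoothNear L y₀)
    (h₀ : ∀ u v, Ω y₀ (L y₀ u) (L y₀ v) = stdForm n u v) :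
    ∃ R : Y → StdSpace n →L[ℝ] StdSpace n, SmoothNear R y₀ ∧ R y₀ = .id ℝ _ ∧
      (∀ᶠ y in 𝓝 y₀, ∀ u v, Ω y (L y (R y u)) (L y (R y v)) = stdForm n u v) ∧
      ∀ᶠ y in 𝓝 y₀, (∀ u v, Ω y (L y (stdJ n u)) (L y (stdJ n v)) = Ω y (L y u) (L y v)) →
        ∀ u, R y (stdJ n u) = stdJ n (R y u) := by
  let W := StdSpace n
  have hS := stdFormL_isInvertible n
  let S := stdFormL n
  let G : Y → W →L[ℝ] W →L[ℝ] ℝ := fun y => (Ω y).bilinearComp (L y) (L y)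
  have hG : SmoothNear G y₀ := hΩ.bilinearComp hL hL
  -- A polar decomposition: `C y` expresses the pulled-back form as `ω₀ (C u, v)` with `ω₀` the
  -- standard form. If `Q = √C` is `ω₀`-self-adjoint, the pulled-back form is `ω₀ (Q u, Q v)`, and
  -- `Q⁻¹` is the required correction.
  let C : Y → W →L[ℝ] W := fun y => S.inverse.comp (G y)
  have hC : SmoothNear C y₀ := (SmoothNear.const _ _).clm_comp hG
  have hCG : ∀ y u v, stdForm n (C y u) v = G y u v := fun y u v =>
    congrArg (fun l => l v) (hS.self_apply_inverse (G y u))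
  have ext : ∀ u u' : W, (∀ v, stdForm n u v = stdForm n u' v) → u = u' := fun u u' h => by
    refine hS.injective (ContinuousLinearMap.ext fun v => h v)
  have hC0 : C y₀ = 1 := ContinuousLinearMap.ext fun u => ext _ _ fun v => by
    rw [hCG]; exact h₀ u v
  have hCt : Filter.Tendsto C (𝓝 y₀) (𝓝 1) := by
    have := hC.continuousAt.tendsto; rwa [hC0] at this
  obtain ⟨s, s1, s2, s3, s4⟩ := exists_smooth_sqrt (W →L[ℝ] W)
  -- The adjoint for the standard form reverses products, so it preserves squares. It fixes `C` by
  -- antisymmetry of `Ω`, hence also the square root.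
  let T : (W →L[ℝ] W) → (W →L[ℝ] W) := fun q => S.inverse.comp ((S.flip.comp q).flip)
  have hTq : ∀ q u v, stdForm n (T q u) v = stdForm n u (q v) := fun q u v =>
    congrArg (fun l => l v) (hS.self_apply_inverse ((S.flip.comp q).flip u))
  have hTc : ContinuousAt T 1 := by
    have h1 : SmoothNear (fun q : W →L[ℝ] W => S.inverse.comp (S.bilinearComp (.id ℝ W) q)) 1 :=
      (SmoothNear.const _ _).clm_comp
        (SmoothNear.bilinearComp (.const _ _) (.const _ _) (.id _))
    exact h1.continuousAt
  have hT := sqrt_fixed s1 s2.continuousAt s3 s4 (T := T) hTc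
    (ContinuousLinearMap.ext fun u => ext _ _ fun v => by rw [hTq]; rfl)
    (fun q => ContinuousLinearMap.ext fun u => ext _ _ fun v => by
      rw [hTq]
      change _ = stdForm n (T q (T q u)) v
      rw [hTq, hTq]; rfl)
  -- Conjugation by the standard complex structure; its fixed points are the complex linear maps. It
  -- fixes `C`, and hence its root, when the pulled-back form is invariant under that structure.
  let T' : (W →L[ℝ] W) → (W →L[ℝ] W) := fun q => -((stdJL n).comp (q.comp (stdJL n)))
  have hT' := sqrt_fixed s1 s2.continuousAt s3 s4 (T := T')
    (((continuous_const.clm_comp (continuous_id.clm_comp continuous_const)).neg).continuousAt)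
    (ContinuousLinearMap.ext fun u => by
      change -(stdJ n (stdJ n u)) = u
      rw [stdJ_stdJ, neg_neg])
    (fun q => ContinuousLinearMap.ext fun u => by
      have hneg : ∀ x : W, stdJ n (-x) = -stdJ n x := fun x => map_neg (stdJL n) x
      change -(stdJ n (q (q (stdJ n u)))) = -(stdJ n (q (stdJ n (-(stdJ n (q (stdJ n u)))))))
      rw [hneg, stdJ_stdJ, neg_neg])
  let Q : Y → W →L[ℝ] W := fun y => s (C y)
  have hQ : SmoothNear Q y₀ := SmoothNear.comp (g := s) y₀ (by rw [hC0]; exact s2) hC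
  have hQ0 : Q y₀ = 1 := by simp only [Q, hC0, s1]
  have hQi : (Q y₀).IsInvertible := by rw [hQ0]; exact ⟨.refl ℝ W, rfl⟩
  refine ⟨fun y => (Q y).inverse, hQ.inverse hQi, ?_, ?_, ?_⟩
  · change (Q y₀).inverse = _
    rw [hQ0]; exact ContinuousLinearMap.inverse_id
  · filter_upwards [hCt.eventually s3, hCt.eventually hT, halt,
      hQ.continuousAt.eventually hQi.eventually] with y h1 h2 h3 h4 u v
    have h5 : T (C y) = C y := ContinuousLinearMap.ext fun u => ext _ _ fun v => by
      rw [hTq, hCG, stdForm_antisymm, hCG]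
      exact (h3 _ _).symm
    have h6 : T (Q y) = Q y := h2 h5
    have h7 : ∀ a, C y a = Q y (Q y a) := fun a => (congrArg (fun l => l a) h1).symm
    change G y _ _ = _
    rw [← hCG, h7, h4.self_apply_inverse]
    nth_rw 1 [← h6]
    rw [hTq, h4.self_apply_inverse]
  · filter_upwards [hCt.eventually hT', hQ.continuousAt.eventually hQi.eventually]
      with y h1 h2 h3 u
    have hneg : ∀ x : W, stdJ n (-x) = -stdJ n x := fun x => map_neg (stdJL n) x
    have skew : ∀ a b : W, stdForm n (stdJ n a) b = -stdForm n a (stdJ n b) := fun a b => by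
      rw [← stdForm_stdJ_stdJ n (stdJ n a) b, stdJ_stdJ]
      exact congrArg (fun l => l (stdJ n b)) (map_neg S a)
    have h4 : T' (C y) = C y := ContinuousLinearMap.ext fun u => ext _ _ fun v => by
      change stdForm n (-(stdJ n (C y (stdJ n u)))) v = _
      have : stdForm n (-(stdJ n (C y (stdJ n u)))) v = -stdForm n (stdJ n (C y (stdJ n u))) v :=
        congrArg (fun l => l v) (map_neg S _)
      rw [this, skew, hCG, hCG, neg_neg]
      exact h3 u v
    have h5 : T' (Q y) = Q y := h1 h4
    have h6 : ∀ a, Q y (stdJ n a) = stdJ n (Q y a) := fun a => by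
      have := congrArg (fun l => l a) h5
      change -(stdJ n (Q y (stdJ n a))) = Q y a at this
      rw [← this, hneg, stdJ_stdJ, neg_neg]
    apply h2.injective
    rw [h2.self_apply_inverse, h6, h2.self_apply_inverse]

end LocalFrame

/-! ### Symplectic and unitary bases -/

section SymplecticLinearAlgebra

variable {E : Type*} [NormedAddCommGroup E] [NormedSpace ℝ E] [FiniteDimensional ℝ E]

/-- A complex structure compatible with a bilinear form. -/
structure IsCompatible (B : E →L[ℝ] E →L[ℝ] ℝ) (J : E →L[ℝ] E) : Prop where
  sq : ∀ v, J (J v) = -v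
  compatible : ∀ u v, B (J u) (J v) = B u v
  pos : ∀ v, v ≠ 0 → 0 < B v (J v)

theorem antisymm_of_alternating {B : E →L[ℝ] E →L[ℝ] ℝ} (h : ∀ a, B a a = 0) (a b : E) :
    B a b = -B b a := by
  have := h (a + b)
  simp only [map_add, _root_.add_apply, h a, h b] at this
  linarith

theorem exists_ne_zero_forall_eq_zero {ι : Type*} [Fintype ι] (f : ι → E →L[ℝ] ℝ)
    (h : Fintype.card ι < Module.finrank ℝ E) : ∃ v : E, v ≠ 0 ∧ ∀ i, f i v = 0 := by
  let F : E →ₗ[ℝ] (ι → ℝ) := LinearMap.pi fun i => (f i : E →ₗ[ℝ] ℝ)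
  have hF : F.ker ≠ ⊥ := LinearMap.ker_ne_bot_of_finrank_lt (by simpa using h)
  obtain ⟨v, hv, hv0⟩ := Submodule.exists_mem_ne_zero_of_ne_bot hF
  exact ⟨v, hv0, fun i => congrFun (LinearMap.mem_ker.1 hv) i⟩

/-- The linear map `ℝ²ⁿ → E` sending the standard basis to `e₁, …, eₙ, f₁, …, fₙ`. -/
def frameMap {n : ℕ} (e f : Fin n → E) : StdSpace n →L[ℝ] E :=
  ∑ i, ((EuclideanSpace.proj (Sum.inl i) : StdSpace n →L[ℝ] ℝ).smulRight (e i)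
    + (EuclideanSpace.proj (Sum.inr i) : StdSpace n →L[ℝ] ℝ).smulRight (f i))

theorem frameMap_apply {n : ℕ} (e f : Fin n → E) (u : StdSpace n) :
    frameMap e f u = ∑ i, (u (Sum.inl i) • e i + u (Sum.inr i) • f i) := by
  simp [frameMap]

theorem frameMap_form {n : ℕ} {B : E →L[ℝ] E →L[ℝ] ℝ} (halt : ∀ a, B a a = 0) {e f : Fin n → E}
    (hee : ∀ i j, B (e i) (e j) = 0) (hff : ∀ i j, B (f i) (f j) = 0)
    (hef : ∀ i j, B (e i) (f j) = if i = j then 1 else 0) (u v : StdSpace n) :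
    B (frameMap e f u) (frameMap e f v) = stdForm n u v := by
  have hfe : ∀ i j, B (f i) (e j) = if j = i then -1 else 0 := fun i j => by
    rw [antisymm_of_alternating halt, hef]; split_ifs <;> simp
  rw [frameMap_apply, frameMap_apply, stdForm]
  simp only [map_sum, _root_.sum_apply, map_add, map_smul, _root_.add_apply, _root_.smul_apply,
    hee, hff, hef, hfe, smul_eq_mul, mul_zero, zero_add, add_zero, Finset.sum_const_zero, mul_ite, mul_one, mul_neg,
    Finset.sum_add_distrib, Finset.sum_ite_eq, Finset.sum_ite_eq', Finset.mem_univ, if_true]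
  rw [← Finset.sum_add_distrib]
  exact Finset.sum_congr rfl fun i _ => by ring

/-- Nondegeneracy of the standard form makes `L` injective, and the dimensions agree. -/
theorem exists_equiv_of_form {n : ℕ} (hE : Module.finrank ℝ E = 2 * n) {B : E →L[ℝ] E →L[ℝ] ℝ}
    (L : StdSpace n →L[ℝ] E) (hL : ∀ u v, B (L u) (L v) = stdForm n u v) :
    ∃ L' : StdSpace n ≃L[ℝ] E, (L' : StdSpace n →L[ℝ] E) = L := by
  have hinj : Function.Injective (L : StdSpace n →ₗ[ℝ] E) := by
    rw [← LinearMap.ker_eq_bot, LinearMap.ker_eq_bot']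
    intro v hv
    refine stdForm_nondegenerate n v fun w => ?_
    have hv : L v = 0 := hv
    rw [← hL, hv]; simp
  refine ⟨(LinearEquiv.ofInjectiveOfFinrankEq _ hinj ?_).toContinuousLinearEquiv, by ext; rfl⟩
  rw [hE, finrank_euclideanSpace, Fintype.card_sum, Fintype.card_fin]; ring

/-- Symplectic Gram–Schmidt. While `k < n`, the `2k` linear conditions of orthogonality to the pairs
found so far have a common nonzero solution `v`; nondegeneracy supplies a partner of `v`. -/
theorem exists_symplectic_basis {n : ℕ} (hE : Module.finrank ℝ E = 2 * n)
    {B : E →L[ℝ] E →L[ℝ] ℝ} (halt : ∀ a, B a a = 0) (hnd : ∀ v, (∀ w, B v w = 0) → v = 0) :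
    ∃ L : StdSpace n ≃L[ℝ] E, ∀ u v, B (L u) (L v) = stdForm n u v := by
  have anti := antisymm_of_alternating halt
  have main : ∀ k ≤ n, ∃ e f : Fin k → E, (∀ i j, B (e i) (e j) = 0) ∧
      (∀ i j, B (f i) (f j) = 0) ∧ ∀ i j, B (e i) (f j) = if i = j then 1 else 0 := by
    intro k
    induction k with
    | zero => exact fun _ => ⟨Fin.elim0, Fin.elim0, fun i => i.elim0, fun i => i.elim0,
        fun i => i.elim0⟩
    | succ k ih =>
      intro hk
      obtain ⟨e, f, hee, hff, hef⟩ := ih (by omega)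
      obtain ⟨v, hv0, hv⟩ := exists_ne_zero_forall_eq_zero
        (Sum.elim (fun i : Fin k => B (e i)) (fun i : Fin k => B (f i)))
        (by rw [hE, Fintype.card_sum, Fintype.card_fin]; omega)
      have hve : ∀ i, B v (e i) = 0 := fun i => by rw [anti, show B (e i) v = 0 from hv (.inl i)]; simp
      have hvf : ∀ i, B v (f i) = 0 := fun i => by rw [anti, show B (f i) v = 0 from hv (.inr i)]; simp
      obtain ⟨w', hw'⟩ : ∃ w, B v w ≠ 0 := by
        by_contra! h
        exact hv0 (hnd v h)
      let w'' := (B v w')⁻¹ • w'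
      -- The partner is scaled to pair to `1` with `v` and then made orthogonal to the earlier
      -- pairs; since `v` is orthogonal to them, its pairing with `v` is unchanged.
      let w := w'' - ∑ i, (B w'' (f i) • e i - B w'' (e i) • f i)
      have hfe : ∀ i j, B (f i) (e j) = if j = i then -1 else 0 := fun i j => by
        rw [anti, hef]; split_ifs <;> simp
      have hvw : B v w = 1 := by
        simp [w, w'', hve, hvf, hw']
      have hwe : ∀ j, B w (e j) = 0 := fun j => by
        simp only [w, map_sub, map_sum, map_smul, _root_.sub_apply, _root_.sum_apply,
          _root_.smul_apply, hee, hfe, smul_eq_mul, mul_zero, mul_ite, Finset.sum_sub_distrib,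
          Finset.sum_ite_eq, Finset.mem_univ, if_true, Finset.sum_const_zero]
        ring
      have hwf : ∀ j, B w (f j) = 0 := fun j => by
        simp only [w, map_sub, map_sum, map_smul, _root_.sub_apply, _root_.sum_apply,
          _root_.smul_apply, hef, hff, smul_eq_mul, mul_zero, mul_ite, Finset.sum_sub_distrib,
          Finset.sum_ite_eq', Finset.mem_univ, if_true, Finset.sum_const_zero]
        ring
      refine ⟨Fin.cons v e, Fin.cons w f, ?_, ?_, ?_⟩
      · intro i j
        refine Fin.cases ?_ (fun i => ?_) i <;> refine Fin.cases ?_ (fun j => ?_) j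
        · simpa using halt v
        · simpa using hve j
        · simpa [hve i] using anti (e i) v
        · simpa using hee i j
      · intro i j
        refine Fin.cases ?_ (fun i => ?_) i <;> refine Fin.cases ?_ (fun j => ?_) j
        · simpa using halt w
        · simpa using hwf j
        · simpa [hwf i] using anti (f i) w
        · simpa using hff i j
      · intro i j
        refine Fin.cases ?_ (fun i => ?_) i <;> refine Fin.cases ?_ (fun j => ?_) j
        · simpa using hvw
        · simpa [(Fin.succ_ne_zero j).symm] using hvf j
        · simpa [hwe i] using anti (e i) w
        · simpa using hef i j
  obtain ⟨e, f, hee, hff, hef⟩ := main n le_rfl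
  obtain ⟨L, hL⟩ := exists_equiv_of_form hE (frameMap e f) (frameMap_form halt hee hff hef)
  refine ⟨L, fun u v => ?_⟩
  rw [← frameMap_form halt hee hff hef, ← hL]; rfl

/-- Gram–Schmidt for the Hermitian structure: a vector orthogonal under `B` to all `e i` and `J (e
i)` has `J`-image with the same property, so the pairs `(v, J v)`, normalized to length one, form
the basis. -/
theorem exists_unitary_basis {n : ℕ} (hE : Module.finrank ℝ E = 2 * n)
    {B : E →L[ℝ] E →L[ℝ] ℝ} (halt : ∀ a, B a a = 0) {J : E →L[ℝ] E} (hJ : IsCompatible B J) :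
    ∃ L : StdSpace n ≃L[ℝ] E, (∀ u v, B (L u) (L v) = stdForm n u v) ∧
      ∀ v, L (stdJ n v) = J (L v) := by
  have anti := antisymm_of_alternating halt
  have main : ∀ k ≤ n, ∃ e : Fin k → E, (∀ i j, B (e i) (e j) = 0) ∧
      ∀ i j, B (e i) (J (e j)) = if i = j then 1 else 0 := by
    intro k
    induction k with
    | zero => exact fun _ => ⟨Fin.elim0, fun i => i.elim0, fun i => i.elim0⟩
    | succ k ih =>
      intro hk
      obtain ⟨e, hee, hef⟩ := ih (by omega)
      obtain ⟨v, hv0, hv⟩ := exists_ne_zero_forall_eq_zero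
        (Sum.elim (fun i : Fin k => B (e i)) (fun i : Fin k => B (J (e i))))
        (by rw [hE, Fintype.card_sum, Fintype.card_fin]; omega)
      have hev : ∀ i, B (e i) v = 0 := fun i => hv (.inl i)
      have hve : ∀ i, B v (e i) = 0 := fun i => by rw [anti, hev]; simp
      have hvf : ∀ i, B v (J (e i)) = 0 := fun i => by
        rw [anti, show B (J (e i)) v = 0 from hv (.inr i)]; simp
      have hevJ : ∀ i, B (e i) (J v) = 0 := fun i => by
        rw [← hJ.compatible, hJ.sq, map_neg, show B (J (e i)) v = 0 from hv (.inr i), neg_zero]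
      have hpos := hJ.pos v hv0
      let c := (Real.sqrt (B v (J v)))⁻¹
      have hc : c * (c * B v (J v)) = 1 := by
        have h1 := Real.mul_self_sqrt hpos.le
        have h2 : Real.sqrt (B v (J v)) ≠ 0 := (Real.sqrt_pos.2 hpos).ne'
        simp only [c]
        nth_rw 3 [← h1]
        field_simp
      refine ⟨Fin.cons (c • v) e, ?_, ?_⟩
      · intro i j
        refine Fin.cases ?_ (fun i => ?_) i <;> refine Fin.cases ?_ (fun j => ?_) j
        · simpa using halt (c • v)
        · simp [hve j]
        · simp [hev i]
        · simpa using hee i j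
      · intro i j
        refine Fin.cases ?_ (fun i => ?_) i <;> refine Fin.cases ?_ (fun j => ?_) j
        · simpa using hc
        · simp [hvf j, (Fin.succ_ne_zero j).symm]
        · simp [hevJ i]
        · simpa using hef i j
  obtain ⟨e, hee, hef⟩ := main n le_rfl
  have hff : ∀ i j, B (J (e i)) (J (e j)) = 0 := fun i j => by rw [hJ.compatible, hee]
  obtain ⟨L, hL⟩ := exists_equiv_of_form hE (frameMap e fun i => J (e i))
    (frameMap_form halt hee hff hef)
  have hL' : ∀ u, L u = frameMap e (fun i => J (e i)) u := fun u => by rw [← hL]; rfl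
  refine ⟨L, fun u v => ?_, fun v => ?_⟩
  · rw [← frameMap_form halt hee hff hef, ← hL]; rfl
  · rw [hL', hL', frameMap_apply, frameMap_apply, map_sum]
    refine Finset.sum_congr rfl fun i _ => ?_
    simp [stdJ, hJ.sq, add_comm]

end SymplecticLinearAlgebra

/-! ### The Cayley path between compatible complex structures -/

section Interpolation

variable {E : Type*} [NormedAddCommGroup E] [NormedSpace ℝ E]

/-- The conjugating map of the Cayley path between two compatible complex structures. -/
def cayleyMap (t : ℝ) (J₀ J₁ : E →L[ℝ] E) : E →L[ℝ] E :=
  (1 + t) • .id ℝ E - (1 - t) • J₀.comp J₁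

/-- The Cayley path from `J₀` to `J₁` in the space of compatible complex structures. -/
def cayleyPath (t : ℝ) (J₀ J₁ : E →L[ℝ] E) : E →L[ℝ] E :=
  (cayleyMap t J₀ J₁).comp (J₁.comp (cayleyMap t J₀ J₁).inverse)

variable {B : E →L[ℝ] E →L[ℝ] ℝ} {J₀ J₁ : E →L[ℝ] E} {t : ℝ}

theorem cayleyMap_apply (v : E) :
    cayleyMap t J₀ J₁ v = (1 + t) • v - (1 - t) • J₀ (J₁ v) := rfl

/-- Pairing the image of `v` with `J₁ v` gives `(1 + t) B (v, J₁ v) + (1 - t) B (J₁ v, J₀ (J₁ v))`,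
which is positive for `v ≠ 0`. So the kernel is trivial. -/
theorem cayleyMap_isInvertible [FiniteDimensional ℝ E] (halt : ∀ a, B a a = 0)
    (h₀ : IsCompatible B J₀) (h₁ : IsCompatible B J₁) (ht : t ∈ Set.Icc (0 : ℝ) 1) :
    (cayleyMap t J₀ J₁).IsInvertible := by
  have hinj : Function.Injective (cayleyMap t J₀ J₁ : E →ₗ[ℝ] E) := by
    rw [← LinearMap.ker_eq_bot, LinearMap.ker_eq_bot']
    intro v hv
    by_contra hv0
    have hv : cayleyMap t J₀ J₁ v = 0 := hv
    have hJv : J₁ v ≠ 0 := fun h => hv0 (by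
      have := h₁.sq v
      rw [h, map_zero] at this
      exact neg_eq_zero.1 this.symm)
    have e1 : B (cayleyMap t J₀ J₁ v) (J₁ v) = 0 := by rw [hv]; simp
    rw [cayleyMap_apply, map_sub, map_smul, map_smul, _root_.sub_apply, _root_.smul_apply,
      _root_.smul_apply, antisymm_of_alternating halt (J₀ (J₁ v)), smul_eq_mul, smul_eq_mul] at e1
    have p1 := h₁.pos v hv0
    have p2 := h₀.pos _ hJv
    have := mul_nonneg (sub_nonneg.2 ht.2) p2.le
    have := mul_nonneg ht.1 p1.le
    nlinarith
  exact ⟨(LinearEquiv.ofInjectiveEndo _ hinj).toContinuousLinearEquiv, by ext; rfl⟩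

theorem cayleyPath_apply_cayleyMap (h : (cayleyMap t J₀ J₁).IsInvertible) (v : E) :
    cayleyPath t J₀ J₁ (cayleyMap t J₀ J₁ v) = cayleyMap t J₀ J₁ (J₁ v) := by
  change cayleyMap t J₀ J₁ (J₁ ((cayleyMap t J₀ J₁).inverse (cayleyMap t J₀ J₁ v))) = _
  rw [h.inverse_apply_self]

/-- Every vector is of the form `D w` with `D` the conjugating map, and the path sends `D w` to `D
(J₁ w)`. The formula `hB` for the form on such vectors is invariant under `J₁`, and on the pair `(D
w, D (J₁ w))` it is a combination of three positive terms with nonnegative coefficients, the one of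
`B (w, J₁ w)` being positive. -/
theorem IsCompatible.cayleyPath [FiniteDimensional ℝ E] (halt : ∀ a, B a a = 0)
    (h₀ : IsCompatible B J₀) (h₁ : IsCompatible B J₁) (ht : t ∈ Set.Icc (0 : ℝ) 1) :
    IsCompatible B (cayleyPath t J₀ J₁) := by
  have hD := cayleyMap_isInvertible halt h₀ h₁ ht
  have anti := antisymm_of_alternating halt
  have key := cayleyPath_apply_cayleyMap hD
  have n0 : ∀ u v, B (J₀ u) v = -B u (J₀ v) := fun u v => by
    rw [← h₀.compatible, h₀.sq, map_neg, _root_.neg_apply]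
  have n1 : ∀ u v, B (J₁ u) v = -B u (J₁ v) := fun u v => by
    rw [← h₁.compatible, h₁.sq, map_neg, _root_.neg_apply]
  have hB : ∀ u v, B (cayleyMap t J₀ J₁ u) (cayleyMap t J₀ J₁ v) =
      ((1 + t) ^ 2 + (1 - t) ^ 2) * B u v
        - (1 + t) * (1 - t) * (B (J₀ (J₁ u)) v + B u (J₀ (J₁ v))) := by
    intro u v
    simp only [cayleyMap_apply, map_sub, map_smul, _root_.sub_apply, _root_.smul_apply,
      smul_eq_mul, h₀.compatible, h₁.compatible]
    ring
  refine ⟨fun v => ?_, fun u v => ?_, fun v hv => ?_⟩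
  · obtain ⟨w, rfl⟩ := hD.surjective v
    rw [key, key, h₁.sq, map_neg]
  · obtain ⟨u, rfl⟩ := hD.surjective u
    obtain ⟨v, rfl⟩ := hD.surjective v
    rw [key, key, hB, hB, h₁.compatible, h₁.sq, h₁.sq]
    have e1 : B (J₀ (-u)) (J₁ v) = B (J₀ (J₁ u)) v * 0 + B u (J₀ (J₁ v)) := by
      rw [map_neg, map_neg, _root_.neg_apply, n0]; ring
    have e2 : B (J₁ u) (J₀ (-v)) = B (J₀ (J₁ u)) v := by
      rw [map_neg, map_neg, n0]
    rw [e1, e2]; ring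
  · obtain ⟨w, rfl⟩ := hD.surjective v
    have hw : w ≠ 0 := fun h => hv (by rw [h, map_zero])
    rw [key, hB, h₁.sq]
    have hJw : J₁ w ≠ 0 := fun h => hw (by
      have := h₁.sq w
      rw [h, map_zero] at this
      exact neg_eq_zero.1 this.symm)
    have p1 := h₁.pos w hw
    have p2 := h₀.pos _ hJw
    have p3 := h₀.pos _ hw
    have e1 : B (J₀ (J₁ w)) (J₁ w) = -B (J₁ w) (J₀ (J₁ w)) := n0 _ _
    have e2 : B w (J₀ (-w)) = -B w (J₀ w) := by rw [map_neg, map_neg]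
    rw [e1, e2]
    have q1 : 0 ≤ (1 + t) * (1 - t) * (B (J₁ w) (J₀ (J₁ w)) + B w (J₀ w)) :=
      mul_nonneg (mul_nonneg (by linarith [ht.1]) (by linarith [ht.2])) (by linarith)
    have q2 : 0 < ((1 + t) ^ 2 + (1 - t) ^ 2) * B w (J₁ w) :=
      mul_pos (by nlinarith [ht.1, sq_nonneg (1 - t)]) p1
    linarith

/-- With `D = 1 - J₀ J₁`, both `D J₁` and `J₀ D` are equal to `J₀ + J₁`. -/
theorem cayleyPath_zero [FiniteDimensional ℝ E] (halt : ∀ a, B a a = 0)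
    (h₀ : IsCompatible B J₀) (h₁ : IsCompatible B J₁) : cayleyPath 0 J₀ J₁ = J₀ := by
  have hD := cayleyMap_isInvertible (t := 0) halt h₀ h₁ ⟨le_rfl, zero_le_one⟩
  ext v
  obtain ⟨w, rfl⟩ := hD.surjective v
  rw [cayleyPath_apply_cayleyMap hD, cayleyMap_apply, cayleyMap_apply, h₁.sq]
  simp [h₀.sq, add_comm]

/-- Here the conjugating map is multiplication by `2`, whatever `J₀` and `J₁` are. No compatibility
is required, so the gluing tolerates a meaningless `J₀` where the bump function is `1`. -/
theorem cayleyPath_one (J₀ J₁ : E →L[ℝ] E) : cayleyPath 1 J₀ J₁ = J₁ := by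
  have h : cayleyMap 1 J₀ J₁ = ((ContinuousLinearEquiv.smulLeft
      (Units.mk0 (2 : ℝ) two_ne_zero) : E ≃L[ℝ] E) : E →L[ℝ] E) := by
    ext v
    rw [cayleyMap_apply]
    norm_num
  have hD : (cayleyMap 1 J₀ J₁).IsInvertible := ⟨_, h.symm⟩
  ext v
  obtain ⟨w, rfl⟩ := hD.surjective v
  rw [cayleyPath_apply_cayleyMap hD, cayleyMap_apply, cayleyMap_apply]
  simp

theorem SmoothNear.cayleyPath {V : Type*} [NormedAddCommGroup V] [NormedSpace ℝ V]
    [CompleteSpace E] {χ : V → ℝ} {J₀ J₁ : V → E →L[ℝ] E} {z : V} (hχ : SmoothNear χ z)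
    (h₀ : SmoothNear J₀ z) (h₁ : SmoothNear J₁ z)
    (hD : (cayleyMap (χ z) (J₀ z) (J₁ z)).IsInvertible) :
    SmoothNear (fun w => _root_.cayleyPath (χ w) (J₀ w) (J₁ w)) z := by
  have h1 : SmoothNear (fun w => 1 + χ w) z := (SmoothNear.const (1 : ℝ) z).add hχ
  have h2 : SmoothNear (fun w => 1 - χ w) z := (SmoothNear.const (1 : ℝ) z).sub hχ
  have h3 : SmoothNear (fun w => (J₀ w).comp (J₁ w)) z := h₀.clm_comp h₁
  have hm : SmoothNear (fun w => cayleyMap (χ w) (J₀ w) (J₁ w)) z :=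
    (h1.smul (SmoothNear.const (ContinuousLinearMap.id ℝ E) z)).sub (h2.smul h3)
  have h4 := hm.inverse hD
  have h5 := h₁.clm_comp h4
  exact hm.clm_comp h5

end Interpolation

/-! ### Local existence of compatible structures and unitary frames -/

section LocalStructures

variable {Y E : Type*} [NormedAddCommGroup Y] [NormedSpace ℝ Y]
  [NormedAddCommGroup E] [NormedSpace ℝ E] [FiniteDimensional ℝ E]

theorem isInvertible_of_form {n : ℕ} (hE : Module.finrank ℝ E = 2 * n)
    {B : E →L[ℝ] E →L[ℝ] ℝ} {L : StdSpace n →L[ℝ] E}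
    (hL : ∀ u v, B (L u) (L v) = stdForm n u v) : L.IsInvertible :=
  exists_equiv_of_form hE L hL

/-- Compatible complex structures exist locally and smoothly. -/
theorem exists_local_compatible {n : ℕ} (hE : Module.finrank ℝ E = 2 * n)
    {Ω : Y → E →L[ℝ] E →L[ℝ] ℝ} {y₀ : Y} (hΩ : SmoothNear Ω y₀)
    (halt : ∀ᶠ y in 𝓝 y₀, ∀ a, Ω y a a = 0) (hnd : ∀ v, (∀ w, Ω y₀ v w = 0) → v = 0) :
    ∃ J : Y → E →L[ℝ] E, SmoothNear J y₀ ∧ ∀ᶠ y in 𝓝 y₀, IsCompatible (Ω y) (J y) := by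
  have : CompleteSpace E := FiniteDimensional.complete ℝ E
  obtain ⟨L₀, hL₀⟩ := exists_symplectic_basis hE halt.self_of_nhds hnd
  obtain ⟨R, hR, hR0, hRf, -⟩ := exists_symplectic_correction hΩ
    (halt.mono fun y hy => antisymm_of_alternating hy)
    (SmoothNear.const (L₀ : StdSpace n →L[ℝ] E) y₀) hL₀
  -- A constant frame that is symplectic at `y₀`, corrected nearby; the complex structure is the
  -- standard one transported by it.
  let L : Y → StdSpace n →L[ℝ] E := fun y => (L₀ : StdSpace n →L[ℝ] E).comp (R y)
  have hL : SmoothNear L y₀ := (SmoothNear.const _ _).clm_comp hR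
  refine ⟨fun y => (L y).comp ((stdJL n).comp (L y).inverse), ?_, ?_⟩
  · exact hL.clm_comp ((SmoothNear.const _ _).clm_comp
      (hL.inverse (isInvertible_of_form hE hRf.self_of_nhds)))
  · filter_upwards [hRf] with y hy
    have hi : (L y).IsInvertible := isInvertible_of_form hE hy
    have key : ∀ v, ((L y).comp ((stdJL n).comp (L y).inverse)) (L y v) = L y (stdJ n v) :=
      fun v => by
        change L y (stdJ n ((L y).inverse (L y v))) = _
        rw [hi.inverse_apply_self]
    refine ⟨fun v => ?_, fun u v => ?_, fun v hv => ?_⟩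
    · obtain ⟨w, rfl⟩ := hi.surjective v
      rw [key, key, stdJ_stdJ, map_neg]
    · obtain ⟨u, rfl⟩ := hi.surjective u
      obtain ⟨v, rfl⟩ := hi.surjective v
      rw [key, key]
      exact (hy _ _).trans ((stdForm_stdJ_stdJ n u v).trans (hy _ _).symm)
    · obtain ⟨w, rfl⟩ := hi.surjective v
      rw [key]
      refine lt_of_lt_of_eq ?_ (hy _ _).symm
      have hw : w ≠ 0 := fun h => hv (by rw [h, map_zero])
      rw [stdForm_stdJ]
      exact pow_pos (norm_pos_iff.2 hw) 2

/-- Unitary frames exist locally and smoothly. -/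
theorem exists_local_unitary {n : ℕ} (hE : Module.finrank ℝ E = 2 * n)
    {Ω : Y → E →L[ℝ] E →L[ℝ] ℝ} {J : Y → E →L[ℝ] E} {y₀ : Y} (hΩ : SmoothNear Ω y₀)
    (hJ : SmoothNear J y₀) (halt : ∀ᶠ y in 𝓝 y₀, ∀ a, Ω y a a = 0)
    (hc : ∀ᶠ y in 𝓝 y₀, IsCompatible (Ω y) (J y)) :
    ∃ L : Y → StdSpace n →L[ℝ] E, SmoothNear L y₀ ∧ ∀ᶠ y in 𝓝 y₀, (L y).IsInvertible ∧
      (∀ u v, Ω y (L y u) (L y v) = stdForm n u v) ∧ ∀ v, L y (stdJ n v) = J y (L y v) := by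
  obtain ⟨L₀, hL₀, hL₀J⟩ := exists_unitary_basis hE halt.self_of_nhds hc.self_of_nhds
  -- The complex linear part of `L₀` with respect to `J y`. It is `L₀` at `y₀`, and the symplectic
  -- correction keeps it complex linear because `J y` preserves `Ω y`.
  let L₁ : Y → StdSpace n →L[ℝ] E := fun y => (1 / 2 : ℝ) •
    ((L₀ : StdSpace n →L[ℝ] E) - (J y).comp ((L₀ : StdSpace n →L[ℝ] E).comp (stdJL n)))
  have hL₁a : ∀ y v, L₁ y v = (1 / 2 : ℝ) • (L₀ v - J y (L₀ (stdJ n v))) := fun y v => rfl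
  have hL₁ : SmoothNear L₁ y₀ := (SmoothNear.const _ _).smul
    ((SmoothNear.const _ _).sub (hJ.clm_comp (.const _ _)))
  have hJJ : ∀ y, IsCompatible (Ω y) (J y) → ∀ v, L₁ y (stdJ n v) = J y (L₁ y v) := by
    intro y hy v
    have : L₀ (-v) = -L₀ v := map_neg L₀ v
    rw [hL₁a, hL₁a, stdJ_stdJ, this, map_neg, map_smul, map_sub, hy.sq]
    congr 1; abel
  have h0 : ∀ v, L₁ y₀ v = L₀ v := fun v => by
    rw [hL₁a, hL₀J, hc.self_of_nhds.sq, sub_neg_eq_add, ← two_smul ℝ, smul_smul]; norm_num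
  obtain ⟨R, hR, -, hRf, hRJ⟩ := exists_symplectic_correction hΩ
    (halt.mono fun y hy => antisymm_of_alternating hy) hL₁
    (fun u v => by rw [h0, h0]; exact hL₀ u v)
  refine ⟨fun y => (L₁ y).comp (R y), hL₁.clm_comp hR, ?_⟩
  filter_upwards [hRf, hRJ, hc] with y h1 h2 h3
  refine ⟨isInvertible_of_form hE h1, h1, fun v => ?_⟩
  change L₁ y (R y (stdJ n v)) = J y (L₁ y (R y v))
  rw [h2 (fun u v => by rw [hJJ y h3, hJJ y h3, h3.compatible]), hJJ y h3]

end LocalStructures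

/-- The model space of a `d`-dimensional manifold. -/
abbrev Coord (d : ℕ) : Type := EuclideanSpace ℝ (Fin d)

/-! ### Charts of the tangent bundle -/

section TangentCharts

variable {d : ℕ} {M : Type*} [TopologicalSpace M] [ChartedSpace (Coord d) M]
  [IsManifold (𝓡 d) ∞ M]

/-- The preferred chart at `x`. -/
abbrev baseChart (x : M) : PartialEquiv M (Coord d) := extChartAt (𝓡 d) x

/-- The chart of the tangent bundle induced by the preferred chart at `x`. -/
def tangentChart (x : M) : PartialEquiv (TangentBundle (𝓡 d) M) (Coord d × Coord d) :=
  extChartAt (𝓡 d).tangent (⟨x, 0⟩ : TangentBundle (𝓡 d) M)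

/-- The derivative of the preferred chart at `x`. -/
def chartDeriv (x m : M) : Coord d →L[ℝ] Coord d :=
  mfderiv (𝓡 d) 𝓘(ℝ, Coord d) (baseChart (d := d) x) m

/-- The derivative of the inverse of the preferred chart at `x`. -/
def chartSymmDeriv (x : M) (y : Coord d) : Coord d →L[ℝ] Coord d :=
  mfderiv 𝓘(ℝ, Coord d) (𝓡 d) (baseChart (d := d) x).symm y

theorem baseChart_source_mem {x m : M} (hm : m ∈ (baseChart (d := d) x).source) :
    (baseChart (d := d) x).source ∈ 𝓝 m := (isOpen_extChartAt_source (I := 𝓡 d) x).mem_nhds hm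

theorem baseChart_target_mem {x : M} {y : Coord d} (hy : y ∈ (baseChart x).target) :
    (baseChart x).target ∈ 𝓝 y := (isOpen_extChartAt_target x).mem_nhds hy

theorem baseChart_contMDiffAt {x m : M} (hm : m ∈ (baseChart (d := d) x).source) :
    ContMDiffAt (𝓡 d) 𝓘(ℝ, Coord d) ∞ (baseChart (d := d) x) m :=
  (contMDiffOn_extChartAt.contMDiffAt (by
    rw [← extChartAt_source (I := 𝓡 d)]; exact baseChart_source_mem hm))

theorem baseChart_symm_contMDiffAt {x : M} {y : Coord d} (hy : y ∈ (baseChart x).target) :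
    ContMDiffAt 𝓘(ℝ, Coord d) (𝓡 d) ∞ (baseChart x).symm y :=
  (contMDiffOn_extChartAt_symm x).contMDiffAt (baseChart_target_mem hy)

theorem chartSymmDeriv_chartDeriv {x m : M} (hm : m ∈ (baseChart (d := d) x).source)
    (v : Coord d) : chartSymmDeriv x (baseChart x m) (chartDeriv x m v) = v := by
  have h := mfderivWithin_extChartAt_symm_comp_mfderiv_extChartAt' (I := 𝓡 d) hm
  simp only [modelWithCornersSelf_coe, Set.range_id, mfderivWithin_univ] at h
  have h' : ((chartSymmDeriv x (baseChart x m)).comp (chartDeriv x m) : Coord d →L[ℝ] Coord d) = .id ℝ _ := h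
  exact DFunLike.congr_fun h' v

theorem chartDeriv_chartSymmDeriv {x : M} {y : Coord d} (hy : y ∈ (baseChart x).target)
    (v : Coord d) : chartDeriv x ((baseChart x).symm y) (chartSymmDeriv x y v) = v := by
  have h := mfderiv_extChartAt_comp_mfderivWithin_extChartAt_symm (I := 𝓡 d) hy
  simp only [modelWithCornersSelf_coe, Set.range_id, mfderivWithin_univ] at h
  have h' : ((chartDeriv x ((baseChart x).symm y)).comp (chartSymmDeriv x y) : Coord d →L[ℝ] Coord d) = .id ℝ _ := h
  exact DFunLike.congr_fun h' v

theorem chartDeriv_chartSymmDeriv' {x m : M} (hm : m ∈ (baseChart (d := d) x).source)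
    (v : Coord d) : chartDeriv x m (chartSymmDeriv x (baseChart x m) v) = v := by
  have h := chartDeriv_chartSymmDeriv ((baseChart x).map_source hm) v
  rwa [(baseChart x).left_inv hm] at h

theorem tangentChart_mem_source {x : M} {p : TangentBundle (𝓡 d) M} :
    p ∈ (tangentChart x).source ↔ p.proj ∈ (baseChart (d := d) x).source := by
  rw [tangentChart, extChartAt_source, extChartAt_source, TangentBundle.mem_chart_source_iff]

theorem tangentChart_mem_target {x : M} {z : Coord d × Coord d} :
    z ∈ (tangentChart x).target ↔ z.1 ∈ (baseChart x).target := by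
  rw [tangentChart, FiberBundle.extChartAt_target]
  simp only [TangentBundle.trivializationAt_baseSet, Set.mem_prod, Set.mem_univ, and_true,
    Set.mem_inter_iff, and_iff_left_iff_imp]
  intro h
  rw [← extChartAt_source (𝓡 d)]
  exact (extChartAt (𝓡 d) x).map_target h

theorem tangentChart_apply {x m : M} (hm : m ∈ (baseChart (d := d) x).source) (v : Coord d) :
    tangentChart x (⟨m, v⟩ : TangentBundle (𝓡 d) M) = (baseChart x m, chartDeriv x m v) := by
  have hm' : m ∈ (chartAt (Coord d) x).source := by rwa [← extChartAt_source (𝓡 d)]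
  have h := TangentBundle.continuousLinearMapAt_trivializationAt (I := 𝓡 d) hm'
  rw [tangentChart, FiberBundle.extChartAt]
  simp only [PartialEquiv.coe_trans, Function.comp_apply, PartialEquiv.prod_coe,
    PartialEquiv.refl_coe, id_eq]
  refine Prod.ext rfl ?_
  have h2 := DFunLike.congr_fun h (v : TangentSpace (𝓡 d) m)
  exact (Trivialization.continuousLinearMapAt_apply_of_mem (R := ℝ) (e := trivializationAt (Coord d)
    (TangentSpace (𝓡 d)) x) (b := m) hm' v).symm.trans h2

theorem tangentChart_symm_apply {x : M} {y : Coord d} (hy : y ∈ (baseChart x).target)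
    (v : Coord d) :
    (tangentChart x).symm (y, v) = (⟨(baseChart x).symm y, chartSymmDeriv x y v⟩ :
      TangentBundle (𝓡 d) M) := by
  apply (tangentChart x).injOn
  · exact (tangentChart x).map_target (tangentChart_mem_target.2 hy)
  · exact tangentChart_mem_source.2 ((baseChart x).map_target hy)
  · rw [(tangentChart x).right_inv (tangentChart_mem_target.2 hy),
      tangentChart_apply ((baseChart x).map_target hy), (baseChart x).right_inv hy,
      chartDeriv_chartSymmDeriv hy]

theorem tangentChart_contMDiffAt {x : M} {p : TangentBundle (𝓡 d) M}
    (hp : p.proj ∈ (baseChart (d := d) x).source) :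
    ContMDiffAt (𝓡 d).tangent 𝓘(ℝ, Coord d × Coord d) ∞ (tangentChart x) p := by
  have := contMDiffAt_extChartAt' (I := (𝓡 d).tangent) (n := ∞)
    (x := (⟨x, 0⟩ : TangentBundle (𝓡 d) M)) (x' := p) (by
      rw [TangentBundle.mem_chart_source_iff, ← extChartAt_source (𝓡 d)]; exact hp)
  exact this

theorem tangentChart_symm_contMDiffAt {x : M} {z : Coord d × Coord d}
    (hz : z.1 ∈ (baseChart x).target) :
    ContMDiffAt 𝓘(ℝ, Coord d × Coord d) (𝓡 d).tangent ∞ (tangentChart x).symm z :=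
  (contMDiffOn_extChartAt_symm _).contMDiffAt
    ((isOpen_extChartAt_target _).mem_nhds (tangentChart_mem_target.2 hz))

end TangentCharts

/-! ### The symplectic form in charts -/

section FormInChart

variable {n : ℕ} {M : Type*} [TopologicalSpace M] [ChartedSpace (Coord (2 * n)) M]
  [IsManifold (𝓡 (2 * n)) ∞ M] (σ : SymplecticForm n M)

/-- The coordinate vector field with constant coefficient `a` is the inverse tangent chart
restricted to the slice `(y, a)`. -/
theorem chartSymmDeriv_contMDiffAt {d : ℕ} {M : Type*} [TopologicalSpace M]
    [ChartedSpace (Coord d) M] [IsManifold (𝓡 d) ∞ M] {x : M} {y : Coord d}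
    (hy : y ∈ (baseChart x).target) (a : Coord d) :
    ContMDiffAt 𝓘(ℝ, Coord d) (𝓡 d).tangent ∞ (fun y => TotalSpace.mk' (Coord d)
      (E := fun m : M => TangentSpace (𝓡 d) m) ((baseChart x).symm y)
      (chartSymmDeriv x y a)) y := by
  have h1 : ContMDiffAt 𝓘(ℝ, Coord d) 𝓘(ℝ, Coord d × Coord d) ∞ (fun y => (y, a)) y :=
    (contDiff_id.prodMk contDiff_const).contMDiff.contMDiffAt
  have h2 := (tangentChart_symm_contMDiffAt (M := M) (z := (y, a)) hy).comp y h1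
  refine h2.congr_of_eventuallyEq ?_
  filter_upwards [baseChart_target_mem hy] with w hw
  exact (tangentChart_symm_apply hw a).symm

theorem formInChart_apply (x : M) (y u v : Coord (2 * n)) :
    formInChart σ.form x y u v =
      σ.form ((baseChart x).symm y) (chartSymmDeriv x y u) (chartSymmDeriv x y v) := rfl

theorem contDiffOn_formInChart (x : M) :
    ContDiffOn ℝ ∞ (formInChart σ.form x) (baseChart x).target := by
  rw [contDiffOn_clm_apply]
  intro a
  rw [contDiffOn_clm_apply]
  intro b y hy
  have hv := chartSymmDeriv_contMDiffAt hy a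
  have hw := chartSymmDeriv_contMDiffAt hy b
  have h := (σ.smooth.contMDiffAt.comp y (baseChart_symm_contMDiffAt hy)).clm_bundle_apply₂
    (F₃ := ℝ) (E₃ := Bundle.Trivial M ℝ) hv hw
  exact ((Bundle.contMDiffAt_totalSpace.1 h).2).contDiffAt.contDiffWithinAt

theorem isSymplecticNear_formInChart (x : M) {y : Coord (2 * n)} (hy : y ∈ (baseChart x).target) :
    IsSymplecticNear (formInChart σ.form x) y where
  smooth := by
    filter_upwards [baseChart_target_mem hy] with w hw
    exact (contDiffOn_formInChart σ x).contDiffAt (baseChart_target_mem hw)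
  alternating := Filter.Eventually.of_forall fun w a => σ.alternating _ _
  closed := by
    filter_upwards [baseChart_target_mem hy] with w hw
    exact σ.closed x w hw
  invertible := by
    refine ContinuousLinearMap.isInvertible_of_nondegenerate _ fun v hv => ?_
    have h : chartSymmDeriv x y v = 0 := σ.nondegenerate ((baseChart x).symm y) _ fun w => by
      rw [← chartSymmDeriv_chartDeriv ((baseChart x).map_target hy) w, (baseChart x).right_inv hy]
      exact hv _
    rw [← chartDeriv_chartSymmDeriv hy v, h, map_zero]

end FormInChart

/-! ### Maps from the tangent bundle in local coordinates -/

section Fibres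

variable {d : ℕ} {M : Type*} [TopologicalSpace M] [ChartedSpace (Coord d) M]
  [IsManifold (𝓡 d) ∞ M]

/-- The derivative of `φ` at `p` in the direction of the fibre of the tangent bundle. -/
def fibreDeriv (φ : TangentBundle (𝓡 d) M → M) (p : TangentBundle (𝓡 d) M) :
    Coord d →L[ℝ] Coord d :=
  mfderiv 𝓘(ℝ, Coord d) (𝓡 d) (fun w : Coord d => φ ⟨p.proj, w⟩) p.2

/-- `F` is the expression of `φ` in the preferred chart at `x`, near `p`. -/
def IsLocalExpr (x : M) (φ : TangentBundle (𝓡 d) M → M) (F : Coord d × Coord d → Coord d)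
    (p : TangentBundle (𝓡 d) M) : Prop :=
  ∀ᶠ q in 𝓝 p, φ q = (baseChart x).symm (F (tangentChart x q)) ∧
    F (tangentChart x q) ∈ (baseChart x).target

theorem tangentChart_symm_tangentChart {x : M} {p : TangentBundle (𝓡 d) M}
    (hp : p.proj ∈ (baseChart (d := d) x).source) :
    (tangentChart x).symm (tangentChart x p) = p :=
  (tangentChart x).left_inv (tangentChart_mem_source.2 hp)

theorem tangentChart_tangentChart_symm {x : M} {z : Coord d × Coord d}
    (hz : z.1 ∈ (baseChart x).target) : tangentChart x ((tangentChart x).symm z) = z :=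
  (tangentChart x).right_inv (tangentChart_mem_target.2 hz)

theorem tangentChart_fst_mem {x : M} {p : TangentBundle (𝓡 d) M}
    (hp : p.proj ∈ (baseChart (d := d) x).source) :
    (tangentChart x p).1 ∈ (baseChart x).target :=
  tangentChart_mem_target.1 ((tangentChart x).map_source (tangentChart_mem_source.2 hp))

theorem tangentChart_symm_tendsto {x : M} {p : TangentBundle (𝓡 d) M}
    (hp : p.proj ∈ (baseChart (d := d) x).source) :
    Filter.Tendsto (tangentChart x).symm (𝓝 (tangentChart x p)) (𝓝 p) := by
  have := (tangentChart_symm_contMDiffAt (tangentChart_fst_mem hp)).continuousAt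
  rwa [ContinuousAt, tangentChart_symm_tangentChart hp] at this

theorem tangentChart_tendsto {x : M} {p : TangentBundle (𝓡 d) M}
    (hp : p.proj ∈ (baseChart (d := d) x).source) :
    Filter.Tendsto (tangentChart x) (𝓝 p) (𝓝 (tangentChart x p)) :=
  (tangentChart_contMDiffAt hp).continuousAt

theorem eventually_nhds_iff_tangentChart {x : M} {p : TangentBundle (𝓡 d) M}
    (hp : p.proj ∈ (baseChart (d := d) x).source) {P : Coord d × Coord d → Prop} :
    (∀ᶠ q in 𝓝 p, P (tangentChart x q)) ↔ ∀ᶠ z in 𝓝 (tangentChart x p), P z := by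
  refine ⟨fun h => ?_, fun h => (tangentChart_tendsto hp).eventually h⟩
  filter_upwards [(tangentChart_symm_tendsto hp).eventually h,
    continuous_fst.continuousAt.eventually (baseChart_target_mem (tangentChart_fst_mem hp))]
    with z hz hz1
  rwa [tangentChart_tangentChart_symm hz1] at hz

theorem eventually_proj_mem_source {x : M} {p : TangentBundle (𝓡 d) M}
    (hp : p.proj ∈ (baseChart (d := d) x).source) :
    ∀ᶠ q in 𝓝 p, q.proj ∈ (baseChart (d := d) x).source :=
  (FiberBundle.continuous_proj (Coord d) (TangentSpace (𝓡 d))).continuousAt.eventually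
    (baseChart_source_mem hp)

theorem continuous_fibre (m : M) :
    Continuous (fun w : Coord d => (⟨m, w⟩ : TangentBundle (𝓡 d) M)) :=
  FiberBundle.continuous_totalSpaceMk (Coord d) (TangentSpace (𝓡 d)) m

namespace IsLocalExpr

variable {x : M} {φ : TangentBundle (𝓡 d) M → M} {F : Coord d × Coord d → Coord d}
  {p : TangentBundle (𝓡 d) M}

theorem eventually (h : IsLocalExpr x φ F p) : ∀ᶠ q in 𝓝 p, IsLocalExpr x φ F q :=
  eventually_eventually_nhds.2 h

theorem eventuallyEq_chart (hp : p.proj ∈ (baseChart (d := d) x).source)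
    (h : IsLocalExpr x φ F p) :
    F =ᶠ[𝓝 (tangentChart x p)] baseChart x ∘ φ ∘ (tangentChart x).symm := by
  rw [Filter.EventuallyEq, ← eventually_nhds_iff_tangentChart hp]
  filter_upwards [h, eventually_proj_mem_source hp] with q hq hq1
  rw [Function.comp_apply, Function.comp_apply, tangentChart_symm_tangentChart hq1, hq.1,
    (baseChart x).right_inv hq.2]

theorem contMDiffAt_iff (hp : p.proj ∈ (baseChart (d := d) x).source) (h : IsLocalExpr x φ F p) :
    ContMDiffAt (𝓡 d).tangent (𝓡 d) ∞ φ p ↔ ContDiffAt ℝ ∞ F (tangentChart x p) := by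
  have h0 := h.self_of_nhds
  constructor
  · intro hφ
    have hφp : φ p ∈ (baseChart (d := d) x).source := by
      rw [h0.1]; exact (baseChart x).map_target h0.2
    have e : (tangentChart x).symm (tangentChart x p) = p := tangentChart_symm_tangentChart hp
    have h1 : ContMDiffAt 𝓘(ℝ, Coord d × Coord d) (𝓡 d) ∞ (φ ∘ (tangentChart x).symm)
        (tangentChart x p) :=
      ContMDiffAt.comp _ (by rwa [e]) (tangentChart_symm_contMDiffAt (tangentChart_fst_mem hp))
    have h2 : ContMDiffAt 𝓘(ℝ, Coord d × Coord d) 𝓘(ℝ, Coord d) ∞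
        (baseChart x ∘ φ ∘ (tangentChart x).symm) (tangentChart x p) :=
      ContMDiffAt.comp _ (baseChart_contMDiffAt (by rwa [Function.comp_apply, e])) h1
    exact h2.contDiffAt.congr_of_eventuallyEq (h.eventuallyEq_chart hp)
  · intro hF
    have h1 : ContMDiffAt (𝓡 d).tangent 𝓘(ℝ, Coord d) ∞ (F ∘ tangentChart x) p :=
      ContMDiffAt.comp _ hF.contMDiffAt (tangentChart_contMDiffAt hp)
    have h2 : ContMDiffAt (𝓡 d).tangent (𝓡 d) ∞ ((baseChart x).symm ∘ F ∘ tangentChart x) p :=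
      ContMDiffAt.comp _ (baseChart_symm_contMDiffAt h0.2) h1
    exact h2.congr_of_eventuallyEq (h.mono fun q hq => hq.1)

/-- Over a fixed base point the tangent chart is linear in the vector, with linear part
`chartDeriv`, so this is the chain rule. -/
theorem fibreDeriv_apply (hp : p.proj ∈ (baseChart (d := d) x).source) (h : IsLocalExpr x φ F p)
    (hF : DifferentiableAt ℝ F (tangentChart x p)) (a : Coord d) :
    fibreDeriv φ p a = chartSymmDeriv x (F (tangentChart x p))
      (fderiv ℝ F (tangentChart x p) (0, chartDeriv x p.proj a)) := by
  obtain ⟨m, (v : Coord d)⟩ := p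
  have e : ∀ w : Coord d, tangentChart x (⟨m, w⟩ : TangentBundle (𝓡 d) M) =
      (baseChart x m, chartDeriv x m w) := tangentChart_apply hp
  have h1 : HasFDerivAt (fun w : Coord d => (baseChart (d := d) x m, chartDeriv (d := d) x m w))
      ((ContinuousLinearMap.inr ℝ (Coord d) (Coord d)).comp (chartDeriv x m)) v :=
    HasFDerivAt.prodMk (hasFDerivAt_const _ _) (chartDeriv x m).hasFDerivAt
  rw [e v] at hF
  have h2 : HasFDerivAt (fun w : Coord d => F (baseChart (d := d) x m, chartDeriv x m w))
      ((fderiv ℝ F (baseChart x m, chartDeriv x m v)).comp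
        ((ContinuousLinearMap.inr ℝ (Coord d) (Coord d)).comp (chartDeriv x m))) v :=
    HasFDerivAt.comp (g := F) v hF.hasFDerivAt h1
  have h0 := h.self_of_nhds.2
  rw [e v] at h0
  have h3 : HasMFDerivAt 𝓘(ℝ, Coord d) (𝓡 d) (baseChart (d := d) x).symm
      (F (baseChart x m, chartDeriv x m v))
      (chartSymmDeriv x (F (baseChart x m, chartDeriv x m v))) :=
    ((baseChart_symm_contMDiffAt h0).mdifferentiableAt (by simp)).hasMFDerivAt
  have h4 := h3.comp v h2.hasMFDerivAt
  have h5 : (fun w : Coord d => φ ⟨m, w⟩) =ᶠ[𝓝 v] (baseChart (d := d) x).symm ∘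
      fun w : Coord d => F (baseChart (d := d) x m, chartDeriv x m w) := by
    filter_upwards [(continuous_fibre m).continuousAt.eventually h] with w hw
    rw [hw.1, e w]; rfl
  have h6 := (h4.congr_of_eventuallyEq h5).mfderiv
  rw [e v]
  exact DFunLike.congr_fun h6 a

end IsLocalExpr

end Fibres

/-! ### Thickenings near the zero section -/

section ThickeningNear

variable {n : ℕ} {M : Type*} [TopologicalSpace M] [ChartedSpace (Coord (2 * n)) M]
  [IsManifold (𝓡 (2 * n)) ∞ M] (σ : SymplecticForm n M)

/-- Near `0_m`, the map `φ` is smooth, it is tangent to the identity along the zero section, and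
its restrictions to the fibres pull `σ` back to constant forms. -/
structure IsThickeningNear (φ : TangentBundle (𝓡 (2 * n)) M → M) (m : M) : Prop where
  zero : ∀ᶠ m' in 𝓝 m, φ ⟨m', 0⟩ = m'
  smooth : ∀ᶠ p in 𝓝 (⟨m, 0⟩ : TangentBundle (𝓡 (2 * n)) M),
    ContMDiffAt (𝓡 (2 * n)).tangent (𝓡 (2 * n)) ∞ φ p
  deriv : ∀ᶠ m' in 𝓝 m, ∀ a, fibreDeriv φ ⟨m', 0⟩ a = a
  symplectic : ∀ᶠ p in 𝓝 (⟨m, 0⟩ : TangentBundle (𝓡 (2 * n)) M), ∀ a b : Coord (2 * n),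
    σ.form (φ p) (fibreDeriv φ p a) (fibreDeriv φ p b) = σ.form p.proj a b

variable {σ} {φ : TangentBundle (𝓡 (2 * n)) M → M}
  {F : Coord (2 * n) × Coord (2 * n) → Coord (2 * n)} {x m : M}

theorem tangentChart_zero (hm : m ∈ (baseChart (d := 2 * n) x).source) :
    tangentChart x (⟨m, 0⟩ : TangentBundle (𝓡 (2 * n)) M) = (baseChart x m, 0) :=
  (tangentChart_apply hm 0).trans (by rw [map_zero])

theorem continuousAt_zeroSection (m : M) :
    ContinuousAt (fun m => (⟨m, 0⟩ : TangentBundle (𝓡 (2 * n)) M)) m :=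
  (contMDiff_zeroSection (n := ∞) (IB := 𝓡 (2 * n)) ℝ (F := Coord (2 * n))
    (TangentSpace (𝓡 (2 * n)) : M → Type)).continuous.continuousAt

theorem eventually_nhds_iff_baseChart (hm : m ∈ (baseChart (d := 2 * n) x).source)
    {P : Coord (2 * n) → Prop} :
    (∀ᶠ q in 𝓝 m, P (baseChart x q)) ↔ ∀ᶠ z in 𝓝 (baseChart x m), P z := by
  refine ⟨fun h => ?_, fun h => (baseChart_contMDiffAt hm).continuousAt.eventually h⟩
  have ht := (baseChart x).map_source hm
  have hc := (baseChart_symm_contMDiffAt ht).continuousAt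
  rw [ContinuousAt, (baseChart x).left_inv hm] at hc
  filter_upwards [hc.eventually h, baseChart_target_mem ht] with z hz hz1
  rwa [(baseChart x).right_inv hz1] at hz

namespace IsLocalExpr

theorem symplectic_iff {p : TangentBundle (𝓡 (2 * n)) M}
    (hp : p.proj ∈ (baseChart (d := 2 * n) x).source)
    (h : IsLocalExpr x φ F p) (hF : DifferentiableAt ℝ F (tangentChart x p)) :
    (∀ a b : Coord (2 * n),
      σ.form (φ p) (fibreDeriv φ p a) (fibreDeriv φ p b) = σ.form p.proj a b) ↔
    ∀ a b : Coord (2 * n), formInChart σ.form x (F (tangentChart x p))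
      (fderiv ℝ F (tangentChart x p) (0, a)) (fderiv ℝ F (tangentChart x p) (0, b)) =
        formInChart σ.form x (tangentChart x p).1 a b := by
  have e0 : (tangentChart x p).1 = baseChart x p.proj := by
    obtain ⟨m, v⟩ := p
    exact congrArg Prod.fst (tangentChart_apply hp v)
  have e1 : ∀ a b : Coord (2 * n), σ.form (φ p) (fibreDeriv φ p a) (fibreDeriv φ p b) =
      formInChart σ.form x (F (tangentChart x p))
        (fderiv ℝ F (tangentChart x p) (0, chartDeriv x p.proj a))
        (fderiv ℝ F (tangentChart x p) (0, chartDeriv x p.proj b)) := by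
    intro a b
    rw [formInChart_apply, h.fibreDeriv_apply hp hF, h.fibreDeriv_apply hp hF, h.self_of_nhds.1]
  have e2 : ∀ a b : Coord (2 * n), σ.form p.proj a b =
      formInChart σ.form x (tangentChart x p).1 (chartDeriv x p.proj a)
        (chartDeriv x p.proj b) := by
    intro a b
    rw [formInChart_apply, e0, chartSymmDeriv_chartDeriv hp, chartSymmDeriv_chartDeriv hp,
      (baseChart x).left_inv hp]
  constructor
  · intro H a b
    have := H (chartSymmDeriv x (baseChart x p.proj) a) (chartSymmDeriv x (baseChart x p.proj) b)
    rwa [e1, e2, chartDeriv_chartSymmDeriv' hp, chartDeriv_chartSymmDeriv' hp] at this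
  · intro H a b
    rw [e1, e2]
    exact H _ _

/-- This transfers the construction between `M` and a chart. Any chart containing `m` is allowed,
which the gluing needs since it works in the chart at the centre of the bump function. Each
condition translates by conjugating vectors with the chart derivative, an isomorphism. -/
theorem isThickeningNear_iff (hm : m ∈ (baseChart (d := 2 * n) x).source)
    (h : IsLocalExpr x φ F (⟨m, 0⟩ : TangentBundle (𝓡 (2 * n)) M)) :
    IsThickeningNear σ φ m ↔ IsThickeningGerm (formInChart σ.form x) F (baseChart x m) := by
  have hs : (∀ᶠ p in 𝓝 (⟨m, 0⟩ : TangentBundle (𝓡 (2 * n)) M),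
      ContMDiffAt (𝓡 (2 * n)).tangent (𝓡 (2 * n)) ∞ φ p) ↔ SmoothNear F (baseChart x m, 0) := by
    rw [SmoothNear, ← tangentChart_zero hm, ← eventually_nhds_iff_tangentChart hm]
    refine Filter.eventually_congr ?_
    filter_upwards [h.eventually, eventually_proj_mem_source (d := 2 * n) (p := ⟨m, 0⟩) hm]
      with p h1 h2
    exact h1.contMDiffAt_iff h2
  have h0 := (continuousAt_zeroSection m).eventually h.eventually
  have hz : (∀ᶠ m' in 𝓝 m, φ ⟨m', 0⟩ = m') ↔ ∀ᶠ y in 𝓝 (baseChart x m), F (y, 0) = y := by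
    rw [← eventually_nhds_iff_baseChart hm]
    refine Filter.eventually_congr ?_
    filter_upwards [h0, baseChart_source_mem hm] with m' h1 h2
    have h3 := h1.self_of_nhds
    rw [tangentChart_zero h2] at h3
    rw [h3.1]
    constructor
    · intro h4
      rw [← (baseChart x).right_inv h3.2, h4]
    · intro h4
      rw [h4, (baseChart x).left_inv h2]
  have hsym : SmoothNear F (baseChart x m, 0) →
      ((∀ᶠ p in 𝓝 (⟨m, 0⟩ : TangentBundle (𝓡 (2 * n)) M), ∀ a b : Coord (2 * n),
        σ.form (φ p) (fibreDeriv φ p a) (fibreDeriv φ p b) = σ.form p.proj a b) ↔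
      ∀ᶠ p in 𝓝 (baseChart x m, (0 : Coord (2 * n))), ∀ a b, formInChart σ.form x (F p)
        (fderiv ℝ F p (0, a)) (fderiv ℝ F p (0, b)) = formInChart σ.form x p.1 a b) := by
    intro hF
    rw [SmoothNear, ← tangentChart_zero hm, ← eventually_nhds_iff_tangentChart hm] at hF
    rw [← tangentChart_zero hm, ← eventually_nhds_iff_tangentChart hm]
    refine Filter.eventually_congr ?_
    filter_upwards [h.eventually, eventually_proj_mem_source (d := 2 * n) (p := ⟨m, 0⟩) hm, hF]
      with p h1 h2 h3
    exact h1.symplectic_iff h2 (h3.differentiableAt (by simp))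
  have hd : SmoothNear F (baseChart x m, 0) → (∀ᶠ y in 𝓝 (baseChart x m), F (y, 0) = y) →
      ((∀ᶠ m' in 𝓝 m, ∀ a, fibreDeriv φ ⟨m', 0⟩ a = a) ↔
        ∀ᶠ y in 𝓝 (baseChart x m), ∀ a, fderiv ℝ F (y, 0) (0, a) = a) := by
    intro hF hz'
    rw [SmoothNear, ← tangentChart_zero hm, ← eventually_nhds_iff_tangentChart hm] at hF
    rw [← eventually_nhds_iff_baseChart hm] at hz' ⊢
    refine Filter.eventually_congr ?_
    filter_upwards [h0, (continuousAt_zeroSection m).eventually hF, hz', baseChart_source_mem hm]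
      with m' h1 h2 h3 h4
    have h5 := h1.fibreDeriv_apply h4 (h2.differentiableAt (by simp))
    rw [tangentChart_zero h4, h3] at h5
    constructor
    · intro H a
      have := H (chartSymmDeriv x (baseChart x m') a)
      rw [h5, chartDeriv_chartSymmDeriv' h4] at this
      have h6 := congrArg (chartDeriv x m') this
      rwa [chartDeriv_chartSymmDeriv' h4, chartDeriv_chartSymmDeriv' h4] at h6
    · intro H a
      rw [h5, H, chartSymmDeriv_chartDeriv h4]
  constructor
  · intro H
    have k1 := hs.1 H.smooth
    have k2 := hz.1 H.zero
    exact { zero := k2, smooth := k1, deriv := (hd k1 k2).1 H.deriv,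
            symplectic := (hsym k1).1 H.symplectic }
  · intro H
    exact { zero := hz.2 H.zero, smooth := hs.2 H.smooth, deriv := (hd H.smooth H.zero).2 H.deriv,
            symplectic := (hsym H.smooth).2 H.symplectic }

end IsLocalExpr

theorem IsThickeningNear.congr {φ' : TangentBundle (𝓡 (2 * n)) M → M}
    (h : IsThickeningNear σ φ m) (e : φ' =ᶠ[𝓝 (⟨m, 0⟩ : TangentBundle (𝓡 (2 * n)) M)] φ) :
    IsThickeningNear σ φ' m := by
  have hd : ∀ᶠ p in 𝓝 (⟨m, 0⟩ : TangentBundle (𝓡 (2 * n)) M),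
      fibreDeriv φ' p = fibreDeriv φ p := by
    filter_upwards [e.eventuallyEq_nhds] with p hp
    obtain ⟨m', w⟩ := p
    exact Filter.EventuallyEq.mfderiv_eq ((continuous_fibre m').continuousAt.eventually hp)
  have hc := continuousAt_zeroSection (n := n) m
  refine ⟨?_, ?_, ?_, ?_⟩
  · filter_upwards [hc.eventually e, h.zero] with p h1 h2 using h1.trans h2
  · filter_upwards [e.eventuallyEq_nhds, h.smooth] with p h1 h2 using
      h2.congr_of_eventuallyEq h1
  · filter_upwards [hc.eventually hd, h.deriv] with p h1 h2
    rwa [h1]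
  · filter_upwards [e, hd, h.symplectic] with p h1 h2 h3
    rwa [h1, h2]

end ThickeningNear

/-! ### Gluing thickenings with bump functions -/

section Gluing

variable {n : ℕ} {M : Type*} [TopologicalSpace M] [ChartedSpace (Coord (2 * n)) M]
  [IsManifold (𝓡 (2 * n)) ∞ M]

theorem IsThickeningGerm.eventually_mem {x : M}
    {Ω : Coord (2 * n) → Coord (2 * n) →L[ℝ] Coord (2 * n) →L[ℝ] ℝ}
    {F : Coord (2 * n) × Coord (2 * n) → Coord (2 * n)} {m : M}
    (hm : m ∈ (baseChart (d := 2 * n) x).source) (h : IsThickeningGerm Ω F (baseChart x m)) :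
    ∀ᶠ q in 𝓝 (⟨m, 0⟩ : TangentBundle (𝓡 (2 * n)) M),
      F (tangentChart x q) ∈ (baseChart x).target := by
  refine (eventually_nhds_iff_tangentChart (p := (⟨m, 0⟩ : TangentBundle (𝓡 (2 * n)) M)) hm
    (P := fun z => F z ∈ (baseChart x).target)).2 ?_
  rw [tangentChart_zero hm]
  refine h.smooth.continuousAt.eventually (baseChart_target_mem ?_)
  rw [h.zero.self_of_nhds]
  exact (baseChart x).map_source hm

variable [T2Space M]

theorem smoothNear_bump {x : M} (f : SmoothBumpFunction (𝓡 (2 * n)) x) {y : Coord (2 * n)}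
    (hy : y ∈ (baseChart x).target) : SmoothNear (fun y => f ((baseChart x).symm y)) y := by
  filter_upwards [baseChart_target_mem hy] with w hw
  exact (ContMDiffAt.comp w f.contMDiffAt (baseChart_symm_contMDiffAt hw)).contDiffAt

/-- The new map is `φ` over the zeros of `f` and the local extension elsewhere. Where `f` is locally
`1` the old map plays no role. At other points of the chart the two branches are compatible, since
the extension equals `F` at base points where `f = 0`. Outside the chart the closed support of `f`
is avoided, so `φ` is unchanged nearby. -/
theorem exists_isThickeningNear_of_bump (σ : SymplecticForm n M)
    (φ : TangentBundle (𝓡 (2 * n)) M → M) {x : M} (f : SmoothBumpFunction (𝓡 (2 * n)) x) :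
    ∃ φ' : TangentBundle (𝓡 (2 * n)) M → M, ∀ m, (IsThickeningNear σ φ m ∨ f =ᶠ[𝓝 m] 1) →
      IsThickeningNear σ φ' m := by
  let F := baseChart (d := 2 * n) x ∘ φ ∘ (tangentChart x).symm
  obtain ⟨F', hF'⟩ := IsThickeningGerm.exists_extension (formInChart σ.form x)
    (fun y => f ((baseChart x).symm y)) F
  classical
  refine ⟨fun p => if f p.proj = 0 then φ p else (baseChart x).symm (F' (tangentChart x p)),
    fun m hm => ?_⟩
  have hsrc : ∀ {q : M}, f q ≠ 0 → q ∈ (baseChart (d := 2 * n) x).source := fun {q} hq => by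
    rw [extChartAt_source]
    exact f.support_subset_source hq
  have hfst : ∀ {q : TangentBundle (𝓡 (2 * n)) M}, q.proj ∈ (baseChart (d := 2 * n) x).source →
      (baseChart x).symm (tangentChart x q).1 = q.proj := fun {q} hq => by
    obtain ⟨m', w⟩ := q
    have e := congrArg Prod.fst (tangentChart_apply (d := 2 * n) hq w)
    exact (congrArg (baseChart x).symm e).trans ((baseChart x).left_inv hq)
  by_cases h1 : f =ᶠ[𝓝 m] 1
  · have hms : m ∈ (baseChart (d := 2 * n) x).source := hsrc (by rw [h1.self_of_nhds]; simp)
    have hyt := (baseChart x).map_source hms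
    obtain ⟨hA, -⟩ := hF' _ (isSymplecticNear_formInChart σ x hyt) (smoothNear_bump f hyt)
    have hg := hA (Or.inr <| (eventually_nhds_iff_baseChart hms
      (P := fun y => f ((baseChart x).symm y) = 1)).1 <| by
        filter_upwards [h1, baseChart_source_mem hms] with q hq hq1
        rw [(baseChart x).left_inv hq1, hq]; rfl)
    refine (IsLocalExpr.isThickeningNear_iff hms ?_).2 hg
    filter_upwards [hg.eventually_mem hms, (FiberBundle.continuous_proj (Coord (2 * n))
      (TangentSpace (𝓡 (2 * n)))).continuousAt.eventually h1] with q hq hq1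
    refine ⟨if_neg ?_, hq⟩
    rw [hq1]; simp
  · replace hm := hm.resolve_right h1
    by_cases hms : m ∈ (baseChart (d := 2 * n) x).source
    · have hyt := (baseChart x).map_source hms
      obtain ⟨hA, hB⟩ := hF' _ (isSymplecticNear_formInChart σ x hyt) (smoothNear_bump f hyt)
      have hle : IsLocalExpr x φ F (⟨m, 0⟩ : TangentBundle (𝓡 (2 * n)) M) := by
        have hc := hm.smooth.self_of_nhds.continuousAt
        rw [ContinuousAt, hm.zero.self_of_nhds] at hc
        filter_upwards [hc.eventually (baseChart_source_mem hms),
          eventually_proj_mem_source (d := 2 * n) (p := ⟨m, 0⟩) hms] with q hq hq1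
        simp only [F, Function.comp_apply]
        rw [tangentChart_symm_tangentChart hq1, (baseChart x).left_inv hq]
        exact ⟨rfl, (baseChart x).map_source hq⟩
      have hgF := (hle.isThickeningNear_iff hms).1 hm
      have hg := hA (Or.inl hgF)
      have hB' := hB hgF
      rw [← tangentChart_zero hms, ← eventually_nhds_iff_tangentChart hms] at hB'
      refine (IsLocalExpr.isThickeningNear_iff hms ?_).2 hg
      filter_upwards [hg.eventually_mem hms, hle, hB',
        eventually_proj_mem_source (d := 2 * n) (p := ⟨m, 0⟩) hms] with q hq hq1 hq2 hq3
      refine ⟨?_, hq⟩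
      split_ifs with h0
      · rw [hq2 (by rw [hfst hq3, h0]), hq1.1]
      · rfl
    · have h0 : f =ᶠ[𝓝 m] 0 := by
        refine notMem_tsupport_iff_eventuallyEq.1 fun h => hms ?_
        exact f.tsupport_subset_extChartAt_source h
      refine hm.congr ?_
      filter_upwards [(FiberBundle.continuous_proj (Coord (2 * n))
        (TangentSpace (𝓡 (2 * n)))).continuousAt.eventually h0] with q hq
      exact if_pos hq

/-- There is a map `TM → M` whose restrictions to the fibres are symplectic near the zero
section. -/
theorem exists_isThickeningNear [CompactSpace M] (σ : SymplecticForm n M) :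
    ∃ φ : TangentBundle (𝓡 (2 * n)) M → M, ∀ m, IsThickeningNear σ φ m := by
  let f : ∀ x : M, SmoothBumpFunction (𝓡 (2 * n)) x := fun x => Classical.arbitrary _
  have hf : ∀ x : M, {m | f x =ᶠ[𝓝 m] 1} ∈ 𝓝 x := fun x => (f x).eventuallyEq_one.eventuallyEq_nhds
  obtain ⟨s, hs⟩ := CompactSpace.elim_nhds_subcover _ hf
  have key : ∀ t : Finset M, ∃ φ : TangentBundle (𝓡 (2 * n)) M → M,
      ∀ m, (∃ x ∈ t, f x =ᶠ[𝓝 m] 1) → IsThickeningNear σ φ m := by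
    classical
    intro t
    induction t using Finset.induction_on with
    -- Nothing is required before the first step, so any map serves as a start.
    | empty => exact ⟨fun p => p.proj, fun m ⟨x, hx, _⟩ => absurd hx (Finset.notMem_empty x)⟩
    | insert a t _ ih =>
      obtain ⟨φ, hφ⟩ := ih
      obtain ⟨φ', hφ'⟩ := exists_isThickeningNear_of_bump σ φ (f a)
      refine ⟨φ', fun m ⟨x, hx, hxm⟩ => hφ' m ?_⟩
      rcases Finset.mem_insert.1 hx with rfl | hx
      · exact Or.inr hxm
      · exact Or.inl (hφ m ⟨x, hx, hxm⟩)
  obtain ⟨φ, hφ⟩ := key s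
  refine ⟨φ, fun m => hφ m ?_⟩
  have hm : m ∈ ⋃ x ∈ s, {m | f x =ᶠ[𝓝 m] 1} := hs ▸ Set.mem_univ m
  simpa using hm

end Gluing

/-! ### Endomorphism fields in charts -/

section Endomorphisms

variable {d : ℕ} {M : Type*} [TopologicalSpace M] [ChartedSpace (Coord d) M]
  [IsManifold (𝓡 d) ∞ M]

/-- A field of endomorphisms of the tangent spaces, as a section of the endomorphism bundle. -/
def endSection (J : M → Coord d →L[ℝ] Coord d) (m : M) : TotalSpace (Coord d →L[ℝ] Coord d)
    (fun m : M => TangentSpace (𝓡 d) m →L[ℝ] TangentSpace (𝓡 d) m) :=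
  TotalSpace.mk' _ m (J m : TangentSpace (𝓡 d) m →L[ℝ] TangentSpace (𝓡 d) m)

/-- A field of endomorphisms of the tangent spaces in the preferred chart at `x`. -/
def endInChart (J : M → Coord d →L[ℝ] Coord d) (x : M) (y : Coord d) : Coord d →L[ℝ] Coord d :=
  (chartDeriv x ((baseChart x).symm y)).comp
    ((J ((baseChart x).symm y)).comp (chartSymmDeriv x y))

theorem endInChart_chart (J : M → Coord d →L[ℝ] Coord d) {x m : M}
    (hm : m ∈ (baseChart (d := d) x).source) : endInChart J x (baseChart x m) =
      (chartDeriv x m).comp ((J m).comp (chartSymmDeriv x (baseChart x m))) := by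
  rw [endInChart, (baseChart x).left_inv hm]

/-- In the trivialization of the endomorphism bundle at `x`, an endomorphism is conjugated by the
tangent bundle trivialization, that is, by the derivative of the chart. -/
theorem contMDiffAt_endSection_iff (J : M → Coord d →L[ℝ] Coord d) {x m : M}
    (hm : m ∈ (baseChart (d := d) x).source) :
    ContMDiffAt (𝓡 d) ((𝓡 d).prod 𝓘(ℝ, Coord d →L[ℝ] Coord d)) ∞ (endSection J) m ↔
      ContDiffAt ℝ ∞ (endInChart J x) (baseChart x m) := by
  have hb : m ∈ (trivializationAt (Coord d →L[ℝ] Coord d)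
      (fun m : M => TangentSpace (𝓡 d) m →L[ℝ] TangentSpace (𝓡 d) m) x).baseSet := by
    rw [hom_trivializationAt_baseSet]
    rw [extChartAt_source] at hm
    exact ⟨hm, hm⟩
  let s : ∀ m : M, TangentSpace (𝓡 d) m →L[ℝ] TangentSpace (𝓡 d) m := J
  have h1 := (trivializationAt (Coord d →L[ℝ] Coord d)
      (fun m : M => TangentSpace (𝓡 d) m →L[ℝ] TangentSpace (𝓡 d) m) x).contMDiffAt_section_iff
      (IB := 𝓡 d) (n := ∞)
      (s := s) hb
  refine h1.trans ?_
  have h2 : (fun m' : M => (trivializationAt (Coord d →L[ℝ] Coord d)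
      (fun m : M => TangentSpace (𝓡 d) m →L[ℝ] TangentSpace (𝓡 d) m) x
      ⟨m', s m'⟩).2) =ᶠ[𝓝 m]
      fun m' => endInChart J x (baseChart x m') := by
    filter_upwards [baseChart_source_mem hm] with m' hm'
    rw [endInChart_chart J hm', hom_trivializationAt_apply]
    have hm2 : m' ∈ (chartAt (Coord d) x).source := by rwa [extChartAt_source] at hm'
    have e1 := TangentBundle.continuousLinearMapAt_trivializationAt (I := 𝓡 d) hm2
    have e2 := TangentBundle.symmL_trivializationAt (I := 𝓡 d) hm2
    simp only [modelWithCornersSelf_coe, Set.range_id, mfderivWithin_univ] at e2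
    change (Trivialization.continuousLinearMapAt ℝ _ m').comp (ContinuousLinearMap.comp _ (Trivialization.symmL ℝ _ m')) = _
    rw [e1, e2]
    rfl
  have hyt := (baseChart x).map_source hm
  constructor
  · intro h
    have h3 := h.congr_of_eventuallyEq h2.symm
    have h4 : ContMDiffAt 𝓘(ℝ, Coord d) 𝓘(ℝ, Coord d →L[ℝ] Coord d) ∞
        ((fun m' => endInChart J x (baseChart x m')) ∘ (baseChart (d := d) x).symm)
        (baseChart x m) :=
      ContMDiffAt.comp _ (by rwa [(baseChart x).left_inv hm]) (baseChart_symm_contMDiffAt hyt)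
    refine h4.contDiffAt.congr_of_eventuallyEq ?_
    filter_upwards [baseChart_target_mem hyt] with w hw
    rw [Function.comp_apply, (baseChart x).right_inv hw]
  · intro h
    refine ContMDiffAt.congr_of_eventuallyEq ?_ h2
    exact ContMDiffAt.comp (g := endInChart J x) m h.contMDiffAt (baseChart_contMDiffAt hm)

end Endomorphisms

/-! ### Naturality under conjugation -/

section Conjugation

variable {E E' : Type*} [NormedAddCommGroup E] [NormedSpace ℝ E] [NormedAddCommGroup E']
  [NormedSpace ℝ E'] {B : E →L[ℝ] E →L[ℝ] ℝ} {B' : E' →L[ℝ] E' →L[ℝ] ℝ} {S : E' →L[ℝ] E}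
  {D : E →L[ℝ] E'} {J J₀ J₁ : E →L[ℝ] E}

theorem IsCompatible.conj (h : IsCompatible B J) (hSD : ∀ v, S (D v) = v) (hDS : ∀ v, D (S v) = v)
    (hB : ∀ u v, B' u v = B (S u) (S v)) : IsCompatible B' (D.comp (J.comp S)) := by
  refine ⟨fun v => ?_, fun u v => ?_, fun v hv => ?_⟩
  · change D (J (S (D (J (S v))))) = -v
    rw [hSD, h.sq, map_neg, hDS]
  · change B' (D (J (S u))) (D (J (S v))) = _
    rw [hB, hSD, hSD, h.compatible, hB]
  · change 0 < B' v (D (J (S v)))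
    rw [hB, hSD]
    refine h.pos _ fun h0 => hv ?_
    rw [← hDS v, h0, map_zero]

/-- The Cayley path is built from composition and inversion only, so it is coordinate-free. This
allows smoothness to be checked on coordinate representatives. -/
theorem cayleyPath_conj {t : ℝ} (hSD : ∀ v, S (D v) = v) (hDS : ∀ v, D (S v) = v)
    (h : (cayleyMap t J₀ J₁).IsInvertible)
    (h' : (cayleyMap t (D.comp (J₀.comp S)) (D.comp (J₁.comp S))).IsInvertible) :
    D.comp ((cayleyPath t J₀ J₁).comp S) =
      cayleyPath t (D.comp (J₀.comp S)) (D.comp (J₁.comp S)) := by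
  have e : ∀ u, S (cayleyMap t (D.comp (J₀.comp S)) (D.comp (J₁.comp S)) u) =
      cayleyMap t J₀ J₁ (S u) := by
    intro u
    simp only [cayleyMap_apply, ContinuousLinearMap.comp_apply, map_sub, map_smul, hSD]
  have hinj : ∀ a b, S a = S b → a = b := fun a b hab => by
    rw [← hDS a, hab, hDS]
  ext v
  obtain ⟨u, rfl⟩ := h'.surjective v
  rw [cayleyPath_apply_cayleyMap h']
  apply hinj
  rw [e]
  simp only [ContinuousLinearMap.comp_apply, hSD]
  rw [e, cayleyPath_apply_cayleyMap h]

end Conjugation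

/-! ### Existence of compatible almost complex structures -/

section ExistenceOfCompatible

variable {n : ℕ} {M : Type*} [TopologicalSpace M] [ChartedSpace (Coord (2 * n)) M]
  [IsManifold (𝓡 (2 * n)) ∞ M] (σ : SymplecticForm n M)

/-- The symplectic form on the model space of `T_m M`. -/
def SymplecticForm.formAt (m : M) : Coord (2 * n) →L[ℝ] Coord (2 * n) →L[ℝ] ℝ := σ.form m

/-- `J` is a smooth compatible almost complex structure near `m`. -/
def IsCompatibleNear (J : M → Coord (2 * n) →L[ℝ] Coord (2 * n)) (m : M) : Prop :=
  ∀ᶠ m' in 𝓝 m, ContMDiffAt (𝓡 (2 * n)) ((𝓡 (2 * n)).prod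
    𝓘(ℝ, Coord (2 * n) →L[ℝ] Coord (2 * n))) ∞ (endSection J) m' ∧
      IsCompatible (σ.formAt m') (J m')

variable {σ} {J J₁ : M → Coord (2 * n) →L[ℝ] Coord (2 * n)} {x m : M}

theorem formInChart_chart (hm : m ∈ (baseChart (d := 2 * n) x).source) (u v : Coord (2 * n)) :
    formInChart σ.form x (baseChart x m) u v = σ.formAt m (chartSymmDeriv x (baseChart x m) u)
      (chartSymmDeriv x (baseChart x m) v) := by
  rw [formInChart_apply, (baseChart x).left_inv hm]; rfl

theorem formAt_eq (hm : m ∈ (baseChart (d := 2 * n) x).source) (u v : Coord (2 * n)) :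
    σ.formAt m u v = formInChart σ.form x (baseChart x m) (chartDeriv x m u)
      (chartDeriv x m v) := by
  rw [formInChart_chart hm, chartSymmDeriv_chartDeriv hm, chartSymmDeriv_chartDeriv hm]

theorem IsCompatible.endInChart (hm : m ∈ (baseChart (d := 2 * n) x).source)
    (h : IsCompatible (σ.formAt m) (J m)) :
    IsCompatible (formInChart σ.form x (baseChart x m)) (endInChart J x (baseChart x m)) := by
  rw [endInChart_chart J hm]
  exact h.conj (chartSymmDeriv_chartDeriv hm) (chartDeriv_chartSymmDeriv' hm)
    (formInChart_chart hm)

theorem IsCompatibleNear.eventually (h : IsCompatibleNear σ J m) :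
    ∀ᶠ m' in 𝓝 m, IsCompatibleNear σ J m' := eventually_eventually_nhds.2 h

theorem IsCompatibleNear.congr (h : IsCompatibleNear σ J m) (e : J₁ =ᶠ[𝓝 m] J) :
    IsCompatibleNear σ J₁ m := by
  filter_upwards [h, e.eventuallyEq_nhds] with m' h1 h2
  refine ⟨h1.1.congr_of_eventuallyEq ?_, by rw [h2.self_of_nhds]; exact h1.2⟩
  filter_upwards [h2] with w hw
  rw [endSection, hw]; rfl

theorem IsCompatibleNear.smoothNear (hm : m ∈ (baseChart (d := 2 * n) x).source)
    (h : IsCompatibleNear σ J m) : SmoothNear (endInChart J x) (baseChart x m) := by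
  rw [SmoothNear, ← eventually_nhds_iff_baseChart hm]
  filter_upwards [h, baseChart_source_mem hm] with w h1 h2
  exact (contMDiffAt_endSection_iff J h2).1 h1.1

theorem exists_isCompatibleNear (σ : SymplecticForm n M) (x : M) :
    ∃ J : M → Coord (2 * n) →L[ℝ] Coord (2 * n), IsCompatibleNear σ J x := by
  have hx : x ∈ (baseChart (d := 2 * n) x).source := mem_extChartAt_source x
  have hs := isSymplecticNear_formInChart σ x ((baseChart x).map_source hx)
  obtain ⟨K, hK, hKc⟩ := exists_local_compatible (n := n) (by simp) hs.smooth hs.alternating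
    (fun v hv => by
      have : formInChart σ.form x (baseChart x x) v = 0 := ContinuousLinearMap.ext hv
      exact hs.invertible.injective (this.trans (map_zero _).symm))
  refine ⟨fun m => (chartSymmDeriv x (baseChart x m)).comp
    ((K (baseChart x m)).comp (chartDeriv x m)), ?_⟩
  have hKs : ∀ᶠ m in 𝓝 x, ContDiffAt ℝ ∞ K (baseChart x m) :=
    (eventually_nhds_iff_baseChart hx).2 hK
  filter_upwards [hKs, (eventually_nhds_iff_baseChart hx).2 hKc, baseChart_source_mem hx]
    with m h1 h2 h3
  refine ⟨(contMDiffAt_endSection_iff _ h3).2 (h1.congr_of_eventuallyEq ?_),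
    h2.conj (chartDeriv_chartSymmDeriv' h3) (chartSymmDeriv_chartDeriv h3) (formAt_eq h3)⟩
  rw [Filter.EventuallyEq, ← eventually_nhds_iff_baseChart h3]
  filter_upwards [baseChart_source_mem h3] with w hw
  rw [endInChart_chart _ hw]
  ext1 v
  simp only [ContinuousLinearMap.comp_apply, chartDeriv_chartSymmDeriv' hw]

theorem IsCompatibleNear.cayleyPath {χ : M → ℝ} (hχ : ContMDiff (𝓡 (2 * n)) 𝓘(ℝ, ℝ) ∞ χ)
    (hI : ∀ m, χ m ∈ Set.Icc (0 : ℝ) 1) (h : IsCompatibleNear σ J m)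
    (h₁ : IsCompatibleNear σ J₁ m) :
    IsCompatibleNear σ (fun m => _root_.cayleyPath (χ m) (J m) (J₁ m)) m := by
  have halt : ∀ m a, σ.formAt m a a = 0 := fun m a => σ.alternating m a
  filter_upwards [h.eventually, h₁.eventually] with x hx hx₁
  have hxs : x ∈ (baseChart (d := 2 * n) x).source := mem_extChartAt_source x
  have hyt := (baseChart x).map_source hxs
  refine ⟨(contMDiffAt_endSection_iff _ hxs).2 ?_,
    hx.self_of_nhds.2.cayleyPath (halt x) hx₁.self_of_nhds.2 (hI x)⟩
  have hχ' : SmoothNear (fun y => χ ((baseChart (d := 2 * n) x).symm y)) (baseChart x x) := by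
    filter_upwards [baseChart_target_mem hyt] with w hw
    exact (ContMDiffAt.comp w hχ.contMDiffAt (baseChart_symm_contMDiffAt hw)).contDiffAt
  have halt' : ∀ y a, formInChart σ.form x y a a = 0 := fun y a => σ.alternating _ _
  have hinv : ∀ m', m' ∈ (baseChart (d := 2 * n) x).source → IsCompatible (σ.formAt m') (J m') →
      IsCompatible (σ.formAt m') (J₁ m') → (cayleyMap (χ m') (endInChart J x (baseChart x m'))
        (endInChart J₁ x (baseChart x m'))).IsInvertible := fun m' k1 k2 k3 =>
    cayleyMap_isInvertible (halt' _) (k2.endInChart k1) (k3.endInChart k1) (hI m')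
  have key := SmoothNear.cayleyPath hχ' (hx.smoothNear hxs) (hx₁.smoothNear hxs) (by
    rw [(baseChart x).left_inv hxs]
    exact hinv x hxs hx.self_of_nhds.2 hx₁.self_of_nhds.2)
  refine key.contDiffAt.congr_of_eventuallyEq ?_
  rw [Filter.EventuallyEq, ← eventually_nhds_iff_baseChart hxs]
  filter_upwards [hx, hx₁, baseChart_source_mem hxs] with w k1 k2 k3
  have k4 := hinv w k3 k1.2 k2.2
  rw [endInChart_chart _ k3, endInChart_chart _ k3] at k4
  rw [endInChart_chart _ k3, endInChart_chart _ k3, endInChart_chart _ k3,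
    (baseChart x).left_inv k3]
  exact cayleyPath_conj (chartSymmDeriv_chartDeriv k3) (chartDeriv_chartSymmDeriv' k3)
    (cayleyMap_isInvertible (halt w) k1.2 k2.2 (hI w)) k4

/-- Move from `J` to `J₁` along the Cayley path with parameter `f`. The separate branch at `f = 0`
keeps `J` even where `J₁` is meaningless; where both are compatible it agrees with the path at
parameter `0`. -/
theorem exists_isCompatibleNear_of_bump [T2Space M] (J : M → Coord (2 * n) →L[ℝ] Coord (2 * n))
    (f : SmoothBumpFunction (𝓡 (2 * n)) x) (hf : ∀ m ∈ tsupport f, IsCompatibleNear σ J₁ m) :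
    ∃ J' : M → Coord (2 * n) →L[ℝ] Coord (2 * n), ∀ m, (IsCompatibleNear σ J m ∨ f =ᶠ[𝓝 m] 1) →
      IsCompatibleNear σ J' m := by
  classical
  refine ⟨fun m => if f m = 0 then J m else cayleyPath (f m) (J m) (J₁ m), fun m hm => ?_⟩
  by_cases h1 : f =ᶠ[𝓝 m] 1
  · have hm1 : m ∈ tsupport f := subset_tsupport f (by
      rw [Function.mem_support, h1.self_of_nhds]; simp)
    refine (hf m hm1).congr ?_
    filter_upwards [h1] with w hw
    rw [hw]
    simp [cayleyPath_one]
  · replace hm := hm.resolve_right h1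
    by_cases hmt : m ∈ tsupport f
    · refine (hm.cayleyPath f.contMDiff (fun _ => f.mem_Icc) (hf m hmt)).congr ?_
      filter_upwards [hm, hf m hmt] with w k1 k2
      split_ifs with h0
      · have halt : ∀ a, σ.formAt w a a = 0 := fun a => σ.alternating w a
        rw [h0, cayleyPath_zero halt k1.2 k2.2]
      · rfl
    · refine hm.congr ?_
      filter_upwards [notMem_tsupport_iff_eventuallyEq.1 hmt] with w hw
      exact if_pos hw

theorem exists_compatibleACS [T2Space M] [CompactSpace M] (σ : SymplecticForm n M) :
    Nonempty (CompatibleACS σ) := by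
  choose J₁ hJ₁ using exists_isCompatibleNear σ
  -- The bump functions are chosen with closed support inside the region where the local structure
  -- is compatible.
  have hb : ∀ x : M, ∃ f : SmoothBumpFunction (𝓡 (2 * n)) x,
      ∀ m ∈ tsupport f, IsCompatibleNear σ (J₁ x) m := fun x => by
    obtain ⟨f, -, hf⟩ := (SmoothBumpFunction.nhds_basis_tsupport (I := 𝓡 (2 * n)) x).mem_iff.1
      (hJ₁ x).eventually
    exact ⟨f, hf⟩
  choose f hfs using hb
  have hf : ∀ x : M, {m | f x =ᶠ[𝓝 m] 1} ∈ 𝓝 x := fun x => (f x).eventuallyEq_one.eventuallyEq_nhds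
  obtain ⟨s, hs⟩ := CompactSpace.elim_nhds_subcover _ hf
  have key : ∀ t : Finset M, ∃ J : M → Coord (2 * n) →L[ℝ] Coord (2 * n),
      ∀ m, (∃ x ∈ t, f x =ᶠ[𝓝 m] 1) → IsCompatibleNear σ J m := by
    classical
    intro t
    induction t using Finset.induction_on with
    | empty => exact ⟨fun _ => 0, fun m ⟨x, hx, _⟩ => absurd hx (Finset.notMem_empty x)⟩
    | insert a t _ ih =>
      obtain ⟨J, hJ⟩ := ih
      obtain ⟨J', hJ'⟩ := exists_isCompatibleNear_of_bump J (f a) (hfs a)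
      refine ⟨J', fun m ⟨x, hx, hxm⟩ => hJ' m ?_⟩
      rcases Finset.mem_insert.1 hx with rfl | hx
      · exact Or.inr hxm
      · exact Or.inl (hJ m ⟨x, hx, hxm⟩)
  obtain ⟨J, hJ⟩ := key s
  have hJ' : ∀ m, IsCompatibleNear σ J m := fun m => hJ m <| by
    have hm : m ∈ ⋃ x ∈ s, {m | f x =ᶠ[𝓝 m] 1} := hs ▸ Set.mem_univ m
    simpa using hm
  exact ⟨{ J := J
           smooth := fun m => (hJ' m).self_of_nhds.1
           sq := fun m => (hJ' m).self_of_nhds.2.sq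
           compatible := fun m => (hJ' m).self_of_nhds.2.compatible
           pos := fun m => (hJ' m).self_of_nhds.2.pos }⟩

end ExistenceOfCompatible

/-! ### Smooth local unitary frames -/

section Frames

variable {n : ℕ} {M : Type*} [TopologicalSpace M] [ChartedSpace (Coord (2 * n)) M]
  [IsManifold (𝓡 (2 * n)) ∞ M] {σ : SymplecticForm n M}

/-- The tangent vector at `m` whose coordinates in the frame `L`, which is given in the preferred
chart at `x`, are `b`. -/
def frameVector (x : M) (L : Coord (2 * n) → StdSpace n →L[ℝ] Coord (2 * n)) (m : M)
    (b : StdSpace n) : TangentBundle (𝓡 (2 * n)) M :=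
  ⟨m, chartSymmDeriv x (baseChart x m) (L (baseChart x m) b)⟩

/-- The coordinates of a tangent vector in the frame `L`, which is given in the preferred
chart at `x`. -/
def frameCoord (x : M) (L : Coord (2 * n) → StdSpace n →L[ℝ] Coord (2 * n))
    (p : TangentBundle (𝓡 (2 * n)) M) : StdSpace n :=
  (L (baseChart x p.proj)).inverse (chartDeriv x p.proj p.2)

/-- A smooth family of unitary frames of the tangent spaces at points of `U`, in the preferred
chart at `x`. -/
structure IsUnitaryFrameOn (J : CompatibleACS σ) (x : M) (U : Set M)
    (L : Coord (2 * n) → StdSpace n →L[ℝ] Coord (2 * n)) : Prop where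
  isOpen : IsOpen U
  subset : U ⊆ (baseChart (d := 2 * n) x).source
  smooth : ∀ m ∈ U, ContDiffAt ℝ ∞ L (baseChart x m)
  invertible : ∀ m ∈ U, (L (baseChart x m)).IsInvertible
  form : ∀ m ∈ U, ∀ u v, σ.form m (frameVector x L m u).2 (frameVector x L m v).2 = stdForm n u v
  complex : ∀ m ∈ U, ∀ v, (frameVector x L m (stdJ n v)).2 = J.J m (frameVector x L m v).2

/-- The squared length of a tangent vector. -/
def CompatibleACS.sqNorm (J : CompatibleACS σ) (p : TangentBundle (𝓡 (2 * n)) M) : ℝ :=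
  σ.form p.proj p.2 (J.J p.proj p.2)

theorem CompatibleACS.isCompatible (J : CompatibleACS σ) (m : M) :
    IsCompatible (σ.formAt m) (J.J m) := ⟨J.sq m, J.compatible m, J.pos m⟩

theorem CompatibleACS.isCompatibleNear (J : CompatibleACS σ) (m : M) :
    IsCompatibleNear σ (fun m => (J.J m : Coord (2 * n) →L[ℝ] Coord (2 * n))) m :=
  Filter.Eventually.of_forall fun m => ⟨J.smooth m, J.isCompatible m⟩

theorem exists_isUnitaryFrameOn (J : CompatibleACS σ) (x : M) :
    ∃ U L, x ∈ U ∧ IsUnitaryFrameOn J x U L := by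
  have hx : x ∈ (baseChart (d := 2 * n) x).source := mem_extChartAt_source x
  have hyt := (baseChart x).map_source hx
  have hs := isSymplecticNear_formInChart σ x hyt
  let J' : M → Coord (2 * n) →L[ℝ] Coord (2 * n) := fun m => J.J m
  have hc : ∀ᶠ y in 𝓝 (baseChart x x), IsCompatible (formInChart σ.form x y)
      (endInChart J' x y) := by
    rw [← eventually_nhds_iff_baseChart hx]
    filter_upwards [baseChart_source_mem hx] with m hm
    exact IsCompatible.endInChart hm (J.isCompatible m)
  obtain ⟨L, hL, hLp⟩ := exists_local_unitary (n := n) (by simp) hs.smooth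
    ((J.isCompatibleNear x).smoothNear hx) hs.alternating hc
  rw [SmoothNear, ← eventually_nhds_iff_baseChart hx] at hL
  rw [← eventually_nhds_iff_baseChart hx] at hLp
  have h := hL.and (hLp.and (baseChart_source_mem hx))
  rw [eventually_nhds_iff] at h
  obtain ⟨U, hU, hUo, hxU⟩ := h
  refine ⟨U, L, hxU, hUo, fun m hm => (hU m hm).2.2, fun m hm => (hU m hm).1,
    fun m hm => (hU m hm).2.1.1, fun m hm u v => ?_, fun m hm v => ?_⟩
  · have := (hU m hm).2.1.2.1 u v
    rwa [formInChart_chart (hU m hm).2.2] at this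
  · have h1 := (hU m hm).2.1.2.2 v
    have h2 := (hU m hm).2.2
    rw [endInChart_chart J' h2] at h1
    change chartSymmDeriv x (baseChart x m) (L (baseChart x m) (stdJ n v)) = _
    rw [h1]
    exact chartSymmDeriv_chartDeriv h2 _

namespace IsUnitaryFrameOn

variable {J : CompatibleACS σ} {x : M} {U : Set M}
  {L : Coord (2 * n) → StdSpace n →L[ℝ] Coord (2 * n)}

theorem sqNorm_frameVector (h : IsUnitaryFrameOn J x U L) {m : M} (hm : m ∈ U) (b : StdSpace n) :
    J.sqNorm (frameVector x L m b) = ‖b‖ ^ 2 := by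
  rw [← stdForm_stdJ, ← h.form m hm, h.complex m hm]
  rfl

theorem frameCoord_frameVector (h : IsUnitaryFrameOn J x U L) {m : M} (hm : m ∈ U)
    (b : StdSpace n) :
    frameCoord x L (frameVector x L m b) = b := by
  simp only [frameCoord, frameVector]
  rw [chartDeriv_chartSymmDeriv' (h.subset hm), (h.invertible m hm).inverse_apply_self]

theorem frameVector_frameCoord (h : IsUnitaryFrameOn J x U L)
    {p : TangentBundle (𝓡 (2 * n)) M} (hp : p.proj ∈ U) :
    frameVector x L p.proj (frameCoord x L p) = p := by
  obtain ⟨m, v⟩ := p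
  have e := (h.invertible m hp).self_apply_inverse (chartDeriv x m v)
  have : chartSymmDeriv x (baseChart x m) (L (baseChart x m) (frameCoord x L ⟨m, v⟩)) = v := by
    rw [frameCoord, e]
    exact chartSymmDeriv_chartDeriv (h.subset hp) v
  exact congrArg (TotalSpace.mk m) this

theorem frameVector_eq (h : IsUnitaryFrameOn J x U L) {m : M} (hm : m ∈ U) (b : StdSpace n) :
    frameVector x L m b = (tangentChart x).symm (baseChart x m, L (baseChart x m) b) := by
  rw [tangentChart_symm_apply ((baseChart x).map_source (h.subset hm))]
  rw [frameVector, (baseChart x).left_inv (h.subset hm)]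

/-- On `U` the frame vector is the inverse tangent chart at coordinates depending smoothly on the
base point and on `b`. -/
theorem contMDiffAt_frameVector (h : IsUnitaryFrameOn J x U L) {m : M} (hm : m ∈ U) (b : StdSpace n) :
    ContMDiffAt ((𝓡 (2 * n)).prod 𝓘(ℝ, StdSpace n)) (𝓡 (2 * n)).tangent ∞
      (fun z : M × StdSpace n => frameVector x L z.1 z.2) (m, b) := by
  have hms := h.subset hm
  have h1 : ContMDiffAt ((𝓡 (2 * n)).prod 𝓘(ℝ, StdSpace n)) 𝓘(ℝ, Coord (2 * n)) ∞
      (fun z : M × StdSpace n => baseChart x z.1) (m, b) :=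
    ContMDiffAt.comp (g := baseChart x) _ (baseChart_contMDiffAt hms) contMDiffAt_fst
  have h2 : ContMDiffAt ((𝓡 (2 * n)).prod 𝓘(ℝ, StdSpace n))
      𝓘(ℝ, StdSpace n →L[ℝ] Coord (2 * n)) ∞
      (fun z : M × StdSpace n => L (baseChart x z.1)) (m, b) :=
    ContMDiffAt.comp (g := L) (f := fun z : M × StdSpace n => baseChart x z.1) _
      (h.smooth m hm).contMDiffAt h1
  have h3 := h1.prodMk_space (h2.clm_apply (contMDiffAt_snd (M := M) (I := 𝓡 (2 * n))))
  have h4 := ContMDiffAt.comp (m, b) (tangentChart_symm_contMDiffAt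
    (z := (baseChart x m, L (baseChart x m) b)) ((baseChart x).map_source hms)) h3
  refine h4.congr_of_eventuallyEq ?_
  filter_upwards [continuous_fst.continuousAt.eventually (h.isOpen.mem_nhds hm)] with z hz
  exact h.frameVector_eq hz z.2

theorem contMDiffAt_frameCoord (h : IsUnitaryFrameOn J x U L)
    {p : TangentBundle (𝓡 (2 * n)) M} (hp : p.proj ∈ U) :
    ContMDiffAt (𝓡 (2 * n)).tangent 𝓘(ℝ, StdSpace n) ∞ (frameCoord x L) p := by
  have hms := h.subset hp
  have h1 : ContMDiffAt (𝓡 (2 * n)).tangent 𝓘(ℝ, Coord (2 * n)) ∞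
      (fun q : TangentBundle (𝓡 (2 * n)) M => baseChart x q.proj) p :=
    ContMDiffAt.comp (g := baseChart x) _ (baseChart_contMDiffAt hms) (contMDiffAt_proj _)
  have h2 : ContDiffAt ℝ ∞ (fun y => (L y).inverse) (baseChart x p.proj) :=
    ((h.invertible _ hp).contDiffAt_map_inverse).comp _ (h.smooth _ hp)
  have h3 : ContMDiffAt (𝓡 (2 * n)).tangent 𝓘(ℝ, Coord (2 * n) →L[ℝ] StdSpace n) ∞
      (fun q : TangentBundle (𝓡 (2 * n)) M => (L (baseChart x q.proj)).inverse) p :=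
    ContMDiffAt.comp (g := fun y => (L y).inverse)
      (f := fun q : TangentBundle (𝓡 (2 * n)) M => baseChart x q.proj) _ h2.contMDiffAt h1
  have h4 : ContMDiffAt (𝓡 (2 * n)).tangent 𝓘(ℝ, Coord (2 * n)) ∞
      (fun q : TangentBundle (𝓡 (2 * n)) M => (tangentChart x q).2) p :=
    ContMDiffAt.comp (g := Prod.snd) _ contDiff_snd.contMDiff.contMDiffAt
      (tangentChart_contMDiffAt hms)
  refine (h3.clm_apply h4).congr_of_eventuallyEq ?_
  filter_upwards [eventually_proj_mem_source hms] with q hq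
  rw [frameCoord]
  obtain ⟨m, v⟩ := q
  have e := congrArg Prod.snd (tangentChart_apply (d := 2 * n) hq v)
  exact congrArg (L (baseChart x m)).inverse e.symm

end IsUnitaryFrameOn

end Frames

/-! ### Uniform radii by compactness -/

section UniformRadius

variable {n : ℕ} {M : Type*} [TopologicalSpace M] [ChartedSpace (Coord (2 * n)) M]
  [IsManifold (𝓡 (2 * n)) ∞ M] {σ : SymplecticForm n M}

/-- Neighbourhoods of `0_m` contain all short tangent vectors at points near `m`. -/
theorem exists_forall_sqNorm_lt_mem (J : CompatibleACS σ) {m : M}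
    {W : Set (TangentBundle (𝓡 (2 * n)) M)}
    (hW : W ∈ 𝓝 (⟨m, 0⟩ : TangentBundle (𝓡 (2 * n)) M)) :
    ∃ ε > 0, ∀ᶠ m' in 𝓝 m, ∀ p : TangentBundle (𝓡 (2 * n)) M, p.proj = m' →
      J.sqNorm p < ε ^ 2 → p ∈ W := by
  obtain ⟨U, L, hmU, hL⟩ := exists_isUnitaryFrameOn J m
  have hc := (hL.contMDiffAt_frameVector hmU 0).continuousAt
  have e : frameVector m L m 0 = (⟨m, 0⟩ : TangentBundle (𝓡 (2 * n)) M) := by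
    rw [frameVector, map_zero, map_zero]; rfl
  have h1 : ∀ᶠ z in 𝓝 (m, (0 : StdSpace n)), frameVector m L z.1 z.2 ∈ W := by
    refine hc.eventually ?_
    change W ∈ 𝓝 (frameVector m L m 0)
    rwa [e]
  rw [nhds_prod_eq, Filter.eventually_prod_iff] at h1
  obtain ⟨P, hP, Q, hQ, hPQ⟩ := h1
  obtain ⟨ε, hε, hεQ⟩ := Metric.eventually_nhds_iff.1 hQ
  refine ⟨ε, hε, ?_⟩
  -- In a unitary frame the length for `g_J` is the Euclidean norm of the coordinates, so a product
  -- neighbourhood in `(m', b)` is the required tube.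
  filter_upwards [hP, hL.isOpen.mem_nhds hmU] with m' hm' hm'U p hp hpε
  subst hp
  rw [← hL.frameVector_frameCoord hm'U] at hpε ⊢
  rw [hL.sqNorm_frameVector hm'U] at hpε
  refine hPQ hm' (hεQ ?_)
  rw [dist_zero_right]
  exact lt_of_pow_lt_pow_left₀ 2 hε.le hpε

theorem exists_uniform_radius [CompactSpace M] {P : M → ℝ → Prop}
    (hmono : ∀ m ε ε', ε' ≤ ε → P m ε → P m ε') (h : ∀ m, ∃ ε > 0, ∀ᶠ m' in 𝓝 m, P m' ε) :
    ∃ ε > 0, ∀ m, P m ε := by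
  choose ε hε hP using h
  obtain ⟨s, hs⟩ := CompactSpace.elim_nhds_subcover _ hP
  have key : ∀ t : Finset M, ∃ δ > 0, ∀ x ∈ t, δ ≤ ε x := by
    classical
    intro t
    induction t using Finset.induction_on with
    | empty => exact ⟨1, one_pos, by simp⟩
    | insert a t _ ih =>
      obtain ⟨δ, hδ, hδt⟩ := ih
      refine ⟨min δ (ε a), lt_min hδ (hε a), fun x hx => ?_⟩
      rcases Finset.mem_insert.1 hx with rfl | hx
      · exact min_le_right _ _
      · exact (min_le_left _ _).trans (hδt x hx)
  obtain ⟨δ, hδ, hδs⟩ := key s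
  refine ⟨δ, hδ, fun m => ?_⟩
  have hm : m ∈ ⋃ x ∈ s, {m | P m (ε x)} := hs ▸ Set.mem_univ m
  simp only [Set.mem_iUnion] at hm
  obtain ⟨x, hx, hmx⟩ := hm
  exact hmono _ _ _ (hδs x hx) hmx

/-- For a property inherited by subsets, neighbourhoods of the zero vectors having it yield a single
radius for which all discs in the fibres have it. -/
theorem exists_forall_sqNorm_lt [CompactSpace M] (J : CompatibleACS σ)
    {W : M → Set (TangentBundle (𝓡 (2 * n)) M)} {Q : Set (TangentBundle (𝓡 (2 * n)) M) → Prop}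
    (hQ : ∀ A B, A ⊆ B → Q B → Q A)
    (hW : ∀ m, W m ∈ 𝓝 (⟨m, 0⟩ : TangentBundle (𝓡 (2 * n)) M) ∧ Q (W m)) :
    ∃ ε > 0, ∀ m : M, Q {p | p.proj = m ∧ J.sqNorm p < ε ^ 2} := by
  have h : ∀ m, ∃ ε > 0, ∀ᶠ m' in 𝓝 m, 0 < ε ∧
      ∀ p : TangentBundle (𝓡 (2 * n)) M, p.proj = m' → J.sqNorm p < ε ^ 2 → p ∈ W m := fun m => by
    obtain ⟨ε, hε, h⟩ := exists_forall_sqNorm_lt_mem J (hW m).1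
    exact ⟨ε, hε, h.mono fun m' hm' => ⟨hε, hm'⟩⟩
  obtain ⟨ε, hε, hP⟩ := exists_uniform_radius
    (P := fun m ε => 0 < ε → Q {p | p.proj = m ∧ J.sqNorm p < ε ^ 2})
    (fun m ε ε' hle hP hε' => hQ _ {p | p.proj = m ∧ J.sqNorm p < ε ^ 2} (fun p hp =>
      ⟨hp.1, hp.2.trans_le (pow_le_pow_left₀ hε'.le hle 2)⟩) (hP (hε'.trans_le hle)))
    (fun m => by
      obtain ⟨ε, hε, h⟩ := h m
      refine ⟨ε, hε, h.mono fun m' hm' _ => hQ _ _ (fun p hp => hm'.2 p hp.1 hp.2) (hW m).2⟩)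
  exact ⟨ε, hε, fun m => hP m hε⟩

/-- Strict differentiability at the zero vector, with fibre derivative the identity: two nearby
vectors with the same base point and the same image differ by some `w` with `‖w‖ ≤ ‖w‖ / 2`. -/
theorem IsThickeningNear.exists_injOn {φ : TangentBundle (𝓡 (2 * n)) M → M} {m : M}
    (h : IsThickeningNear σ φ m) : ∃ W ∈ 𝓝 (⟨m, 0⟩ : TangentBundle (𝓡 (2 * n)) M),
      ∀ p ∈ W, ∀ q ∈ W, p.proj = q.proj → φ p = φ q → p = q := by
  have hms : m ∈ (baseChart (d := 2 * n) m).source := mem_extChartAt_source m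
  let F := baseChart (d := 2 * n) m ∘ φ ∘ (tangentChart m).symm
  have hle : IsLocalExpr m φ F (⟨m, 0⟩ : TangentBundle (𝓡 (2 * n)) M) := by
    have hc := h.smooth.self_of_nhds.continuousAt
    rw [ContinuousAt, h.zero.self_of_nhds] at hc
    filter_upwards [hc.eventually (baseChart_source_mem hms),
      eventually_proj_mem_source (d := 2 * n) (p := ⟨m, 0⟩) hms] with q hq hq1
    simp only [F, Function.comp_apply]
    rw [tangentChart_symm_tangentChart hq1, (baseChart m).left_inv hq]
    exact ⟨rfl, (baseChart m).map_source hq⟩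
  have hg := (hle.isThickeningNear_iff hms).1 h
  have hs := (hg.smooth.contDiffAt.hasStrictFDerivAt (by simp)).isLittleO.def
    (show (0 : ℝ) < 1 / 2 by norm_num)
  rw [nhds_prod_eq] at hs
  obtain ⟨N, hN, hNF⟩ := Filter.mem_prod_self_iff.1 hs
  rw [← tangentChart_zero hms] at hN
  refine ⟨_, Filter.inter_mem ((tangentChart_tendsto hms).eventually hN)
    (Filter.inter_mem (eventually_proj_mem_source (d := 2 * n) (p := ⟨m, 0⟩) hms) hle), ?_⟩
  rintro p ⟨hp1, hp2, hp3⟩ q ⟨hq1, hq2, hq3⟩ hpq hφ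
  have e1 : F (tangentChart m p) = F (tangentChart m q) := by
    rw [← (baseChart m).right_inv hp3.2, ← (baseChart m).right_inv hq3.2, ← hp3.1, ← hq3.1, hφ]
  have e2 : (tangentChart m p).1 = (tangentChart m q).1 := by
    obtain ⟨p0, v⟩ := p
    obtain ⟨q0, w⟩ := q
    have e := congrArg Prod.fst (tangentChart_apply (d := 2 * n) hp2 v)
    have e' := congrArg Prod.fst (tangentChart_apply (d := 2 * n) hq2 w)
    exact e.trans ((congrArg (baseChart m) hpq).trans e'.symm)
  have e3 := hNF (Set.mk_mem_prod hp1 hq1)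
  rw [Set.mem_ofPred_eq] at e3
  have e4 : tangentChart m p - tangentChart m q =
      (0, (tangentChart m p).2 - (tangentChart m q).2) :=
    Prod.ext (by simp [e2]) rfl
  simp only [e1, sub_self, zero_sub, norm_neg] at e3
  rw [e4, hg.deriv.self_of_nhds, Prod.norm_mk, norm_zero, max_eq_right (norm_nonneg _)] at e3
  have e5 : (tangentChart m p).2 - (tangentChart m q).2 = 0 := by
    rw [← norm_le_zero_iff]; linarith
  exact (tangentChart m).injOn (tangentChart_mem_source.2 hp2) (tangentChart_mem_source.2 hq2)
    (Prod.ext e2 (sub_eq_zero.1 e5))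

end UniformRadius

/-! ### Symplectic embeddings of balls of uniform radius -/

section Thickening

theorem hasMFDerivAt_opens_val {V : Type*} [NormedAddCommGroup V] [NormedSpace ℝ V] (U : Opens V)
    (b : U) : HasMFDerivAt 𝓘(ℝ, V) 𝓘(ℝ, V) (Subtype.val : U → V) b (.id ℝ V) := by
  refine ⟨continuous_subtype_val.continuousAt, ?_⟩
  have h : writtenInExtChartAt 𝓘(ℝ, V) 𝓘(ℝ, V) b (Subtype.val : U → V) =ᶠ[𝓝 (b : V)] id := by
    have h1 := U.chartAt_subtype_val_symm_eventuallyEq (H := V) (x := b)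
    simp only [chartAt_self_eq] at h1
    filter_upwards [h1] with w hw
    simpa [chartAt_self_eq] using hw.symm
  exact ((hasFDerivAt_id (b : V)).congr_of_eventuallyEq h).hasFDerivWithinAt

variable {n : ℕ} {M : Type*} [TopologicalSpace M] [ChartedSpace (Coord (2 * n)) M]
  [IsManifold (𝓡 (2 * n)) ∞ M] {σ : SymplecticForm n M}

theorem contMDiff_fibre {d : ℕ} {M : Type*} [TopologicalSpace M] [ChartedSpace (Coord d) M]
    [IsManifold (𝓡 d) ∞ M] (m : M) : ContMDiff 𝓘(ℝ, Coord d) (𝓡 d).tangent ∞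
      (fun w : Coord d => (⟨m, w⟩ : TangentBundle (𝓡 d) M)) := by
  intro v
  have hm : m ∈ (baseChart (d := d) m).source := mem_extChartAt_source m
  have h1 : ContMDiffAt 𝓘(ℝ, Coord d) 𝓘(ℝ, Coord d × Coord d) ∞
      (fun w : Coord d => (baseChart (d := d) m m, chartDeriv (d := d) m m w)) v :=
    (contDiff_const.prodMk (chartDeriv m m).contDiff).contMDiff.contMDiffAt
  refine (ContMDiffAt.comp v (tangentChart_symm_contMDiffAt
    (z := (baseChart m m, chartDeriv m m v)) ((baseChart m).map_source hm)) h1).congr_of_eventuallyEq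
    (Filter.Eventually.of_forall fun w => ?_)
  have e := tangentChart_apply (d := d) hm w
  rw [Function.comp_apply, ← e]
  exact (tangentChart_symm_tangentChart (p := ⟨m, w⟩) hm).symm

/-- `φ` restricts to symplectic embeddings of the balls of radius less than `r` in the tangent
spaces. -/
structure IsThickeningOn (J : CompatibleACS σ) (φ : TangentBundle (𝓡 (2 * n)) M → M) (r : ℝ) :
    Prop where
  zero : ∀ m, φ ⟨m, 0⟩ = m
  smooth : ∀ p, J.sqNorm p < r ^ 2 → ContMDiffAt (𝓡 (2 * n)).tangent (𝓡 (2 * n)) ∞ φ p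
  symplectic : ∀ p, J.sqNorm p < r ^ 2 → ∀ a b : Coord (2 * n),
    σ.form (φ p) (fibreDeriv φ p a) (fibreDeriv φ p b) = σ.form p.proj a b
  injective : ∀ p q, J.sqNorm p < r ^ 2 → J.sqNorm q < r ^ 2 → p.proj = q.proj → φ p = φ q → p = q

theorem exists_isThickeningOn [CompactSpace M] (J : CompatibleACS σ)
    {φ : TangentBundle (𝓡 (2 * n)) M → M} (hφ : ∀ m, IsThickeningNear σ φ m) :
    ∃ r > 0, IsThickeningOn J φ r := by
  choose W hW hinj using fun m => (hφ m).exists_injOn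
  obtain ⟨r₁, h₁, H₁⟩ := exists_forall_sqNorm_lt J (W := W)
    (Q := fun W => ∀ p ∈ W, ∀ q ∈ W, p.proj = q.proj → φ p = φ q → p = q)
    (fun A B hAB hB p hp q hq => hB p (hAB hp) q (hAB hq)) (fun m => ⟨hW m, hinj m⟩)
  obtain ⟨r₂, h₂, H₂⟩ := exists_forall_sqNorm_lt J
    (W := fun _ => {p | ContMDiffAt (𝓡 (2 * n)).tangent (𝓡 (2 * n)) ∞ φ p ∧
      ∀ a b : Coord (2 * n),
        σ.form (φ p) (fibreDeriv φ p a) (fibreDeriv φ p b) = σ.form p.proj a b})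
    (Q := fun W => ∀ p ∈ W, ContMDiffAt (𝓡 (2 * n)).tangent (𝓡 (2 * n)) ∞ φ p ∧
      ∀ a b : Coord (2 * n),
        σ.form (φ p) (fibreDeriv φ p a) (fibreDeriv φ p b) = σ.form p.proj a b)
    (fun A B hAB hB p hp => hB p (hAB hp))
    (fun m => ⟨(hφ m).smooth.and (hφ m).symplectic, fun p hp => hp⟩)
  have hr : 0 < min r₁ r₂ := lt_min h₁ h₂
  have e₁ : min r₁ r₂ ^ 2 ≤ r₁ ^ 2 := pow_le_pow_left₀ hr.le (min_le_left _ _) 2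
  have e₂ : min r₁ r₂ ^ 2 ≤ r₂ ^ 2 := pow_le_pow_left₀ hr.le (min_le_right _ _) 2
  exact ⟨min r₁ r₂, hr, fun m => (hφ m).zero.self_of_nhds,
    fun p hp => (H₂ p.proj p ⟨rfl, hp.trans_le e₂⟩).1,
    fun p hp => (H₂ p.proj p ⟨rfl, hp.trans_le e₂⟩).2,
    fun p q hp hq hpq => H₁ q.proj p ⟨hpq, hp.trans_le e₁⟩ q ⟨rfl, hq.trans_le e₁⟩ hpq⟩

/-- Because `ε < r` is strict, the fibre map is defined, continuous and injective on the closed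
`ε`-ball. That ball is compact and `M` is Hausdorff, so the map is a homeomorphism onto its image,
also after restriction to the open ball. -/
theorem IsThickeningOn.isSymplecticEmbedding [T2Space M] {J : CompatibleACS σ}
    {φ : TangentBundle (𝓡 (2 * n)) M → M} {r : ℝ} (h : IsThickeningOn J φ r) {ε : ℝ}
    (hεr : ε < r) {m : M} {L : StdSpace n ≃L[ℝ] TangentSpace (𝓡 (2 * n)) m}
    (hL : IsUnitaryFrame J m L) :
    IsSymplecticEmbedding σ (fun b : stdBall n ε => φ ⟨m, L b⟩) := by
  let L' : StdSpace n →L[ℝ] Coord (2 * n) := (L : StdSpace n →L[ℝ] TangentSpace (𝓡 (2 * n)) m)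
  have hsq : ∀ b, J.sqNorm ⟨m, L' b⟩ = ‖b‖ ^ 2 := fun b => by
    rw [← stdForm_stdJ, ← hL.form, hL.complex]; rfl
  have hlt : ∀ b : StdSpace n, ‖b‖ ≤ ε → J.sqNorm ⟨m, L' b⟩ < r ^ 2 := fun b hb => by
    rw [hsq]
    exact pow_lt_pow_left₀ (hb.trans_lt hεr) (norm_nonneg _) two_ne_zero
  have hsm : ∀ b : StdSpace n, ‖b‖ ≤ ε → ContMDiffAt 𝓘(ℝ, StdSpace n) (𝓡 (2 * n)) ∞
      (fun b : StdSpace n => φ ⟨m, L' b⟩) b := fun b hb => by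
    have h1 : ContMDiffAt 𝓘(ℝ, StdSpace n) (𝓡 (2 * n)).tangent ∞
        (fun b : StdSpace n => (⟨m, L' b⟩ : TangentBundle (𝓡 (2 * n)) M)) b :=
      ContMDiffAt.comp (g := fun w : Coord (2 * n) => (⟨m, w⟩ : TangentBundle (𝓡 (2 * n)) M)) b
        (contMDiff_fibre m).contMDiffAt L'.contDiff.contMDiff.contMDiffAt
    exact ContMDiffAt.comp (g := φ) b (h.smooth _ (hlt b hb)) h1
  have hball : ∀ b : stdBall n ε, ‖(b : StdSpace n)‖ ≤ ε := fun b => (mem_ball_zero_iff.1 b.2).le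
  refine ⟨fun b => ?_, ?_, fun b u v => ?_⟩
  · exact ContMDiffAt.comp (g := fun b : StdSpace n => φ ⟨m, L' b⟩) b (hsm b (hball b))
      contMDiff_subtype_val.contMDiffAt
  · let g : Metric.closedBall (0 : StdSpace n) ε → M := fun b => φ ⟨m, L' b⟩
    have hle : ∀ b : Metric.closedBall (0 : StdSpace n) ε, ‖(b : StdSpace n)‖ ≤ ε :=
      fun b => mem_closedBall_zero_iff.1 b.2
    have hg : Continuous g := continuous_iff_continuousAt.2 fun b =>
      (hsm b (hle b)).continuousAt.comp continuous_subtype_val.continuousAt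
    have hinj : Function.Injective g := fun b c hbc => by
      have := h.injective _ _ (hlt b (hle b)) (hlt c (hle c)) rfl hbc
      exact Subtype.ext (L.injective (TotalSpace.mk_inj.1 this))
    have : CompactSpace (Metric.closedBall (0 : StdSpace n) ε) :=
      isCompact_iff_compactSpace.1 (isCompact_closedBall _ _)
    exact (hg.isClosedEmbedding hinj).isEmbedding.comp
      (IsEmbedding.inclusion (Metric.ball_subset_closedBall (x := (0 : StdSpace n)) (ε := ε)))
  · have hd : HasMFDerivAt 𝓘(ℝ, StdSpace n) (𝓡 (2 * n)) (fun b : StdSpace n => φ ⟨m, L' b⟩)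
        (b : StdSpace n) ((fibreDeriv φ ⟨m, L' b⟩).comp L') := by
      have h1 : ContMDiffAt 𝓘(ℝ, Coord (2 * n)) (𝓡 (2 * n)) ∞
          (fun w : Coord (2 * n) => φ ⟨m, w⟩) (L' b) :=
        ContMDiffAt.comp (g := φ) _ (h.smooth _ (hlt b (hball b))) (contMDiff_fibre m).contMDiffAt
      exact HasMFDerivAt.comp (b : StdSpace n) (g := fun w : Coord (2 * n) => φ ⟨m, w⟩)
        (h1.mdifferentiableAt (by simp)).hasMFDerivAt L'.hasFDerivAt.hasMFDerivAt
    have hd' := (hd.comp b (hasMFDerivAt_opens_val (stdBall n ε) b)).mfderiv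
    have e : ∀ u : StdSpace n, mfderiv 𝓘(ℝ, StdSpace n) (𝓡 (2 * n))
        (fun b : stdBall n ε => φ ⟨m, L b⟩) b u = fibreDeriv φ ⟨m, L' b⟩ (L' u) :=
      fun u => DFunLike.congr_fun hd' u
    rw [e, e, ← hL.form]
    exact h.symplectic _ (hlt b (hball b)) _ _

theorem IsThickeningOn.isThickening [T2Space M] {J : CompatibleACS σ}
    {φ : TangentBundle (𝓡 (2 * n)) M → M} {r : ℝ} (h : IsThickeningOn J φ r) {ε : ℝ} (hε : 0 < ε)
    (hεr : ε < r) : IsThickening J hε (fun p : discBundle J ε => φ p) where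
  smooth p := ContMDiffAt.comp p (h.smooth p (lt_trans p.2
    (pow_lt_pow_left₀ hεr hε.le two_ne_zero))) contMDiff_subtype_val.contMDiffAt
  zero m := h.zero m
  fibre _ _ hL := h.isSymplecticEmbedding hεr hL

end Thickening

/-! ### Continuous twisted families -/

section TwistedFamilies

variable {n : ℕ} {M : Type*} [TopologicalSpace M] [ChartedSpace (Coord (2 * n)) M]
  [IsManifold (𝓡 (2 * n)) ∞ M] {σ : SymplecticForm n M}

open Classical in
/-- The point of the ball given by a vector of length less than `ε`, and the centre otherwise. -/
def toBall (n : ℕ) {ε : ℝ} (hε : 0 < ε) (b : StdSpace n) : stdBall n ε :=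
  if h : b ∈ stdBall n ε then ⟨b, h⟩ else ⟨0, Metric.mem_ball_self hε⟩

theorem coe_toBall {ε : ℝ} (hε : 0 < ε) {b : StdSpace n} (h : b ∈ stdBall n ε) :
    (toBall n hε b : StdSpace n) = b := by
  rw [toBall, dif_pos h]

variable {J : CompatibleACS σ} {x : M} {U : Set M}
  {L : Coord (2 * n) → StdSpace n →L[ℝ] Coord (2 * n)} {ε : ℝ}

namespace IsUnitaryFrameOn

theorem frameVector_mem (h : IsUnitaryFrameOn J x U L) {m : M} (hm : m ∈ U) (b : stdBall n ε) :
    frameVector x L m b ∈ discBundle J ε := by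
  change J.sqNorm _ < ε ^ 2
  rw [h.sqNorm_frameVector hm]
  exact pow_lt_pow_left₀ (mem_ball_zero_iff.1 b.2) (norm_nonneg _) two_ne_zero

theorem frameCoord_mem (h : IsUnitaryFrameOn J x U L) (hε : 0 < ε)
    {p : TangentBundle (𝓡 (2 * n)) M} (hp : p.proj ∈ U) (hpε : p ∈ discBundle J ε) :
    frameCoord x L p ∈ stdBall n ε := by
  refine mem_ball_zero_iff.2 (lt_of_pow_lt_pow_left₀ 2 hε.le ?_)
  rw [← h.sqNorm_frameVector hp, h.frameVector_frameCoord hp]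
  exact hpε

variable {X K : Type*} [TopologicalSpace X] [FunLike K X M] [ContinuousMapClass K X M]

open Classical in
/-- The vector with coordinates `b` in the frame `L`, as a point of the pulled back disc bundle. -/
def pullbackVector (h : IsUnitaryFrameOn J x U L) (hε : 0 < ε) (f : K) (y : X)
    (b : stdBall n ε) : pullbackDisc J ε f :=
  if hy : f y ∈ U then ⟨⟨y, (frameVector x L (f y) b).2⟩, h.frameVector_mem hy b⟩
  else ⟨⟨y, (0 : Coord (2 * n))⟩, (discZero J hε (f y)).2⟩

theorem pullbackVector_proj (h : IsUnitaryFrameOn J x U L) (hε : 0 < ε) (f : K) (y : X)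
    (b : stdBall n ε) : (h.pullbackVector hε f y b).1.proj = y := by
  rw [pullbackVector]; split_ifs <;> rfl

theorem lift_pullbackVector (h : IsUnitaryFrameOn J x U L) (hε : 0 < ε) (f : K) {y : X}
    (hy : f y ∈ U) (b : stdBall n ε) :
    Pullback.lift f (h.pullbackVector hε f y b).1 = frameVector x L (f y) b := by
  rw [pullbackVector, dif_pos hy]; rfl

theorem continuousOn_frameVector (h : IsUnitaryFrameOn J x U L) (f : K) :
    ContinuousOn (fun z : X × stdBall n ε => frameVector x L (f z.1) z.2)
      ((f ⁻¹' U) ×ˢ Set.univ) := by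
  rintro ⟨y, b⟩ ⟨hy, -⟩
  have h1 := (h.contMDiffAt_frameVector (m := f y) hy (b : StdSpace n)).continuousAt
  have h2 : ContinuousAt (fun z : X × stdBall n ε => (f z.1, (z.2 : StdSpace n))) (y, b) :=
    (((map_continuous f).comp continuous_fst).prodMk
      (continuous_subtype_val.comp continuous_snd)).continuousAt
  exact (ContinuousAt.comp (g := fun z : M × StdSpace n => frameVector x L z.1 z.2)
    (f := fun z : X × stdBall n ε => (f z.1, (z.2 : StdSpace n))) (x := (y, b)) h1 h2).continuousWithinAt

theorem continuousOn_frameCoord (h : IsUnitaryFrameOn J x U L) :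
    ContinuousOn (frameCoord x L) {p : TangentBundle (𝓡 (2 * n)) M | p.proj ∈ U} := fun _ hp =>
  (h.contMDiffAt_frameCoord hp).continuousAt.continuousWithinAt

/-- The local trivialization of the pulled back disc bundle given by a unitary frame. -/
def discTrivialization (h : IsUnitaryFrameOn J x U L) (hε : 0 < ε) (f : K) :
    Trivialization (stdBall n ε) (pullbackDiscProj J ε f) where
  -- The default values in `toBall` and `pullbackVector` are never reached over `f ⁻¹' U`, since the
  -- frame is isometric there.
  toFun p := (p.1.proj, toBall n hε (frameCoord x L (Pullback.lift f p.1)))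
  invFun z := h.pullbackVector hε f z.1 z.2
  source := pullbackDiscProj J ε f ⁻¹' (f ⁻¹' U)
  target := (f ⁻¹' U) ×ˢ Set.univ
  baseSet := f ⁻¹' U
  map_source' p hp := ⟨hp, Set.mem_univ _⟩
  map_target' z hz := by
    change f (h.pullbackVector hε f z.1 z.2).1.proj ∈ U
    rw [h.pullbackVector_proj]
    exact hz.1
  left_inv' p hp := by
    obtain ⟨⟨y, v⟩, hpε⟩ := p
    have hp' : f y ∈ U := hp
    have e := h.frameVector_frameCoord (p := ⟨f y, v⟩) hp'
    have e2 : (frameVector x L (f y) (frameCoord x L ⟨f y, v⟩)).2 = v := TotalSpace.mk_inj.1 e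
    apply Subtype.ext
    simp only [pullbackVector, dif_pos hp']
    rw [coe_toBall hε (h.frameCoord_mem hε hp' hpε)]
    exact congrArg (TotalSpace.mk y) e2
  right_inv' z hz := by
    refine Prod.ext (h.pullbackVector_proj hε f _ _) (Subtype.ext ?_)
    have e : frameCoord x L (Pullback.lift f (h.pullbackVector hε f z.1 z.2).1) = z.2 := by
      rw [h.lift_pullbackVector hε f hz.1, h.frameCoord_frameVector hz.1]
    change (toBall n hε _ : StdSpace n) = z.2
    rw [e, coe_toBall hε z.2.2]
  open_source := h.isOpen.preimage ((map_continuous f).comp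
    ((Pullback.continuous_proj _ _ _).comp continuous_subtype_val))
  open_target := (h.isOpen.preimage (map_continuous f)).prod isOpen_univ
  continuousOn_toFun := by
    refine ContinuousOn.prodMk ((Pullback.continuous_proj _ _ _).comp
      continuous_subtype_val).continuousOn (IsInducing.subtypeVal.continuousOn_iff.2 ?_)
    refine ContinuousOn.congr (f := fun p : pullbackDisc J ε f =>
      frameCoord x L (Pullback.lift f p.1)) ?_ fun p hp =>
        coe_toBall hε (h.frameCoord_mem hε hp p.2)
    exact h.continuousOn_frameCoord.comp ((Pullback.continuous_lift _ _ _).comp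
      continuous_subtype_val).continuousOn fun p hp => hp
  continuousOn_invFun := by
    -- The total space of the pull-back carries the topology induced from `X` and `TM`, so
    -- continuity is checked on the projection and on the lift.
    refine IsInducing.subtypeVal.continuousOn_iff.2
      ((inducing_pullbackTotalSpaceEmbedding _ _ _).continuousOn_iff.2 ?_)
    refine ContinuousOn.prodMk ?_ ?_
    · exact continuous_fst.continuousOn.congr fun z hz => h.pullbackVector_proj hε f _ _
    · exact (h.continuousOn_frameVector f).congr fun z hz => h.lift_pullbackVector hε f hz.1 _
  open_baseSet := h.isOpen.preimage (map_continuous f)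
  source_eq := rfl
  target_eq := rfl
  proj_toFun _ _ := rfl

theorem exists_isUnitaryFrame (h : IsUnitaryFrameOn J x U L) {m : M} (hm : m ∈ U) :
    ∃ L' : StdSpace n ≃L[ℝ] TangentSpace (𝓡 (2 * n)) m, IsUnitaryFrame J m L' ∧
      ∀ b, L' b = (frameVector x L m b).2 := by
  obtain ⟨L', hL'⟩ := exists_equiv_of_form (E := Coord (2 * n)) (B := σ.formAt m) (by simp)
    ((chartSymmDeriv x (baseChart x m)).comp (L (baseChart x m))) (h.form m hm)
  have e : ∀ b, L' b = (frameVector x L m b).2 := fun b => DFunLike.congr_fun hL' b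
  refine ⟨L', ⟨fun u v => ?_, fun v => ?_⟩, e⟩
  · exact (congrArg₂ (fun a b : Coord (2 * n) => σ.formAt m a b) (e u) (e v)).trans
      (h.form m hm u v)
  · exact (e _).trans ((h.complex m hm v).trans (congrArg (J.J m) (e v).symm))

/-- On each fibre the trivialization is the identification by a unitary frame, so the fibre
condition of a thickening applies verbatim. -/
theorem isSymplecticEmbedding_discTrivialization (h : IsUnitaryFrameOn J x U L) (hε : 0 < ε)
    (f : K) {φ : discBundle J ε → M} (hφ : IsThickening J hε φ) {y : X} (hy : f y ∈ U) :
    IsSymplecticEmbedding σ (fun b => (φ ∘ pullbackDiscLift J ε f)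
      ((h.discTrivialization hε f).toOpenPartialHomeomorph.symm (y, b))) := by
  obtain ⟨L', hL', e⟩ := h.exists_isUnitaryFrame hy
  have := hφ.fibre _ L' hL'
  convert this using 1
  funext b
  refine congrArg φ (Subtype.ext ?_)
  exact (h.lift_pullbackVector hε f hy b).trans (congrArg (TotalSpace.mk (f y)) (e b).symm)

end IsUnitaryFrameOn

theorem IsThickening.isTwistedFamily {hε : 0 < ε} {φ : discBundle J ε → M}
    (hφ : IsThickening J hε φ) {X : Type*} [TopologicalSpace X] (f : C(X, M)) :
    IsTwistedFamily σ ε (pullbackDiscProj J ε f) (φ ∘ pullbackDiscLift J ε f) where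
  continuous := hφ.smooth.continuous.comp
    (((Pullback.continuous_lift _ _ _).comp continuous_subtype_val).subtype_mk _)
  locallyTrivial y := by
    obtain ⟨U, L, hU, h⟩ := exists_isUnitaryFrameOn J (f y)
    exact ⟨h.discTrivialization hε f, hU,
      fun _ hy => h.isSymplecticEmbedding_discTrivialization hε f hφ hy⟩

end TwistedFamilies

/-! ### Smooth twisted families -/

section SmoothTwistedFamilies

variable {n : ℕ} {M : Type*} [TopologicalSpace M] [ChartedSpace (Coord (2 * n)) M]
  [IsManifold (𝓡 (2 * n)) ∞ M] {σ : SymplecticForm n M}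
  {EX HX X : Type*} [NormedAddCommGroup EX] [NormedSpace ℝ EX] [TopologicalSpace HX]
  {IX : ModelWithCorners ℝ EX HX} [TopologicalSpace X] [ChartedSpace HX X]

/-- The trivializations of the pull-back bundle are those of `TM` composed with the lift, so the
fibre components coincide; the base component of the lift is `f` of the projection, which is
automatically smooth. -/
theorem contMDiffAt_pullback_iff {EN HN N : Type*} [NormedAddCommGroup EN] [NormedSpace ℝ EN]
    [TopologicalSpace HN] {IN : ModelWithCorners ℝ EN HN} [TopologicalSpace N]
    [ChartedSpace HN N] (f : C^∞⟮IX, X; 𝓡 (2 * n), M⟯)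
    {g : N → TotalSpace (Coord (2 * n))
      ((f : X → M) *ᵖ (TangentSpace (𝓡 (2 * n)) : M → Type))} {z : N} :
    ContMDiffAt IN (IX.prod (𝓡 (2 * n))) ∞ g z ↔
      ContMDiffAt IN IX ∞ (fun w => (g w).proj) z ∧
      ContMDiffAt IN (𝓡 (2 * n)).tangent ∞ (fun w => Pullback.lift f (g w)) z := by
  rw [contMDiffAt_totalSpace, contMDiffAt_totalSpace]
  refine and_congr_right fun h => ⟨fun h2 => ⟨?_, h2⟩, fun h2 => h2.2⟩
  exact ContMDiffAt.comp (g := f) z f.contMDiff.contMDiffAt h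

variable {J : CompatibleACS σ} {x : M} {U : Set M}
  {L : Coord (2 * n) → StdSpace n →L[ℝ] Coord (2 * n)} {ε : ℝ}

theorem contMDiff_lift (f : C^∞⟮IX, X; 𝓡 (2 * n), M⟯) :
    ContMDiff (IX.prod (𝓡 (2 * n))) (𝓡 (2 * n)).tangent ∞
      (Pullback.lift (F := Coord (2 * n)) (E := (TangentSpace (𝓡 (2 * n)) : M → Type)) f) :=
  fun _ => ((contMDiffAt_pullback_iff f).1 contMDiffAt_id).2

theorem contMDiff_pullbackDiscLift (f : C^∞⟮IX, X; 𝓡 (2 * n), M⟯) :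
    ContMDiff (IX.prod (𝓡 (2 * n))) (𝓡 (2 * n)).tangent ∞ (pullbackDiscLift J ε f) := by
  rw [← ContMDiff.subtypeVal_comp_iff]
  exact (contMDiff_lift f).comp contMDiff_subtype_val

namespace IsUnitaryFrameOn

theorem contMDiffOn_discTrivialization (h : IsUnitaryFrameOn J x U L) (hε : 0 < ε)
    (f : C^∞⟮IX, X; 𝓡 (2 * n), M⟯) :
    ContMDiffOn (IX.prod (𝓡 (2 * n))) (IX.prod 𝓘(ℝ, StdSpace n)) ∞ (h.discTrivialization hε f)
      (h.discTrivialization hε f).source := by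
  have hval : ContMDiff (IX.prod (𝓡 (2 * n))) (IX.prod (𝓡 (2 * n))) ∞
    (Subtype.val : pullbackDisc J ε f → _) := contMDiff_subtype_val
  refine ContMDiffOn.prodMk (f := fun p : pullbackDisc J ε f => p.1.proj)
    (g := fun p : pullbackDisc J ε f => toBall n hε (frameCoord x L (Pullback.lift f p.1)))
    ?_ fun p hp => ?_
  · exact ((contMDiff_proj _).comp hval).contMDiffOn
  · rw [← ContMDiffWithinAt.subtypeVal_comp_iff]
    have h1 : ContMDiffAt (IX.prod (𝓡 (2 * n))) 𝓘(ℝ, StdSpace n) ∞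
        (fun p : pullbackDisc J ε f => frameCoord x L (Pullback.lift f p.1)) p :=
      ContMDiffAt.comp (g := frameCoord x L)
        (f := fun p : pullbackDisc J ε f => Pullback.lift f p.1) p (h.contMDiffAt_frameCoord hp)
        ((contMDiff_lift f).comp hval).contMDiffAt
    exact h1.contMDiffWithinAt.congr
      (fun q hq => coe_toBall hε (h.frameCoord_mem hε hq q.2))
      (coe_toBall hε (h.frameCoord_mem hε hp p.2))

theorem contMDiffOn_discTrivialization_symm (h : IsUnitaryFrameOn J x U L) (hε : 0 < ε)
    (f : C^∞⟮IX, X; 𝓡 (2 * n), M⟯) :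
    ContMDiffOn (IX.prod 𝓘(ℝ, StdSpace n)) (IX.prod (𝓡 (2 * n))) ∞
      (h.discTrivialization hε f).toOpenPartialHomeomorph.symm
      (h.discTrivialization hε f).target := by
  rintro ⟨y, b⟩ hz
  have hy : f y ∈ U := hz.1
  refine ContMDiffAt.contMDiffWithinAt ?_
  rw [← ContMDiffAt.subtypeVal_comp_iff, contMDiffAt_pullback_iff]
  constructor
  · refine ContMDiffAt.congr_of_eventuallyEq contMDiffAt_fst
      (Filter.Eventually.of_forall fun z => ?_)
    exact h.pullbackVector_proj hε f _ _
  · have h1 : ContMDiffAt (IX.prod 𝓘(ℝ, StdSpace n)) (𝓡 (2 * n)) ∞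
        (fun z : X × stdBall n ε => f z.1) (y, b) :=
      ContMDiffAt.comp (g := f) _ f.contMDiff.contMDiffAt contMDiffAt_fst
    have h2 : ContMDiffAt (IX.prod 𝓘(ℝ, StdSpace n)) 𝓘(ℝ, StdSpace n) ∞
        (fun z : X × stdBall n ε => (z.2 : StdSpace n)) (y, b) :=
      ContMDiffAt.comp (g := (Subtype.val : stdBall n ε → StdSpace n)) _
        contMDiff_subtype_val.contMDiffAt contMDiffAt_snd
    have h3 : ContMDiffAt (IX.prod 𝓘(ℝ, StdSpace n)) (𝓡 (2 * n)).tangent ∞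
        (fun z : X × stdBall n ε => frameVector x L (f z.1) z.2) (y, b) :=
      ContMDiffAt.comp (g := fun z : M × StdSpace n => frameVector x L z.1 z.2)
        (f := fun z : X × stdBall n ε => (f z.1, (z.2 : StdSpace n))) (y, b)
        (h.contMDiffAt_frameVector hy b) (h1.prodMk h2)
    refine h3.congr_of_eventuallyEq ?_
    filter_upwards [((map_continuous f).comp continuous_fst).continuousAt.eventually
      (h.isOpen.mem_nhds hy)] with z hz
    exact h.lift_pullbackVector hε f hz _

end IsUnitaryFrameOn

theorem IsThickening.isSmoothTwistedFamily {hε : 0 < ε} {φ : discBundle J ε → M}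
    (hφ : IsThickening J hε φ) (f : C^∞⟮IX, X; 𝓡 (2 * n), M⟯) :
    IsSmoothTwistedFamily σ ε IX (IX.prod (𝓡 (2 * n)))
      (pullbackDiscProj J ε f) (φ ∘ pullbackDiscLift J ε f) where
  smooth := hφ.smooth.comp (contMDiff_pullbackDiscLift f)
  locallyTrivial y := by
    obtain ⟨U, L, hU, h⟩ := exists_isUnitaryFrameOn J (f y)
    exact ⟨h.discTrivialization hε f, hU, h.contMDiffOn_discTrivialization hε f,
      h.contMDiffOn_discTrivialization_symm hε f,
      fun _ hy => h.isSymplecticEmbedding_discTrivialization hε f hφ hy⟩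

end SmoothTwistedFamilies

end

/-! ### The main theorem -/

theorem corollaryC (n : ℕ) (M : Type*) [TopologicalSpace M] [T2Space M] [CompactSpace M]
    [ChartedSpace (EuclideanSpace ℝ (Fin (2 * n))) M] [IsManifold (𝓡 (2 * n)) ∞ M]
    (σ : SymplecticForm n M) :
    Nonempty (CompatibleACS σ) ∧
    ∀ J : CompatibleACS σ, ∃ ε₀ : ℝ, 0 < ε₀ ∧ ∀ (ε : ℝ) (hε : 0 < ε), ε ≤ ε₀ →
      ∃ φ : discBundle J ε → M, IsThickening J hε φ ∧
        (∀ (X : Type*) [TopologicalSpace X] (f : C(X, M)),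
          IsTwistedFamily σ ε (pullbackDiscProj J ε f) (φ ∘ pullbackDiscLift J ε f)) ∧
        (∀ (EX HX X : Type*) [NormedAddCommGroup EX] [NormedSpace ℝ EX] [TopologicalSpace HX]
          (IX : ModelWithCorners ℝ EX HX) [TopologicalSpace X] [ChartedSpace HX X]
          [IsManifold IX ∞ X] (f : C^∞⟮IX, X; 𝓡 (2 * n), M⟯),
          IsSmoothTwistedFamily σ ε IX (IX.prod (𝓡 (2 * n)))
            (pullbackDiscProj J ε f) (φ ∘ pullbackDiscLift J ε f)) := by
  refine ⟨exists_compatibleACS σ, fun J => ?_⟩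
  obtain ⟨φ, hφ⟩ := exists_isThickeningNear σ
  obtain ⟨r, hr, h⟩ := exists_isThickeningOn J hφ
  -- Halving ensures `ε < r`, as the closed `ε`-balls must lie in the region where `φ` is
  -- controlled. The same `φ` then serves all `ε`.
  refine ⟨r / 2, half_pos hr, fun ε hε hεr => ?_⟩
  have hT := h.isThickening hε (hεr.trans_lt (half_lt_self hr))
  refine ⟨_, hT, ?_, ?_⟩
  · intro X _ f
    exact hT.isTwistedFamily f
  · intro EX HX X _ _ _ IX _ _ _ f
    exact hT.isSmoothTwistedFamily f
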